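/- **Setting.** Let $M$ be a smooth (finite-dimensional, Hausdorff, second countable) manifold. An *almost Lie algebroid* $(A,[\cdot,\cdot],\bar\rho)$ over $M$ is a smooth vector bundle $\tau:A\to M$ of finite rank with a vector bundle morphism $\bar\rho:A\to TM$ over the identity (the anchor) and an $\mathbb R$-bilinear skew-symmetric bracket on $\Gamma(A)$ such that, for all $X,Y\in\Gamma(A)$ and $f\in C^\infty(M)$, $$[X,fY]=f[X,Y]+\bar\rho(X)(f)\,Y,\qquad \bar\rho([X,Y])=[\bar\rho(X),\bar\rho(Y)]$$ (the Jacobi identity is not assumed). *The graded bundles $A^n$.* A curve $\gamma$ in $A$ is admissible if $\bar\rho\circ\gamma$ is the tangent lift of $\tau\circ\gamma$. $A^n$ is the manifold of $(n-1)$-jets at $0$ of admissible curves, with projection $\bar\tau:A^n\to M$ (so $A^1=A$; put $A^0=M$). Linear adapted coordinates $(x,y)$ on $A$ give coordinates $(x,y_1,\dots,y_n)$ on $A^n$, where $y_{j+1}$ is the $j$-th derivative of $y$ along the curve at $0$. The homogeneity structure $h_t:A^n\to A^n$, $t\in\mathbb R$, sends the jet of $\gamma$ to the jet of $s\mapsto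 t\,\gamma(ts)$; so $x$ has weight $0$ and $y_w$ has weight $w$. *The bundle $D(A^k)$.* For $k\ge1$ let $$D(A^k)=\{(Y,Z)\in A\times_M TA^{k-1}\;:\;\bar\rho(Y)=T\bar\tau(Z)\},$$ a vector bundle over $A^{k-1}$ (the projection being that of $Z$), with the maps $H_t(Y,Z)=(Y,Th_t(Z))$ over $h_t$. A section of $D(A^k)$ is *projectable* if it is of the form $q\mapsto (X(\bar\tau(q)),V(q))$ with $X\in\Gamma(A)$; then $V$ is a vector field on $A^{k-1}$ which projects to $\bar\rho(X)$. *Weighted skew algebroids.* A $\mathcal{GL}$-bundle of degree $k$ is a vector bundle $D\to N$ with a smooth action $t\mapsto H_t$ of the monoid $(\mathbb R,\cdot)$ by vector bundle morphisms, over maps $h_t$ of $N$, such that around every point of $N$ there are homogeneous local coordinates of $N$ and homogeneous fibrewise linear coordinates of $D$, all of weights in $\{0,\dots,k-1\}$; the second weight is given by multiplication in the fibres. On $D^*$ consider, for $t\ne0$, the maps $\xi\mapsto t^{k-1}\,\xi\circ H_t^{-1}$ and the multiplication in the fibres. $T^*D$ carries three weights, given by the following maps ($t,s\neq 0$): (1)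 the phase lift of $H_t$ multiplied by $t^{k-1}$; (2) the multiplication by $s$ in the fibres of $T^*D\to D^*$; (3) the multiplication by $s$ in the fibres of $T^*D\to D$. $TD^*$ carries the three corresponding weights: (1) the tangent lift of $\xi\mapsto t^{k-1}\,\xi\circ H_t^{-1}$; (2) the multiplication by $s$ in the fibres of $TD^*\to D^*$; (3) the multiplication by $s$ in the fibres of $TD^*\to TN$. A *weighted algebroid* structure on $D$ is a smooth map $\epsilon:T^*D\to TD^*$ covering the identity of $D^*$ which intertwines these three pairs of weights. Its *anchor* $\rho:D\to TN$ is the map underlying $\epsilon$. With the canonical isomorphism $\mathcal R:T^*D\to T^*D^*$, $(x,y,p,\xi)\mapsto(x,\xi,-p,y)$, it defines the 2-contravariant tensor $\Lambda_\epsilon(\mathcal R\alpha,\mathcal R\alpha')=\langle \mathcal R\alpha',\epsilon(\alpha)\rangle$ on $D^*$; the weighted algebroid is *skew* if $\Lambda_\epsilon$ is a bivector field. The bracket of sections of $D$ is given by $\iota_{[S,S']}=\Lambda_\epsilon(d\iota_S,d\iota_{S'})$, where $\iota_S$ is the linear function on $D^*$ defined by $S$. **Theorem.** Let $(A,[\cdot,\cdot],\bar\rho)$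 be an almost Lie algebroid and let $k\ge1$. Then $D(A^k)$, with the maps $H_t$, is a $\mathcal{GL}$-bundle of degree $k$, and it carries a weighted skew algebroid structure $\epsilon:T^*D(A^k)\to TD^*(A^k)$ whose anchor is $\rho(Y,Z)=Z$ and whose bracket of projectable sections is $$\big[(X\circ\bar\tau,V),(X'\circ\bar\tau,V')\big]=\big([X,X']\circ\bar\tau,\,[V,V']\big),$$ where $[V,V']$ is the Lie bracket of vector fields on $A^{k-1}$; in particular, this pair is again a (projectable) section of $D(A^k)$. -/

import Mathlib

open Bundle Set Filter Topology
open scoped Manifold ContDiff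

set_option linter.unusedSectionVars false

noncomputable section

namespace HigherAlgebroid
section Analysis

variable {X Y : Type*} [NormedAddCommGroup X] [NormedSpace ℝ X] [NormedAddCommGroup Y]
  [NormedSpace ℝ Y]

theorem iteratedDeriv_comp_congr {g : X → Y} {c c' : ℝ → X} {j : ℕ}
    (hg : ContDiffAt ℝ ∞ g (c 0)) (hc : ContDiffAt ℝ ∞ c 0) (hc' : ContDiffAt ℝ ∞ c' 0)
    (H : ∀ i ≤ j, iteratedDeriv i c 0 = iteratedDeriv i c' 0) :
    iteratedDeriv j (g ∘ c) 0 = iteratedDeriv j (g ∘ c') 0 := by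
  have h0 : c 0 = c' 0 := by simpa using H 0 (Nat.zero_le _)
  have H' : ∀ i ≤ j, iteratedFDeriv ℝ i c 0 = iteratedFDeriv ℝ i c' 0 := by
    intro i hi
    rw [iteratedFDeriv_eq_equiv_comp, Function.comp_apply, H i hi, ← Function.comp_apply
      (f := ContinuousMultilinearMap.piFieldEquiv ℝ (Fin i) X), ← iteratedFDeriv_eq_equiv_comp]
  rw [iteratedDeriv_eq_iteratedFDeriv, iteratedDeriv_eq_iteratedFDeriv,
    iteratedFDeriv_comp hg hc (i := j) (by exact_mod_cast le_top),
    iteratedFDeriv_comp (h0 ▸ hg) hc' (i := j) (by exact_mod_cast le_top), ← h0]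
  congr 1
  simp only [FormalMultilinearSeries.taylorComp]
  refine Finset.sum_congr rfl fun p _ ↦ ?_
  simp only [FormalMultilinearSeries.compAlongOrderedFinpartition]
  congr 1
  funext m
  exact H' _ (p.partSize_le m)

/-- The derivative of the function `g` along the vector field `v`. -/
def lieD (v : X → X) (g : X → Y) (z : X) : Y := fderiv ℝ g z (v z)

theorem contDiffOn_iterate_lieD {v : X → X} {U : Set X} (hU : IsOpen U)
    (hv : ContDiffOn ℝ ∞ v U) {g : X → Y} (hg : ContDiffOn ℝ ∞ g U) (j : ℕ) :
    ContDiffOn ℝ ∞ ((lieD v)^[j] g) U := by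
  induction j with
  | zero => exact hg
  | succ j ih =>
    rw [Function.iterate_succ_apply']
    exact (ih.fderiv_of_isOpen hU (by simp)).clm_apply hv

theorem iteratedDeriv_comp_eventuallyEq {v : X → X} {U : Set X} (hU : IsOpen U)
    (hv : ContDiffOn ℝ ∞ v U) {g : X → Y} (hg : ContDiffOn ℝ ∞ g U) {c : ℝ → X} 
    (hcU : ∀ᶠ t in 𝓝 0, c t ∈ U) (hc : ∀ᶠ t in 𝓝 0, HasDerivAt c (v (c t)) t) (j : ℕ) :
    iteratedDeriv j (g ∘ c) =ᶠ[𝓝 0] ((lieD v)^[j] g) ∘ c := by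
  induction j with
  | zero => simp [iteratedDeriv_zero]
  | succ j ih =>
    rw [iteratedDeriv_succ, Function.iterate_succ_apply']
    refine ih.deriv.trans ?_
    filter_upwards [hcU, hc] with t h1 h2
    have := ((contDiffOn_iterate_lieD hU hv hg j).contDiffAt (hU.mem_nhds h1)).differentiableAt
      (by simp)
    exact (this.hasFDerivAt.comp_hasDerivAt t h2).deriv

theorem exists_integralCurve [CompleteSpace X] {v : X → X} {U : Set X} (hU : IsOpen U)
    (hv : ContDiffOn ℝ ∞ v U) {z : X} (hz : z ∈ U) :
    ∃ c : ℝ → X, c 0 = z ∧ (∀ᶠ t in 𝓝 0, c t ∈ U) ∧ (∀ᶠ t in 𝓝 0, HasDerivAt c (v (c t)) t) ∧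
      ∀ᶠ t in 𝓝 0, ContDiffAt ℝ ∞ c t := by
  obtain ⟨c, h0, ε, hε, hc⟩ :=
    ((hv.contDiffAt (hU.mem_nhds hz)).of_le (by simp : (1 : WithTop ℕ∞) ≤ ∞)
      ).exists_forall_mem_closedBall_exists_eq_forall_mem_Ioo_hasDerivAt₀ 0
  have hc' : ∀ᶠ t in 𝓝 (0:ℝ), HasDerivAt c (v (c t)) t := by
    filter_upwards [Ioo_mem_nhds (by linarith : 0 - ε < 0) (by linarith : 0 < 0 + ε)] with t ht
    exact hc t ht
  have hcU : ∀ᶠ t in 𝓝 (0:ℝ), c t ∈ U :=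
    hc'.self_of_nhds.continuousAt.eventually (hU.mem_nhds (h0 ▸ hz))
  refine ⟨c, h0, hcU, hc', ?_⟩
  obtain ⟨δ, hδ, H⟩ := Metric.eventually_nhds_iff_ball.1 (hc'.and hcU)
  have key : ContDiffOn ℝ ∞ c (Icc (-(δ/2)) (δ/2)) := by
    have hsub : ∀ t ∈ Icc (-(δ/2)) (δ/2), t ∈ Metric.ball (0:ℝ) δ := by
      intro t ht
      rw [Real.ball_eq_Ioo]
      exact ⟨by linarith [ht.1], by linarith [ht.2]⟩
    refine ODE.contDiffOn_enat_Icc_of_hasDerivWithinAt (f := fun _ x ↦ v x) (u := U) (n := ⊤) ?_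
      (fun t ht ↦ (H t (hsub t ht)).1.hasDerivWithinAt) (fun t ht ↦ (H t (hsub t ht)).2)
    exact hv.comp contDiffOn_snd (fun x hx ↦ hx.2)
  filter_upwards [Ioo_mem_nhds (by linarith : -(δ/2) < 0) (by linarith : 0 < δ/2)] with t ht
  exact key.contDiffAt (Icc_mem_nhds ht.1 ht.2)

variable {E R : Type*} [NormedAddCommGroup E] [NormedSpace ℝ E] [NormedAddCommGroup R]
  [NormedSpace ℝ R]

theorem iteratedDeriv_fst_snd {c : ℝ → E × R} {j : ℕ} (hc : ContDiffAt ℝ ∞ c 0) :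
    iteratedDeriv j c 0 =
      (iteratedDeriv j (fun t ↦ (c t).1) 0, iteratedDeriv j (fun t ↦ (c t).2) 0) := by
  have h1 := (ContinuousLinearMap.fst ℝ E R).iteratedFDeriv_comp_left (f := c) hc (i := j)
    (by exact_mod_cast le_top)
  have h2 := (ContinuousLinearMap.snd ℝ E R).iteratedFDeriv_comp_left (f := c) hc (i := j)
    (by exact_mod_cast le_top)
  rw [iteratedDeriv_eq_iteratedFDeriv]
  ext
  · exact (congrArg (fun m ↦ m fun _ ↦ (1:ℝ)) h1).symm
  · exact (congrArg (fun m ↦ m fun _ ↦ (1:ℝ)) h2).symm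

/-- Jets of solutions of `x' = w (x, y)` are determined by the initial value of `x` and the jet
of `y`. -/
theorem iteratedDeriv_eq_of_solution {w : E × R → E} {U : Set (E × R)} (hU : IsOpen U)
    (hw : ContDiffOn ℝ ∞ w U) {c c' : ℝ → E × R} (hc : ContDiffAt ℝ ∞ c 0)
    (hc' : ContDiffAt ℝ ∞ c' 0) (h0 : c 0 ∈ U)
    (H : ∀ᶠ t in 𝓝 0, HasDerivAt (fun s ↦ (c s).1) (w (c t)) t)
    (H' : ∀ᶠ t in 𝓝 0, HasDerivAt (fun s ↦ (c' s).1) (w (c' t)) t) {n : ℕ}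
    (hx : (c 0).1 = (c' 0).1)
    (hy : ∀ j < n, (iteratedDeriv j c 0).2 = (iteratedDeriv j c' 0).2) (j : ℕ) (hj : j < n) :
    iteratedDeriv j c 0 = iteratedDeriv j c' 0 := by
  induction j using Nat.strong_induction_on with
  | _ j ih =>
    refine Prod.ext ?_ (hy j hj)
    cases j with
    | zero => simpa using hx
    | succ j =>
      have e : ∀ {c : ℝ → E × R}, ContDiffAt ℝ ∞ c 0 →
          (∀ᶠ t in 𝓝 0, HasDerivAt (fun s ↦ (c s).1) (w (c t)) t) →
          (iteratedDeriv (j + 1) c 0).1 = iteratedDeriv j (w ∘ c) 0 := by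
        intro c hc H
        rw [iteratedDeriv_fst_snd hc, iteratedDeriv_succ']
        refine Filter.EventuallyEq.iteratedDeriv_eq _ ?_
        filter_upwards [H] with t ht using ht.deriv
      rw [e hc H, e hc' H']
      exact iteratedDeriv_comp_congr (hw.contDiffAt (hU.mem_nhds h0)) hc hc'
        fun i hi ↦ ih i (by omega) (by omega)

/-- The `j`-th entry of `y`, and `0` for `j ≥ n`. -/
def entry (n j : ℕ) : (Fin n → R) →L[ℝ] R :=
  if h : j < n then ContinuousLinearMap.proj ⟨j, h⟩ else 0

/-- The vector field on the space of coordinates `(x, y₀, …, y_{n-1})` whose integral curves solve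
`x' = w (x, y₀)`, `y_j' = y_{j+1}`, `y_{n-1}' = 0`. -/
def jetField (n : ℕ) (w : E × R → E) (z : E × (Fin n → R)) : E × (Fin n → R) :=
  (w (z.1, entry n 0 z.2), fun j ↦ entry n (j + 1) z.2)

theorem contDiffOn_jetField {n : ℕ} {w : E × R → E} {U : Set (E × R)} 
    (hw : ContDiffOn ℝ ∞ w U) :
    ContDiffOn ℝ ∞ (jetField n w) {z | (z.1, entry n 0 z.2) ∈ U} := by
  have key (j : ℕ) : ContDiff ℝ ∞ fun z : E × (Fin n → R) ↦ entry n j z.2 :=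
    ((entry (R := R) n j).comp (ContinuousLinearMap.snd ℝ E _)).contDiff
  refine ContDiffOn.prodMk ?_ ?_
  · exact hw.comp (contDiffOn_fst.prodMk (key 0).contDiffOn) fun z hz ↦ hz
  · exact contDiffOn_pi.2 fun j ↦ (key (j + 1)).contDiffOn

theorem iteratedDeriv_entry {n : ℕ} {w : E × R → E} {c : ℝ → E × (Fin n → R)}
    (hc : ∀ᶠ t in 𝓝 0, HasDerivAt c (jetField n w (c t)) t) (j : ℕ) :
    iteratedDeriv j (fun t ↦ entry n 0 (c t).2) =ᶠ[𝓝 0] fun t ↦ entry n j (c t).2 := by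
  induction j with
  | zero => simp [iteratedDeriv_zero]
  | succ j ih =>
    rw [iteratedDeriv_succ]
    refine ih.deriv.trans ?_
    filter_upwards [hc] with t ht
    have := ((entry (R := R) n j).comp (ContinuousLinearMap.snd ℝ E _)).hasFDerivAt.comp_hasDerivAt
      t ht
    refine this.deriv.trans ?_
    simp only [jetField, ContinuousLinearMap.comp_apply, ContinuousLinearMap.coe_snd']
    by_cases h : j < n
    · simp [entry, h]
    · have : ¬ (j + 1 < n) := by omega
      simp [entry, h, this]

end Analysis

variable {E R M : Type*} [NormedAddCommGroup E] [NormedSpace ℝ E] [NormedAddCommGroup R]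
  [NormedSpace ℝ R] [TopologicalSpace M] [ChartedSpace E M] [IsManifold 𝓘(ℝ, E) ∞ M]
  {A : M → Type*} [∀ x, AddCommGroup (A x)] [∀ x, Module ℝ (A x)] [∀ x, TopologicalSpace (A x)]
  [TopologicalSpace (TotalSpace R A)] [FiberBundle R A] [VectorBundle ℝ R A]
  [ContMDiffVectorBundle ∞ R A 𝓘(ℝ, E)]

variable (E R A) in
/-- An anchored bundle: a vector bundle `A → M` with a vector bundle morphism `A → T M`
over the identity. -/
structure AnchoredBundle where
  anchor : ∀ x, A x →L[ℝ] TangentSpace 𝓘(ℝ, E) x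
  contMDiff_anchor : ContMDiff (𝓘(ℝ, E).prod 𝓘(ℝ, R)) 𝓘(ℝ, E).tangent ∞
    (fun v : TotalSpace R A ↦ (⟨v.proj, anchor v.proj v.2⟩ : TangentBundle 𝓘(ℝ, E) M))

variable (E R A) in
/-- The adapted local coordinates `(x, y)` on the total space of `A` around the fibre over `p`. -/
def adaptedChart (p : M) : PartialEquiv (TotalSpace R A) (E × R) :=
  extChartAt (𝓘(ℝ, E).prod 𝓘(ℝ, R)) (⟨p, 0⟩ : TotalSpace R A)

variable (E R A) in
/-- The domain in `M` of the adapted local coordinates around `p`. -/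
def chartDomain (p : M) : Set M := (chartAt E p).source ∩ (trivializationAt R A p).baseSet

theorem mem_chartDomain_self (p : M) : p ∈ chartDomain E R A p :=
  ⟨mem_chart_source E p, FiberBundle.mem_baseSet_trivializationAt R A p⟩

theorem isOpen_chartDomain (p : M) : IsOpen (chartDomain E R A p) :=
  (chartAt E p).open_source.inter (trivializationAt R A p).open_baseSet

theorem mem_adaptedChart_source {p : M} {v : TotalSpace R A} :
    v ∈ (adaptedChart E R A p).source ↔ v.proj ∈ chartDomain E R A p := by
  rw [adaptedChart, FiberBundle.extChartAt]
  simp only [chartDomain, mfld_simps]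
  constructor
  · rintro ⟨h1, h2⟩
    rw [(trivializationAt R A p).coe_fst h1] at h2
    exact ⟨h2, (trivializationAt R A p).mem_source.1 h1⟩
  · rintro ⟨h1, h2⟩
    exact ⟨(trivializationAt R A p).mem_source.2 h2, by rwa [(trivializationAt R A p).coe_fst' h2]⟩

theorem adaptedChart_apply {p : M} {v : TotalSpace R A} (hv : v.proj ∈ chartDomain E R A p) :
    adaptedChart E R A p v = (chartAt E p v.proj, (trivializationAt R A p v).2) := by
  rw [adaptedChart, FiberBundle.extChartAt]
  simp only [mfld_simps]
  rw [(trivializationAt R A p).coe_fst' hv.2]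

theorem mem_adaptedChart_target {p : M} {z : E × R} :
    z ∈ (adaptedChart E R A p).target ↔
      z.1 ∈ (chartAt E p).target ∧ (chartAt E p).symm z.1 ∈ (trivializationAt R A p).baseSet := by
  rw [adaptedChart, FiberBundle.extChartAt_target]
  simp only [mfld_simps]

theorem isOpen_adaptedChart_target (p : M) : IsOpen (adaptedChart E R A p).target :=
  isOpen_extChartAt_target _

theorem contMDiffOn_adaptedChart (p : M) :
    ContMDiffOn (𝓘(ℝ, E).prod 𝓘(ℝ, R)) 𝓘(ℝ, E × R) ∞ (adaptedChart E R A p)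
      (adaptedChart E R A p).source := by
  rw [adaptedChart, extChartAt_source]
  exact contMDiffOn_extChartAt

theorem contMDiffOn_adaptedChart_symm (p : M) :
    ContMDiffOn 𝓘(ℝ, E × R) (𝓘(ℝ, E).prod 𝓘(ℝ, R)) ∞ (adaptedChart E R A p).symm
      (adaptedChart E R A p).target :=
  contMDiffOn_extChartAt_symm _

namespace AnchoredBundle

variable (𝓐 : AnchoredBundle E R A)

/-- The anchor in local coordinates: `x' = localAnchor p (x, y)` is the condition of admissibility. -/
def localAnchor (p : M) (z : E × R) : E :=
  (trivializationAt E (TangentSpace 𝓘(ℝ, E)) p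
    (⟨((adaptedChart E R A p).symm z).proj, 𝓐.anchor _ ((adaptedChart E R A p).symm z).2⟩ :
      TangentBundle 𝓘(ℝ, E) M)).2

theorem contDiffOn_localAnchor (p : M) :
    ContDiffOn ℝ ∞ (𝓐.localAnchor p) (adaptedChart E R A p).target := by
  rw [← contMDiffOn_iff_contDiffOn]
  have h1 := 𝓐.contMDiff_anchor.comp_contMDiffOn (contMDiffOn_adaptedChart_symm (E := E) (R := R) (A := A) p)
  have h2 := (trivializationAt E (TangentSpace 𝓘(ℝ, E)) p).contMDiffOn_iff (IB := 𝓘(ℝ, E)) (n := ∞) (IM := 𝓘(ℝ, E × R)) (s := (adaptedChart E R A p).target)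
    (f := fun z ↦ (⟨((adaptedChart E R A p).symm z).proj, 𝓐.anchor _ ((adaptedChart E R A p).symm z).2⟩ :
      TangentBundle 𝓘(ℝ, E) M)) ?_
  · exact (h2.1 h1).2
  · intro z hz
    have h1 := mem_adaptedChart_source.1 ((adaptedChart E R A p).map_target hz)
    exact (Trivialization.mem_source _).2 h1.1

/-- An admissible curve (germ at `0`) in an anchored bundle over `x`: the anchor of the curve is the
tangent lift of its projection to `M`. -/
structure AdmissibleCurve (x : M) where
  curve : ℝ → TotalSpace R A
  base : (curve 0).proj = x
  contMDiff : ∀ᶠ t in 𝓝 0, ContMDiffAt 𝓘(ℝ, ℝ) (𝓘(ℝ, E).prod 𝓘(ℝ, R)) ∞ curve t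
  admissible : ∀ᶠ t in 𝓝 0, 𝓐.anchor (curve t).proj (curve t).2 =
    mfderiv 𝓘(ℝ, ℝ) 𝓘(ℝ, E) (fun s ↦ (curve s).proj) t (1 : ℝ)

theorem admissible_iff {c : ℝ → TotalSpace R A} {t : ℝ} {p : M}
    (hc : ContMDiffAt 𝓘(ℝ, ℝ) (𝓘(ℝ, E).prod 𝓘(ℝ, R)) ∞ c t) (hp : (c t).proj ∈ chartDomain E R A p) :
    𝓐.anchor (c t).proj (c t).2 = mfderiv 𝓘(ℝ, ℝ) 𝓘(ℝ, E) (fun s ↦ (c s).proj) t (1 : ℝ) ↔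
    HasDerivAt (fun s ↦ (adaptedChart E R A p (c s)).1)
      (𝓐.localAnchor p (adaptedChart E R A p (c t))) t := by
  have hγ : MDifferentiableAt 𝓘(ℝ, ℝ) 𝓘(ℝ, E) (fun s ↦ (c s).proj) t :=
    ((contMDiffAt_proj A).comp t hc).mdifferentiableAt (by simp)
  have hev : ∀ᶠ s in 𝓝 t, (c s).proj ∈ chartDomain E R A p :=
    hγ.continuousAt.eventually ((isOpen_chartDomain p).mem_nhds hp)
  have hφ : MDifferentiableAt 𝓘(ℝ, E) 𝓘(ℝ, E) (extChartAt 𝓘(ℝ, E) p) (c t).proj :=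
    mdifferentiableAt_extChartAt hp.1
  set L := (trivializationAt E (TangentSpace 𝓘(ℝ, E)) p).continuousLinearMapAt ℝ (c t).proj with hL
  have hLd : L = mfderiv 𝓘(ℝ, E) 𝓘(ℝ, E) (extChartAt 𝓘(ℝ, E) p) (c t).proj :=
    TangentBundle.continuousLinearMapAt_trivializationAt hp.1
  have h1 : HasDerivAt (fun s ↦ (adaptedChart E R A p (c s)).1)
      (L (mfderiv 𝓘(ℝ, ℝ) 𝓘(ℝ, E) (fun s ↦ (c s).proj) t (1 : ℝ))) t := by
    have h : HasFDerivAt (fun s ↦ extChartAt 𝓘(ℝ, E) p (c s).proj)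
        ((L : E →L[ℝ] E).comp (mfderiv 𝓘(ℝ, ℝ) 𝓘(ℝ, E) (fun s ↦ (c s).proj) t : ℝ →L[ℝ] E)) t := by
      rw [hLd]
      exact (hφ.hasMFDerivAt.comp t hγ.hasMFDerivAt).hasFDerivAt
    refine h.hasDerivAt.congr_of_eventuallyEq ?_
    filter_upwards [hev] with s hs
    rw [adaptedChart_apply hs]
    rfl
  have h2 : 𝓐.localAnchor p (adaptedChart E R A p (c t)) = L (𝓐.anchor (c t).proj (c t).2) := by
    rw [localAnchor, (adaptedChart E R A p).left_inv (mem_adaptedChart_source.2 hp), hL]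
    rw [Trivialization.continuousLinearMapAt_apply, Trivialization.linearMapAt_apply]
    exact (if_pos hp.1).symm
  rw [h2]
  constructor
  · intro h
    rw [h]
    exact h1
  · intro h
    have h3 := h.unique h1
    have hinj : Function.Injective L :=
      Function.LeftInverse.injective (g := (trivializationAt E (TangentSpace 𝓘(ℝ, E)) p).symmL ℝ
        (c t).proj) fun v ↦ Trivialization.symmL_continuousLinearMapAt _ hp.1 v
    exact hinj h3

variable {𝓐}

theorem AdmissibleCurve.eventually_mem {x p : M} (c : 𝓐.AdmissibleCurve x)
    (hx : x ∈ chartDomain E R A p) : ∀ᶠ t in 𝓝 0, (c.curve t).proj ∈ chartDomain E R A p :=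
  ((contMDiffAt_proj A).comp 0 c.contMDiff.self_of_nhds).continuousAt.eventually
    ((isOpen_chartDomain p).mem_nhds (by simpa [c.base] using hx))

theorem AdmissibleCurve.eventually_contDiffAt {x p : M} (c : 𝓐.AdmissibleCurve x)
    (hx : x ∈ chartDomain E R A p) :
    ∀ᶠ t in 𝓝 0, ContDiffAt ℝ ∞ (adaptedChart E R A p ∘ c.curve) t := by
  filter_upwards [c.eventually_mem hx, c.contMDiff] with t h1 h2
  rw [← contMDiffAt_iff_contDiffAt]
  exact ((contMDiffOn_adaptedChart p).contMDiffAt ((isOpen_extChartAt_source _).mem_nhds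
    (mem_adaptedChart_source.2 h1))).comp t h2

theorem AdmissibleCurve.eventually_hasDerivAt {x p : M} (c : 𝓐.AdmissibleCurve x)
    (hx : x ∈ chartDomain E R A p) :
    ∀ᶠ t in 𝓝 0, HasDerivAt (fun s ↦ ((adaptedChart E R A p ∘ c.curve) s).1)
      (𝓐.localAnchor p ((adaptedChart E R A p ∘ c.curve) t)) t := by
  filter_upwards [c.eventually_mem hx, c.contMDiff, c.admissible] with t h1 h2 h3
  exact (𝓐.admissible_iff h2 h1).1 h3

variable (𝓐)

/-- Two admissible curves over `x` have the same jet of order `n - 1` at `0` (if `n = 0`, the only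
condition is that both are curves over `x`). -/
def jetSetoid (n : ℕ) (x : M) : Setoid (𝓐.AdmissibleCurve x) where
  r c c' := ∀ p, x ∈ chartDomain E R A p → ∀ j < n,
    iteratedDeriv j (adaptedChart E R A p ∘ c.curve) 0 =
      iteratedDeriv j (adaptedChart E R A p ∘ c'.curve) 0
  iseqv := ⟨fun _ _ _ _ _ ↦ rfl, fun h p hp j hj ↦ (h p hp j hj).symm,
    fun h h' p hp j hj ↦ (h p hp j hj).trans (h' p hp j hj)⟩

/-- The bundle `A^n` of jets of order `n - 1` at `0` of admissible curves in `A` (in particular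
`A^0 = M` and `A^1 = A`). A point is given by its projection `base` to `M` and a jet. -/
structure HigherBundle (n : ℕ) where
  base : M
  jet : Quotient (𝓐.jetSetoid n base)

/-- The coordinates `(x, y₁, …, y_n)` on `A^n` defined by adapted coordinates `(x, y)` on `A`:
`y_{j+1}` is the `j`-th derivative at `0` of the coordinate `y` of the admissible curve. -/
def jetCoord (n : ℕ) (p : M) (q : 𝓐.HigherBundle n) : E × (Fin n → R) :=
  (chartAt E p q.base,
    fun j : Fin n ↦ (iteratedDeriv j (adaptedChart E R A p ∘ q.jet.out.curve) 0).2)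

variable {𝓐}

theorem jetCoord_mk {n : ℕ} {p x : M} (hx : x ∈ chartDomain E R A p) (c : 𝓐.AdmissibleCurve x) :
    𝓐.jetCoord n p ⟨x, Quotient.mk _ c⟩ =
      (chartAt E p x, fun j : Fin n ↦ (iteratedDeriv j (adaptedChart E R A p ∘ c.curve) 0).2) := by
  refine Prod.ext rfl (funext fun j ↦ ?_)
  have h := Quotient.exact (Quotient.out_eq (Quotient.mk (𝓐.jetSetoid n x) c))
  exact congrArg (Prod.snd : E × R → R) (h p hx j j.2)

theorem adaptedChart_symm_proj {p : M} {z : E × R} (hz : z ∈ (adaptedChart E R A p).target) :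
    ((adaptedChart E R A p).symm z).proj = (chartAt E p).symm z.1 := by
  have h := (adaptedChart E R A p).right_inv hz
  have hd := mem_adaptedChart_source.1 ((adaptedChart E R A p).map_target hz)
  rw [adaptedChart_apply hd] at h
  rw [← (chartAt E p).left_inv hd.1]
  exact congrArg _ (congrArg Prod.fst h)

theorem injOn_jetCoord (n : ℕ) (p : M) :
    InjOn (𝓐.jetCoord n p) {q | q.base ∈ chartDomain E R A p} := by
  rintro ⟨x, c⟩ hx ⟨x', c'⟩ hx' h
  obtain rfl : x = x' := (chartAt E p).injOn hx.1 hx'.1 (congrArg Prod.fst h)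
  induction c using Quotient.inductionOn with | _ c
  induction c' using Quotient.inductionOn with | _ c'
  rw [jetCoord_mk hx, jetCoord_mk hx] at h
  congr 1
  refine Quotient.sound fun p' hp' j hj ↦ ?_
  have h0 : ∀ c : 𝓐.AdmissibleCurve x, (c.curve 0).proj ∈ chartDomain E R A p := fun c ↦ by
    rw [c.base]; exact hx
  have hsrc : ∀ c : 𝓐.AdmissibleCurve x, c.curve 0 ∈ (adaptedChart E R A p).source := fun c ↦
    mem_adaptedChart_source.2 (h0 c)
  have key : ∀ j < n, iteratedDeriv j (adaptedChart E R A p ∘ c.curve) 0 =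
      iteratedDeriv j (adaptedChart E R A p ∘ c'.curve) 0 := by
    refine iteratedDeriv_eq_of_solution (isOpen_adaptedChart_target p) (𝓐.contDiffOn_localAnchor p)
      (c.eventually_contDiffAt hx).self_of_nhds (c'.eventually_contDiffAt hx).self_of_nhds
      ((adaptedChart E R A p).map_source (hsrc c))
      (c.eventually_hasDerivAt hx) (c'.eventually_hasDerivAt hx) ?_ ?_
    · simp only [Function.comp_apply]
      rw [adaptedChart_apply (h0 c), adaptedChart_apply (h0 c'), c.base, c'.base]
    · intro j hj
      exact congrFun (congrArg Prod.snd h) ⟨j, hj⟩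
  have e : ∀ c : 𝓐.AdmissibleCurve x, iteratedDeriv j (adaptedChart E R A p' ∘ c.curve) 0 =
      iteratedDeriv j ((adaptedChart E R A p' ∘ (adaptedChart E R A p).symm) ∘
        (adaptedChart E R A p ∘ c.curve)) 0 := by
    intro c
    refine Filter.EventuallyEq.iteratedDeriv_eq _ ?_
    filter_upwards [c.eventually_mem hx] with t ht
    simp only [Function.comp_apply]
    rw [(adaptedChart E R A p).left_inv (mem_adaptedChart_source.2 ht)]
  rw [e c, e c']
  refine iteratedDeriv_comp_congr ?_ (c.eventually_contDiffAt hx).self_of_nhds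
    (c'.eventually_contDiffAt hx).self_of_nhds fun i hi ↦ key i (by omega)
  rw [← contMDiffAt_iff_contDiffAt]
  have h1 := (contMDiffOn_adaptedChart_symm (E := E) (R := R) (A := A) p).contMDiffAt
    ((isOpen_adaptedChart_target p).mem_nhds ((adaptedChart E R A p).map_source (hsrc c)))
  refine ContMDiffAt.comp _ ?_ h1
  refine (contMDiffOn_adaptedChart p').contMDiffAt ((isOpen_extChartAt_source _).mem_nhds ?_)
  rw [Function.comp_apply, (adaptedChart E R A p).left_inv (hsrc c)]
  exact mem_adaptedChart_source.2 (by rwa [c.base])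

variable (E R A) in
/-- The range of the coordinates of `A^n` around `p`. -/
def jetTarget (n : ℕ) (p : M) : Set (E × (Fin n → R)) :=
  {z | (z.1, entry n 0 z.2) ∈ (adaptedChart E R A p).target}

theorem jetTarget_mem {n : ℕ} {p : M} {z : E × (Fin n → R)} (h : z ∈ jetTarget E R A n p) :
    (z.1, entry n 0 z.2) ∈ (adaptedChart E R A p).target := h

theorem mem_jetTarget {n : ℕ} {p : M} {z : E × (Fin n → R)} :
    z ∈ jetTarget E R A n p ↔
      z.1 ∈ (chartAt E p).target ∧ (chartAt E p).symm z.1 ∈ chartDomain E R A p := by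
  have h := mem_adaptedChart_target (A := A) (p := p) (z := (z.1, entry n 0 z.2))
  refine Iff.trans h ⟨fun h ↦ ⟨h.1, (chartAt E p).map_target h.1, h.2⟩, fun h ↦ ⟨h.1, h.2.2⟩⟩

theorem isOpen_jetTarget (n : ℕ) (p : M) : IsOpen (jetTarget E R A n p) :=
  (isOpen_adaptedChart_target p).preimage
    (continuous_fst.prodMk ((entry (R := R) n 0).continuous.comp continuous_snd))

variable [FiniteDimensional ℝ E] [FiniteDimensional ℝ R]

theorem exists_admissibleCurve {n : ℕ} {p : M} {z : E × (Fin n → R)}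
    (hz : z ∈ jetTarget E R A n p) :
    ∃ (C : ℝ → E × (Fin n → R)) (c : 𝓐.AdmissibleCurve ((chartAt E p).symm z.1)),
      C 0 = z ∧ (∀ᶠ t in 𝓝 0, C t ∈ jetTarget E R A n p) ∧
      (∀ᶠ t in 𝓝 0, HasDerivAt C (jetField n (𝓐.localAnchor p) (C t)) t) ∧
      c.curve = fun t ↦ (adaptedChart E R A p).symm ((C t).1, entry n 0 (C t).2) := by
  have := FiniteDimensional.complete ℝ E
  have := FiniteDimensional.complete ℝ R
  obtain ⟨C, h0, hU, hC, hs⟩ := exists_integralCurve (isOpen_jetTarget n p)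
    (contDiffOn_jetField (n := n) (𝓐.contDiffOn_localAnchor p)) hz
  have hent : ContDiff ℝ ∞ fun z : E × (Fin n → R) ↦ (z.1, entry n 0 z.2) :=
    contDiff_fst.prodMk ((entry (R := R) n 0).comp (ContinuousLinearMap.snd ℝ E _)).contDiff
  have hsm : ∀ᶠ t in 𝓝 0, ContMDiffAt 𝓘(ℝ, ℝ) (𝓘(ℝ, E).prod 𝓘(ℝ, R)) ∞
      (fun t ↦ (adaptedChart E R A p).symm ((C t).1, entry n 0 (C t).2)) t := by
    filter_upwards [hU, hs] with t h1 h2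
    exact ((contMDiffOn_adaptedChart_symm p).contMDiffAt
      ((isOpen_adaptedChart_target p).mem_nhds h1)).comp t
      (hent.contDiffAt.comp t h2).contMDiffAt
  refine ⟨C, ⟨_, ?_, hsm, ?_⟩, h0, hU, hC, rfl⟩
  · rw [h0]
    exact adaptedChart_symm_proj (jetTarget_mem hz)
  · filter_upwards [hU.eventually_nhds, hC, hsm] with t h1 h2 h3
    have hd := mem_adaptedChart_source.1 ((adaptedChart E R A p).map_target h1.self_of_nhds)
    refine (𝓐.admissible_iff h3 hd).2 ?_
    rw [(adaptedChart E R A p).right_inv h1.self_of_nhds]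
    have h4 := (ContinuousLinearMap.fst ℝ E (Fin n → R)).hasFDerivAt.comp_hasDerivAt t h2
    refine HasDerivAt.congr_of_eventuallyEq (f := fun s ↦ (C s).1) h4 ?_
    filter_upwards [h1] with s hs
    rw [(adaptedChart E R A p).right_inv hs]

theorem jetCoord_eq {n : ℕ} {p : M} {z : E × (Fin n → R)} (hz : z ∈ jetTarget E R A n p)
    {C : ℝ → E × (Fin n → R)} {c : 𝓐.AdmissibleCurve ((chartAt E p).symm z.1)} (h0 : C 0 = z)
    (hU : ∀ᶠ t in 𝓝 0, C t ∈ jetTarget E R A n p)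
    (hC : ∀ᶠ t in 𝓝 0, HasDerivAt C (jetField n (𝓐.localAnchor p) (C t)) t)
    (hc : c.curve = fun t ↦ (adaptedChart E R A p).symm ((C t).1, entry n 0 (C t).2)) :
    𝓐.jetCoord n p ⟨(chartAt E p).symm z.1, Quotient.mk _ c⟩ = z := by
  obtain ⟨ht, hx⟩ := mem_jetTarget.1 hz
  rw [jetCoord_mk hx]
  refine Prod.ext ((chartAt E p).right_inv ht) (funext fun j ↦ ?_)
  have hsm := (c.eventually_contDiffAt hx).self_of_nhds
  simp only
  rw [iteratedDeriv_fst_snd hsm]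
  have : (fun t ↦ ((adaptedChart E R A p ∘ c.curve) t).2) =ᶠ[𝓝 0]
      fun t ↦ entry n 0 (C t).2 := by
    filter_upwards [hU] with t ht
    rw [hc, Function.comp_apply, (adaptedChart E R A p).right_inv ht]
  simp only
  rw [this.iteratedDeriv_eq, (iteratedDeriv_entry hC j).self_of_nhds]
  simp [entry, h0]

theorem jetCoord_bijOn (n : ℕ) (p : M) :
    BijOn (𝓐.jetCoord n p) {q | q.base ∈ chartDomain E R A p} (jetTarget E R A n p) := by
  refine ⟨?_, injOn_jetCoord n p, ?_⟩
  · intro q hq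
    refine mem_jetTarget.2 ⟨(chartAt E p).map_source hq.1, ?_⟩
    simp only [jetCoord]
    rw [(chartAt E p).left_inv hq.1]
    exact hq
  · intro z hz
    obtain ⟨C, c, h0, hU, hC, hc⟩ := exists_admissibleCurve (𝓐 := 𝓐) hz
    exact ⟨⟨_, Quotient.mk _ c⟩, (mem_jetTarget.1 hz).2, jetCoord_eq hz h0 hU hC hc⟩

variable (𝓐)

theorem nonempty_higherBundle (n : ℕ) (p : M) : Nonempty (𝓐.HigherBundle n) := by
  have h : ((chartAt E p p, 0) : E × (Fin n → R)) ∈ jetTarget E R A n p :=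
    mem_jetTarget.2 ⟨mem_chart_target E p, by
      simpa using mem_chartDomain_self (R := R) (A := A) p⟩
  obtain ⟨q, -, -⟩ := (jetCoord_bijOn (𝓐 := 𝓐) n p).surjOn h
  exact ⟨q⟩

/-- The chart of `A^n` defined by adapted coordinates on `A` around `p`. -/
def jetChart (n : ℕ) (p : M) : PartialEquiv (𝓐.HigherBundle n) (E × (Fin n → R)) :=
  haveI : Nonempty (𝓐.HigherBundle n) := 𝓐.nonempty_higherBundle n p
  (jetCoord_bijOn n p).toPartialEquiv _ _ _

theorem jetChart_source (n : ℕ) (p : M) :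
    (𝓐.jetChart n p).source = {q | q.base ∈ chartDomain E R A p} := rfl

theorem jetChart_target (n : ℕ) (p : M) : (𝓐.jetChart n p).target = jetTarget E R A n p := rfl

theorem coe_jetChart (n : ℕ) (p : M) : (𝓐.jetChart n p : _ → _) = 𝓐.jetCoord n p := rfl

theorem jetChart_symm_base {n : ℕ} {p : M} {z : E × (Fin n → R)} (hz : z ∈ jetTarget E R A n p) :
    ((𝓐.jetChart n p).symm z).base = (chartAt E p).symm z.1 := by
  have h := (𝓐.jetChart n p).right_inv hz
  have hd : ((𝓐.jetChart n p).symm z).base ∈ chartDomain E R A p :=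
    (𝓐.jetChart n p).map_target hz
  rw [← (chartAt E p).left_inv hd.1]
  exact congrArg _ (congrArg Prod.fst h)

theorem jetChart_trans_source (n : ℕ) (p p' : M) :
    ((𝓐.jetChart n p).symm.trans (𝓐.jetChart n p')).source =
      jetTarget E R A n p ∩ (fun z ↦ (chartAt E p).symm z.1) ⁻¹' chartDomain E R A p' := by
  ext z
  have h : z ∈ ((𝓐.jetChart n p).symm.trans (𝓐.jetChart n p')).source ↔
      z ∈ jetTarget E R A n p ∧ ((𝓐.jetChart n p).symm z).base ∈ chartDomain E R A p' := by
    rw [PartialEquiv.trans_source]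
    exact Iff.rfl
  rw [h]
  refine and_congr_right fun hz ↦ ?_
  rw [jetChart_symm_base 𝓐 hz]
  exact Iff.rfl

theorem isOpen_jetChart_trans_source (n : ℕ) (p p' : M) :
    IsOpen ((𝓐.jetChart n p).symm.trans (𝓐.jetChart n p')).source := by
  rw [jetChart_trans_source]
  have h : ContinuousOn (fun z : E × (Fin n → R) ↦ (chartAt E p).symm z.1)
      (jetTarget E R A n p) :=
    (chartAt E p).continuousOn_symm.comp continuous_fst.continuousOn
      fun z hz ↦ (mem_jetTarget.1 hz).1
  exact h.isOpen_inter_preimage (isOpen_jetTarget n p) (isOpen_chartDomain p')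

theorem jetChart_symm_eq {n : ℕ} {p : M} {z : E × (Fin n → R)} (hz : z ∈ jetTarget E R A n p)
    {C : ℝ → E × (Fin n → R)} {c : 𝓐.AdmissibleCurve ((chartAt E p).symm z.1)} (h0 : C 0 = z)
    (hU : ∀ᶠ t in 𝓝 0, C t ∈ jetTarget E R A n p)
    (hC : ∀ᶠ t in 𝓝 0, HasDerivAt C (jetField n (𝓐.localAnchor p) (C t)) t)
    (hc : c.curve = fun t ↦ (adaptedChart E R A p).symm ((C t).1, entry n 0 (C t).2)) :
    (𝓐.jetChart n p).symm z = ⟨(chartAt E p).symm z.1, Quotient.mk _ c⟩ := by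
  obtain ⟨ht, hx⟩ := mem_jetTarget.1 hz
  have h := (𝓐.jetChart n p).left_inv (x := ⟨(chartAt E p).symm z.1, Quotient.mk _ c⟩) hx
  rw [coe_jetChart, jetCoord_eq hz h0 hU hC hc] at h
  exact h

theorem contDiffOn_localJetField (n : ℕ) (p : M) :
    ContDiffOn ℝ ∞ (jetField n (𝓐.localAnchor p)) (jetTarget E R A n p) :=
  contDiffOn_jetField (𝓐.contDiffOn_localAnchor p)

theorem contDiffOn_jetChart_trans (n : ℕ) (p p' : M) :
    ContDiffOn ℝ ∞ ((𝓐.jetChart n p).symm.trans (𝓐.jetChart n p'))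
      ((𝓐.jetChart n p).symm.trans (𝓐.jetChart n p')).source := by
  have hUo : IsOpen (jetTarget E R A n p ∩
      (fun z ↦ (chartAt E p).symm z.1) ⁻¹' chartDomain E R A p') := by
    rw [← jetChart_trans_source 𝓐]
    exact isOpen_jetChart_trans_source 𝓐 n p p'
  rw [jetChart_trans_source]
  set U := jetTarget E R A n p ∩ (fun z ↦ (chartAt E p).symm z.1) ⁻¹' chartDomain E R A p' with hU
  have hproj : ∀ z ∈ U, ((adaptedChart E R A p).symm (z.1, entry n 0 z.2)).proj ∈
      chartDomain E R A p' := by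
    intro z hz
    rw [adaptedChart_symm_proj (jetTarget_mem hz.1)]
    exact hz.2
  let G : E × (Fin n → R) → E × R := fun z ↦
    adaptedChart E R A p' ((adaptedChart E R A p).symm (z.1, entry n 0 z.2))
  have hent : ContDiff ℝ ∞ fun z : E × (Fin n → R) ↦ (z.1, entry n 0 z.2) :=
    contDiff_fst.prodMk ((entry (R := R) n 0).comp (ContinuousLinearMap.snd ℝ E _)).contDiff
  have hG : ContDiffOn ℝ ∞ G U := by
    rw [← contMDiffOn_iff_contDiffOn]
    have h1 : ∀ z ∈ U, (z.1, entry n 0 z.2) ∈ (adaptedChart E R A p).target :=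
      fun z hz ↦ jetTarget_mem hz.1
    have h2 := (contMDiffOn_adaptedChart_symm (E := E) (R := R) (A := A) p).comp
      (hent.contMDiff.contMDiffOn (s := U)) h1
    exact (contMDiffOn_adaptedChart p').comp h2
      fun z hz ↦ mem_adaptedChart_source.2 (hproj z hz)
  have hV : ContDiffOn ℝ ∞ (jetField n (𝓐.localAnchor p)) U :=
    (contDiffOn_localJetField 𝓐 n p).mono fun z hz ↦ hz.1
  have h2 : ContDiffOn ℝ ∞ (fun z ↦ (G z).2) U := contDiff_snd.comp_contDiffOn hG
  refine ContDiffOn.congr (f := fun z ↦ ((G z).1, fun j : Fin n ↦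
    ((lieD (jetField n (𝓐.localAnchor p)))^[j] (fun z ↦ (G z).2)) z)) ?_ ?_
  · exact (contDiff_fst.comp_contDiffOn hG).prodMk
      (contDiffOn_pi.2 fun j ↦ contDiffOn_iterate_lieD hUo hV h2 j)
  · intro z hz
    obtain ⟨C, c, h0, hCt, hC, hc⟩ := exists_admissibleCurve (𝓐 := 𝓐) hz.1
    have hCU : ∀ᶠ t in 𝓝 0, C t ∈ U :=
      hC.self_of_nhds.continuousAt.eventually (hUo.mem_nhds (h0 ▸ hz))
    have hx' : (chartAt E p).symm z.1 ∈ chartDomain E R A p' := hz.2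
    change 𝓐.jetCoord n p' ((𝓐.jetChart n p).symm z) = _
    rw [jetChart_symm_eq 𝓐 hz.1 h0 hCt hC hc, jetCoord_mk hx']
    refine Prod.ext ?_ (funext fun j ↦ ?_)
    · change _ = (G z).1
      simp only [G]
      rw [adaptedChart_apply (hproj z hz), adaptedChart_symm_proj (jetTarget_mem hz.1)]
    · simp only
      rw [iteratedDeriv_fst_snd (c.eventually_contDiffAt hx').self_of_nhds, hc]
      have := (iteratedDeriv_comp_eventuallyEq hUo hV h2 hCU hC j).self_of_nhds
      rw [Function.comp_apply, h0] at this
      exact this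

/-- The atlas of `A^n` consisting of the charts defined by adapted coordinates on `A`. -/
def jetAtlas (n : ℕ) : ChartedSpaceCore (E × (Fin n → R)) (𝓐.HigherBundle n) where
  atlas := range (𝓐.jetChart n)
  chartAt q := 𝓐.jetChart n q.base
  mem_chart_source q := mem_chartDomain_self q.base
  chart_mem_atlas q := mem_range_self _
  open_source := by
    rintro _ _ ⟨p, rfl⟩ ⟨p', rfl⟩
    exact isOpen_jetChart_trans_source 𝓐 n p p'
  continuousOn_toFun := by
    rintro _ _ ⟨p, rfl⟩ ⟨p', rfl⟩
    exact (contDiffOn_jetChart_trans 𝓐 n p p').continuousOn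

instance (n : ℕ) : TopologicalSpace (𝓐.HigherBundle n) := (𝓐.jetAtlas n).toTopologicalSpace

instance (n : ℕ) : ChartedSpace (E × (Fin n → R)) (𝓐.HigherBundle n) :=
  (𝓐.jetAtlas n).toChartedSpace

instance (n : ℕ) : IsManifold 𝓘(ℝ, E × (Fin n → R)) ∞ (𝓐.HigherBundle n) := by
  refine isManifold_of_contDiffOn _ _ _ ?_
  intro e e' he he'
  change e ∈ ⋃ _, _ at he
  change e' ∈ ⋃ _, _ at he'
  simp only [mem_iUnion, mem_singleton_iff] at he he'
  obtain ⟨_, ⟨p, rfl⟩, rfl⟩ := he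
  obtain ⟨_, ⟨p', rfl⟩, rfl⟩ := he'
  have h := contDiffOn_jetChart_trans 𝓐 n p p'
  simp only [mfld_simps]
  exact h

end AnchoredBundle
end HigherAlgebroid

namespace HigherAlgebroid

variable {E R M : Type*} [NormedAddCommGroup E] [NormedSpace ℝ E] [NormedAddCommGroup R]
  [NormedSpace ℝ R] [TopologicalSpace M] [ChartedSpace E M] [IsManifold 𝓘(ℝ, E) ∞ M]
  {A : M → Type*} [∀ x, AddCommGroup (A x)] [∀ x, Module ℝ (A x)] [∀ x, TopologicalSpace (A x)]
  [TopologicalSpace (TotalSpace R A)] [FiberBundle R A] [VectorBundle ℝ R A]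
  [ContMDiffVectorBundle ∞ R A 𝓘(ℝ, E)]

namespace AnchoredBundle

theorem contMDiff_fibreSmul (t : ℝ) : ContMDiff (𝓘(ℝ, E).prod 𝓘(ℝ, R)) (𝓘(ℝ, E).prod 𝓘(ℝ, R)) ∞
    (fun v : TotalSpace R A ↦ (⟨v.proj, t • v.2⟩ : TotalSpace R A)) := by
  intro v₀
  rw [contMDiffAt_totalSpace]
  refine ⟨contMDiffAt_proj A, ?_⟩
  have h := (contMDiffAt_totalSpace.1 (contMDiffAt_id (I := 𝓘(ℝ, E).prod 𝓘(ℝ, R)) (n := ∞)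
    (x := v₀))).2
  refine ((t • ContinuousLinearMap.id ℝ R).contMDiff.contMDiffAt.comp v₀ h).congr_of_eventuallyEq ?_
  have hb : ∀ᶠ v : TotalSpace R A in 𝓝 v₀, v.proj ∈ (trivializationAt R A v₀.proj).baseSet :=
    (FiberBundle.continuous_proj R A).continuousAt.eventually
      ((trivializationAt R A v₀.proj).open_baseSet.mem_nhds
        (FiberBundle.mem_baseSet_trivializationAt R A v₀.proj))
  filter_upwards [hb] with v hv
  exact ((trivializationAt R A v₀.proj).linear ℝ hv).map_smul t v.2

variable {𝓐 : AnchoredBundle E R A}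

/-- The rescaling `s ↦ t • c (t s)` of an admissible curve `c`. -/
def AdmissibleCurve.scale (t : ℝ) {x : M} (c : 𝓐.AdmissibleCurve x) : 𝓐.AdmissibleCurve x where
  curve s := ⟨(c.curve (t * s)).proj, t • (c.curve (t * s)).2⟩
  base := by simpa using c.base
  contMDiff := by
    have h0 : Tendsto (fun s : ℝ ↦ t * s) (𝓝 0) (𝓝 0) := by
      simpa using (continuous_const_mul t).tendsto (0 : ℝ)
    filter_upwards [h0.eventually c.contMDiff] with s hs
    exact (contMDiff_fibreSmul t).contMDiffAt.comp s
      (hs.comp s (contDiff_const.mul contDiff_id).contDiffAt.contMDiffAt)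
  admissible := by
    have h0 : Tendsto (fun s : ℝ ↦ t * s) (𝓝 0) (𝓝 0) := by
      simpa using (continuous_const_mul t).tendsto (0 : ℝ)
    filter_upwards [h0.eventually c.contMDiff, h0.eventually c.admissible] with s hs ha
    have h1 : MDifferentiableAt 𝓘(ℝ, ℝ) 𝓘(ℝ, E) (fun s ↦ (c.curve s).proj) (t * s) :=
      ((contMDiffAt_proj A).comp _ hs).mdifferentiableAt (by simp)
    have h2 : HasMFDerivAt 𝓘(ℝ, ℝ) 𝓘(ℝ, ℝ) (fun s ↦ t * s) s (t • ContinuousLinearMap.id ℝ ℝ) :=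
      ((hasFDerivAt_id (𝕜 := ℝ) s).const_mul t).hasMFDerivAt
    have h3 := (h1.hasMFDerivAt.comp s h2).mfderiv
    change 𝓐.anchor _ (t • (c.curve (t * s)).2) = _
    rw [map_smul, ha]
    refine Eq.trans ?_ (congrArg (fun L ↦ L (1 : ℝ)) h3).symm
    change _ = mfderiv 𝓘(ℝ, ℝ) 𝓘(ℝ, E) (fun s ↦ (c.curve s).proj) (t * s) (t • (1 : ℝ))
    exact (map_smul (mfderiv 𝓘(ℝ, ℝ) 𝓘(ℝ, E) (fun s ↦ (c.curve s).proj) (t * s)) t (1 : ℝ)).symm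

theorem differentiableAt_iteratedDeriv {X : Type*} [NormedAddCommGroup X] [NormedSpace ℝ X]
    {c : ℝ → X} {i j : ℕ} {t : ℝ} (hc : ContDiffAt ℝ j c t) (hi : i < j) :
    DifferentiableAt ℝ (iteratedDeriv i c) t := by
  have h := hc.differentiableAt_iteratedFDeriv (m := i) (by exact_mod_cast hi)
  rw [iteratedDeriv_eq_equiv_comp]
  exact (LinearIsometryEquiv.differentiableAt _).comp t h

theorem iteratedDeriv_smul_comp_mul {X Y : Type*} [NormedAddCommGroup X] [NormedSpace ℝ X]
    [NormedAddCommGroup Y] [NormedSpace ℝ Y] {c : ℝ → X}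
    (hc : ContDiffAt ℝ ∞ c 0) (L : X →L[ℝ] Y) (t : ℝ) (j : ℕ) :
    iteratedDeriv j (fun s ↦ L (c (t * s))) 0 = t ^ j • L (iteratedDeriv j c 0) := by
  have h0 : Tendsto (fun s : ℝ ↦ t * s) (𝓝 0) (𝓝 0) := by
    simpa using (continuous_const_mul t).tendsto (0 : ℝ)
  have hev : ∀ᶠ s in 𝓝 0, ContDiffAt ℝ j c s :=
    (hc.of_le (by exact_mod_cast le_top)).eventually (by simp)
  have key : ∀ i ≤ j, iteratedDeriv i (fun s ↦ L (c (t * s))) =ᶠ[𝓝 0]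
      fun s ↦ t ^ i • L (iteratedDeriv i c (t * s)) := by
    intro i
    induction i with
    | zero => intro _; simp [iteratedDeriv_zero]
    | succ i ih =>
      intro hi
      rw [iteratedDeriv_succ]
      refine (ih (by omega)).deriv.trans ?_
      filter_upwards [h0.eventually hev] with s hs
      have hd : DifferentiableAt ℝ (iteratedDeriv i c) (t * s) :=
        differentiableAt_iteratedDeriv hs (by exact_mod_cast hi)
      have h1 : HasDerivAt (fun s ↦ iteratedDeriv i c (t * s))
          (t • deriv (iteratedDeriv i c) (t * s)) s := by
        simpa [Function.comp_def] using hd.hasDerivAt.scomp s ((hasDerivAt_id s).const_mul t)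
      have h2 := ((L.hasFDerivAt.comp_hasDerivAt s h1).const_smul (t ^ i)).deriv
      refine h2.trans ?_
      rw [map_smul, smul_smul, pow_succ, iteratedDeriv_succ]
  simpa using (key j le_rfl).self_of_nhds

theorem AdmissibleCurve.iteratedDeriv_scale (t : ℝ) {x p : M} (hx : x ∈ chartDomain E R A p)
    (c : 𝓐.AdmissibleCurve x) (j : ℕ) :
    iteratedDeriv j (adaptedChart E R A p ∘ (c.scale t).curve) 0 =
      t ^ j • ((ContinuousLinearMap.fst ℝ E R).prod (t • ContinuousLinearMap.snd ℝ E R))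
        (iteratedDeriv j (adaptedChart E R A p ∘ c.curve) 0) := by
  rw [← iteratedDeriv_smul_comp_mul (c.eventually_contDiffAt hx).self_of_nhds]
  refine Filter.EventuallyEq.iteratedDeriv_eq _ ?_
  have h0 : Tendsto (fun s : ℝ ↦ t * s) (𝓝 0) (𝓝 0) := by
    simpa using (continuous_const_mul t).tendsto (0 : ℝ)
  filter_upwards [h0.eventually (c.eventually_mem hx)] with s hs
  have h1 : ((c.scale t).curve s).proj ∈ chartDomain E R A p := hs
  rw [Function.comp_apply, Function.comp_apply, adaptedChart_apply h1, adaptedChart_apply hs]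
  refine Prod.ext rfl ?_
  exact ((trivializationAt R A p).linear ℝ hs.2).map_smul t _

variable (𝓐)

/-- The homogeneity structure `h t` of `A^n`: the jet of the curve `c` goes to the jet of
`s ↦ t • c (t s)`. -/
def homogeneity (n : ℕ) (t : ℝ) (q : 𝓐.HigherBundle n) : 𝓐.HigherBundle n :=
  ⟨q.base, Quotient.map' (AdmissibleCurve.scale t) (fun c c' h p hp j hj ↦ by
    rw [c.iteratedDeriv_scale t hp, c'.iteratedDeriv_scale t hp, h p hp j hj]) q.jet⟩

/-- In coordinates, the homogeneity structure multiplies `y_w` by `t ^ w`. -/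
theorem jetCoord_homogeneity {n : ℕ} {p : M} (t : ℝ) {q : 𝓐.HigherBundle n}
    (hq : q.base ∈ chartDomain E R A p) :
    𝓐.jetCoord n p (𝓐.homogeneity n t q) =
      ((𝓐.jetCoord n p q).1, fun j : Fin n ↦ t ^ (j + 1 : ℕ) • (𝓐.jetCoord n p q).2 j) := by
  obtain ⟨x, c⟩ := q
  induction c using Quotient.inductionOn with | _ c
  change 𝓐.jetCoord n p ⟨x, Quotient.mk _ (c.scale t)⟩ = _
  rw [jetCoord_mk hq, jetCoord_mk hq]
  refine Prod.ext rfl (funext fun j ↦ ?_)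
  simp only [c.iteratedDeriv_scale t hq]
  simp [pow_succ, smul_smul]

variable [FiniteDimensional ℝ E] [FiniteDimensional ℝ R]

theorem chartAt_higherBundle (n : ℕ) (q : 𝓐.HigherBundle n) :
    (extChartAt 𝓘(ℝ, E × (Fin n → R)) q : _ → _) = 𝓐.jetCoord n q.base := rfl

theorem extChartAt_source_higherBundle (n : ℕ) (q : 𝓐.HigherBundle n) :
    (extChartAt 𝓘(ℝ, E × (Fin n → R)) q).source = {q' | q'.base ∈ chartDomain E R A q.base} := by
  rw [extChartAt_source]
  rfl

theorem contMDiffOn_extChartAt_higherBundle (n : ℕ) (q : 𝓐.HigherBundle n) :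
    ContMDiffOn 𝓘(ℝ, E × (Fin n → R)) 𝓘(ℝ, E × (Fin n → R)) ∞
      (extChartAt 𝓘(ℝ, E × (Fin n → R)) q) (extChartAt 𝓘(ℝ, E × (Fin n → R)) q).source := by
  rw [extChartAt_source]
  exact contMDiffOn_extChartAt

theorem contMDiff_base (n : ℕ) : ContMDiff 𝓘(ℝ, E × (Fin n → R)) 𝓘(ℝ, E) ∞
    (HigherBundle.base : 𝓐.HigherBundle n → M) := by
  intro q
  have h1 : ContMDiffOn 𝓘(ℝ, E × (Fin n → R)) 𝓘(ℝ, E) ∞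
      (fun q' ↦ (extChartAt 𝓘(ℝ, E) q.base).symm (extChartAt 𝓘(ℝ, E × (Fin n → R)) q q').1)
      (extChartAt 𝓘(ℝ, E × (Fin n → R)) q).source := by
    refine (contMDiffOn_extChartAt_symm (I := 𝓘(ℝ, E)) (n := ∞) q.base).comp
      (t := (extChartAt 𝓘(ℝ, E) q.base).target)
      ((ContinuousLinearMap.fst ℝ E (Fin n → R)).contMDiff.comp_contMDiffOn
        (𝓐.contMDiffOn_extChartAt_higherBundle n q)) ?_
    intro q' hq'
    rw [extChartAt_source_higherBundle] at hq'
    exact (extChartAt 𝓘(ℝ, E) q.base).map_source (by rw [extChartAt_source]; exact hq'.1)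
  refine ((h1.contMDiffAt (extChartAt_source_mem_nhds q))).congr_of_eventuallyEq ?_
  filter_upwards [extChartAt_source_mem_nhds (I := 𝓘(ℝ, E × (Fin n → R))) q] with q' hq'
  rw [extChartAt_source_higherBundle] at hq'
  exact ((extChartAt 𝓘(ℝ, E) q.base).left_inv (by rw [extChartAt_source]; exact hq'.1)).symm

theorem contMDiff_homogeneity (n : ℕ) (t : ℝ) : ContMDiff 𝓘(ℝ, E × (Fin n → R))
    𝓘(ℝ, E × (Fin n → R)) ∞ (𝓐.homogeneity n t) := by
  intro q
  let L : (E × (Fin n → R)) →L[ℝ] E × (Fin n → R) :=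
    (ContinuousLinearMap.fst ℝ E (Fin n → R)).prod
      (ContinuousLinearMap.pi fun j : Fin n ↦ t ^ (j + 1 : ℕ) •
        (ContinuousLinearMap.proj j).comp (ContinuousLinearMap.snd ℝ E (Fin n → R)))
  have hL : ∀ q' ∈ (extChartAt 𝓘(ℝ, E × (Fin n → R)) q).source,
      extChartAt 𝓘(ℝ, E × (Fin n → R)) q (𝓐.homogeneity n t q') =
        L (extChartAt 𝓘(ℝ, E × (Fin n → R)) q q') := by
    intro q' hq'
    rw [extChartAt_source_higherBundle] at hq'
    exact 𝓐.jetCoord_homogeneity t hq'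
  have hs : ∀ q' ∈ (extChartAt 𝓘(ℝ, E × (Fin n → R)) q).source,
      𝓐.homogeneity n t q' ∈ (extChartAt 𝓘(ℝ, E × (Fin n → R)) q).source := by
    intro q' hq'
    rw [extChartAt_source_higherBundle] at hq' ⊢
    exact hq'
  have h1 : ContMDiffOn 𝓘(ℝ, E × (Fin n → R)) 𝓘(ℝ, E × (Fin n → R)) ∞
      (fun q' ↦ (extChartAt 𝓘(ℝ, E × (Fin n → R)) q).symm
        (L (extChartAt 𝓘(ℝ, E × (Fin n → R)) q q')))
      (extChartAt 𝓘(ℝ, E × (Fin n → R)) q).source := by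
    refine (contMDiffOn_extChartAt_symm (I := 𝓘(ℝ, E × (Fin n → R))) (n := ∞) q).comp
      (L.contMDiff.comp_contMDiffOn (𝓐.contMDiffOn_extChartAt_higherBundle n q)) ?_
    intro q' hq'
    have := (extChartAt 𝓘(ℝ, E × (Fin n → R)) q).map_source (hs q' hq')
    rw [hL q' hq'] at this
    exact this
  refine ((h1.contMDiffAt (extChartAt_source_mem_nhds q))).congr_of_eventuallyEq ?_
  filter_upwards [extChartAt_source_mem_nhds (I := 𝓘(ℝ, E × (Fin n → R))) q] with q' hq'
  rw [← hL q' hq', (extChartAt 𝓘(ℝ, E × (Fin n → R)) q).left_inv (hs q' hq')]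

end AnchoredBundle
end HigherAlgebroid

namespace HigherAlgebroid

variable {E R M : Type*} [NormedAddCommGroup E] [NormedSpace ℝ E] [NormedAddCommGroup R]
  [NormedSpace ℝ R] [TopologicalSpace M] [ChartedSpace E M] [IsManifold 𝓘(ℝ, E) ∞ M]
  {A : M → Type*} [∀ x, AddCommGroup (A x)] [∀ x, Module ℝ (A x)] [∀ x, TopologicalSpace (A x)]
  [TopologicalSpace (TotalSpace R A)] [FiberBundle R A] [VectorBundle ℝ R A]
  [ContMDiffVectorBundle ∞ R A 𝓘(ℝ, E)]

theorem contMDiffOn_clm {H N F G : Type*} [NormedAddCommGroup H] [NormedSpace ℝ H]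
    [TopologicalSpace N] [ChartedSpace H N]
    [NormedAddCommGroup F] [NormedSpace ℝ F] [FiniteDimensional ℝ F]
    [NormedAddCommGroup G] [NormedSpace ℝ G] {f : N → F →L[ℝ] G} {s : Set N}
    (hf : ∀ y, ContMDiffOn 𝓘(ℝ, H) 𝓘(ℝ, G) ∞ (fun x ↦ f x y) s) :
    ContMDiffOn 𝓘(ℝ, H) 𝓘(ℝ, F →L[ℝ] G) ∞ f s := by
  let d := Module.finrank ℝ F
  have hd : d = Module.finrank ℝ (Fin d → ℝ) := (Module.finrank_fin_fun ℝ).symm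
  let e₁ := ContinuousLinearEquiv.ofFinrankEq hd
  let e₂ := (e₁.arrowCongr (1 : G ≃L[ℝ] G)).trans (ContinuousLinearEquiv.piRing (Fin d))
  have h : ContMDiffOn 𝓘(ℝ, H) 𝓘(ℝ, Fin d → G) ∞ (e₂ ∘ f) s :=
    contMDiffOn_pi_space.2 fun i ↦ hf _
  have h2 : f = e₂.symm ∘ e₂ ∘ f := by funext x; simp
  rw [h2]
  exact e₂.symm.contDiff.contMDiff.comp_contMDiffOn h

namespace AnchoredBundle

variable (𝓐 : AnchoredBundle E R A)

/-- The anchor at `x` in the local trivializations around `p`. -/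
def localAnchorMap (p x : M) : R →L[ℝ] E :=
  ((trivializationAt E (TangentSpace 𝓘(ℝ, E)) p).continuousLinearMapAt ℝ x).comp
    ((𝓐.anchor x).comp ((trivializationAt R A p).symmL ℝ x))

theorem contMDiffOn_localAnchorMap [FiniteDimensional ℝ R] (p : M) :
    ContMDiffOn 𝓘(ℝ, E) 𝓘(ℝ, R →L[ℝ] E) ∞ (𝓐.localAnchorMap p) (chartDomain E R A p) := by
  refine contMDiffOn_clm fun y ↦ ?_
  have h1 : ContMDiffOn 𝓘(ℝ, E) 𝓘(ℝ, E × R) ∞ (fun x ↦ (extChartAt 𝓘(ℝ, E) p x, y))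
      (chartDomain E R A p) :=
    ((contMDiffOn_extChartAt (I := 𝓘(ℝ, E)) (n := ∞) (x := p)).mono fun x hx ↦ hx.1).prodMk_space
      contMDiffOn_const
  have hm : ∀ x ∈ chartDomain E R A p, (extChartAt 𝓘(ℝ, E) p x, y) ∈
      (adaptedChart E R A p).target := fun x hx ↦
    mem_adaptedChart_target.2 ⟨(chartAt E p).map_source hx.1, by
      change (chartAt E p).symm (chartAt E p x) ∈ _
      rw [(chartAt E p).left_inv hx.1]; exact hx.2⟩
  have h2 := (𝓐.contDiffOn_localAnchor p).contMDiffOn.comp h1 hm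
  refine h2.congr fun x hx ↦ ?_
  have e : (adaptedChart E R A p).symm (extChartAt 𝓘(ℝ, E) p x, y) =
      ⟨x, (trivializationAt R A p).symm x y⟩ := by
    have : (extChartAt 𝓘(ℝ, E) p x, y) =
        adaptedChart E R A p ⟨x, (trivializationAt R A p).symm x y⟩ := by
      rw [adaptedChart_apply (show (⟨x, _⟩ : TotalSpace R A).proj ∈ chartDomain E R A p from hx),
        Trivialization.apply_mk_symm _ hx.2]
      rfl
    rw [this, (adaptedChart E R A p).left_inv (mem_adaptedChart_source.2 hx)]
  simp only [Function.comp_apply, localAnchor]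
  rw [e]
  simp only [localAnchorMap, ContinuousLinearMap.comp_apply]
  rw [Trivialization.continuousLinearMapAt_apply, Trivialization.linearMapAt_apply,
    if_pos (show x ∈ (trivializationAt E (TangentSpace 𝓘(ℝ, E)) p).baseSet from hx.1),
    Trivialization.symmL_apply _ hx.2]

variable [FiniteDimensional ℝ E] [FiniteDimensional ℝ R]

/-- The fibre of the prolongation over `q ∈ A^n`: the pairs `(Y, Z)`, with `Y` in the fibre of `A`
over the projection of `q` to `M` and `Z ∈ T_q A^n`, such that the anchor of `Y` is the projection
of `Z` to `T M`. -/
def prolongationFibre (n : ℕ) (q : 𝓐.HigherBundle n) :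
    Submodule ℝ (A q.base × TangentSpace 𝓘(ℝ, E × (Fin n → R)) q) where
  carrier := {v | 𝓐.anchor q.base v.1 =
    mfderiv 𝓘(ℝ, E × (Fin n → R)) 𝓘(ℝ, E) (HigherBundle.base : 𝓐.HigherBundle n → M) q v.2}
  add_mem' {v w} hv hw := by
    change 𝓐.anchor q.base (v.1 + w.1) = mfderiv _ _ _ q (v.2 + w.2)
    rw [map_add, map_add]
    exact congrArg₂ (· + ·) hv hw
  zero_mem' := by
    change 𝓐.anchor q.base 0 = mfderiv _ _ _ q 0
    rw [map_zero, map_zero]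
  smul_mem' t v hv := by
    change 𝓐.anchor q.base (t • v.1) = mfderiv _ _ _ q (t • v.2)
    rw [map_smul, map_smul]
    exact congrArg (t • ·) hv

/-- The prolongation `{(Y, Z) ∈ A ×_M T A^n | ρ(Y) = T τ(Z)}`, as a family of vector spaces
over `A^n`. For `n = k - 1` this is `D(A^k)`. -/
def Prolongation (n : ℕ) (q : 𝓐.HigherBundle n) : Type _ := 𝓐.prolongationFibre n q

instance (n : ℕ) (q : 𝓐.HigherBundle n) : AddCommGroup (𝓐.Prolongation n q) :=
  inferInstanceAs (AddCommGroup (𝓐.prolongationFibre n q))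

instance (n : ℕ) (q : 𝓐.HigherBundle n) : Module ℝ (𝓐.Prolongation n q) :=
  inferInstanceAs (Module ℝ (𝓐.prolongationFibre n q))

instance (n : ℕ) (q : 𝓐.HigherBundle n) : TopologicalSpace (𝓐.Prolongation n q) :=
  inferInstanceAs (TopologicalSpace (𝓐.prolongationFibre n q))

/-- A pair `(Y, Z)` as an element of the prolongation. -/
def prMk {n : ℕ} {q : 𝓐.HigherBundle n} (v : A q.base × TangentSpace 𝓘(ℝ, E × (Fin n → R)) q)
    (hv : v ∈ 𝓐.prolongationFibre n q) : 𝓐.Prolongation n q := ⟨v, hv⟩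

/-- The component `Y` of `(Y, Z)`. -/
def prFst {n : ℕ} (q : 𝓐.HigherBundle n) : 𝓐.Prolongation n q →L[ℝ] A q.base :=
  (ContinuousLinearMap.fst ℝ (A q.base) (TangentSpace 𝓘(ℝ, E × (Fin n → R)) q)).comp
    (𝓐.prolongationFibre n q).subtypeL

/-- The component `Z` of `(Y, Z)`. -/
def prSnd {n : ℕ} (q : 𝓐.HigherBundle n) :
    𝓐.Prolongation n q →L[ℝ] TangentSpace 𝓘(ℝ, E × (Fin n → R)) q :=
  (ContinuousLinearMap.snd ℝ (A q.base) (TangentSpace 𝓘(ℝ, E × (Fin n → R)) q)).comp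
    (𝓐.prolongationFibre n q).subtypeL

theorem pr_eq {n : ℕ} {q : 𝓐.HigherBundle n} (v : 𝓐.Prolongation n q) :
    𝓐.anchor q.base (𝓐.prFst q v) = mfderiv 𝓘(ℝ, E × (Fin n → R)) 𝓘(ℝ, E)
      (HigherBundle.base : 𝓐.HigherBundle n → M) q (𝓐.prSnd q v) := v.2

theorem pr_ext {n : ℕ} {q : 𝓐.HigherBundle n} {v w : 𝓐.Prolongation n q}
    (h1 : 𝓐.prFst q v = 𝓐.prFst q w) (h2 : 𝓐.prSnd q v = 𝓐.prSnd q w) : v = w :=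
  Subtype.ext (Prod.ext h1 h2)

/-- The projection `T A^n → T M` in local trivializations. -/
theorem mfderiv_base {n : ℕ} {q₀ q : 𝓐.HigherBundle n} (hq : q.base ∈ chartDomain E R A q₀.base)
    (Z : TangentSpace 𝓘(ℝ, E × (Fin n → R)) q) :
    (trivializationAt E (TangentSpace 𝓘(ℝ, E)) q₀.base).continuousLinearMapAt ℝ q.base
      (mfderiv 𝓘(ℝ, E × (Fin n → R)) 𝓘(ℝ, E) (HigherBundle.base : 𝓐.HigherBundle n → M) q Z) =
    ((trivializationAt (E × (Fin n → R)) (TangentSpace 𝓘(ℝ, E × (Fin n → R)))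
      q₀).continuousLinearMapAt ℝ q Z).1 := by
  have hq' : q ∈ (chartAt (E × (Fin n → R)) q₀).source := hq
  rw [TangentBundle.continuousLinearMapAt_trivializationAt hq.1,
    TangentBundle.continuousLinearMapAt_trivializationAt hq']
  have h1 := (mdifferentiableAt_extChartAt (I := 𝓘(ℝ, E)) hq.1).hasMFDerivAt.comp q
    ((𝓐.contMDiff_base n).mdifferentiableAt (by simp) (x := q)).hasMFDerivAt
  have h2 := ((ContinuousLinearMap.fst ℝ E (Fin n → R)).hasMFDerivAt
      (x := extChartAt 𝓘(ℝ, E × (Fin n → R)) q₀ q)).comp q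
    (mdifferentiableAt_extChartAt (I := 𝓘(ℝ, E × (Fin n → R))) hq').hasMFDerivAt
  exact congrArg (fun L ↦ L Z) (hasMFDerivAt_unique h1 h2)

/-- The local coordinates on a fibre of the prolongation: the coordinates of `Y`, and the coordinates
of `Z` vertical with respect to the projection to `M`. -/
def prCoord {n : ℕ} (q₀ q : 𝓐.HigherBundle n) : 𝓐.Prolongation n q →L[ℝ] R × (Fin n → R) :=
  (((trivializationAt R A q₀.base).continuousLinearMapAt ℝ q.base).comp (𝓐.prFst q)).prod
    ((ContinuousLinearMap.snd ℝ E (Fin n → R)).comp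
      (((trivializationAt (E × (Fin n → R)) (TangentSpace 𝓘(ℝ, E × (Fin n → R)))
        q₀).continuousLinearMapAt ℝ q).comp (𝓐.prSnd q)))

/-- The component `Z` in terms of the local coordinates. -/
def prSymmSnd {n : ℕ} (q₀ q : 𝓐.HigherBundle n) :
    R × (Fin n → R) →L[ℝ] TangentSpace 𝓘(ℝ, E × (Fin n → R)) q :=
  ((trivializationAt (E × (Fin n → R)) (TangentSpace 𝓘(ℝ, E × (Fin n → R))) q₀).symmL ℝ q).comp
    (((𝓐.localAnchorMap q₀.base q.base).comp (ContinuousLinearMap.fst ℝ R (Fin n → R))).prod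
      (ContinuousLinearMap.snd ℝ R (Fin n → R)))

theorem prSymm_mem {n : ℕ} {q₀ q : 𝓐.HigherBundle n} (hq : q.base ∈ chartDomain E R A q₀.base)
    (f : R × (Fin n → R)) :
    ((trivializationAt R A q₀.base).symmL ℝ q.base f.1, 𝓐.prSymmSnd q₀ q f) ∈
      𝓐.prolongationFibre n q := by
  change 𝓐.anchor q.base _ = mfderiv _ _ _ q _
  have hinj : Function.Injective
      ((trivializationAt E (TangentSpace 𝓘(ℝ, E)) q₀.base).continuousLinearMapAt ℝ q.base) :=
    Function.LeftInverse.injective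
      (g := (trivializationAt E (TangentSpace 𝓘(ℝ, E)) q₀.base).symmL ℝ q.base)
      fun v ↦ Trivialization.symmL_continuousLinearMapAt _ hq.1 v
  apply hinj
  rw [𝓐.mfderiv_base hq]
  simp only [prSymmSnd, ContinuousLinearMap.comp_apply]
  rw [Trivialization.continuousLinearMapAt_symmL _ (show q ∈ (trivializationAt (E × (Fin n → R))
    (TangentSpace 𝓘(ℝ, E × (Fin n → R))) q₀).baseSet from hq)]
  rfl

open Classical in
/-- The vector of the prolongation with given local coordinates. -/
def prSymm {n : ℕ} (q₀ q : 𝓐.HigherBundle n) (f : R × (Fin n → R)) : 𝓐.Prolongation n q :=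
  if hq : q.base ∈ chartDomain E R A q₀.base then 𝓐.prMk _ (𝓐.prSymm_mem hq f) else 0

theorem prFst_prSymm {n : ℕ} {q₀ q : 𝓐.HigherBundle n} (hq : q.base ∈ chartDomain E R A q₀.base)
    (f : R × (Fin n → R)) :
    𝓐.prFst q (𝓐.prSymm q₀ q f) = (trivializationAt R A q₀.base).symmL ℝ q.base f.1 := by
  rw [prSymm, dif_pos hq]
  rfl

theorem prSnd_prSymm {n : ℕ} {q₀ q : 𝓐.HigherBundle n} (hq : q.base ∈ chartDomain E R A q₀.base)
    (f : R × (Fin n → R)) : 𝓐.prSnd q (𝓐.prSymm q₀ q f) = 𝓐.prSymmSnd q₀ q f := by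
  rw [prSymm, dif_pos hq]
  rfl

theorem prSymm_prCoord {n : ℕ} {q₀ q : 𝓐.HigherBundle n} (hq : q.base ∈ chartDomain E R A q₀.base)
    (v : 𝓐.Prolongation n q) : 𝓐.prSymm q₀ q (𝓐.prCoord q₀ q v) = v := by
  have hq' : q ∈ (trivializationAt (E × (Fin n → R))
    (TangentSpace 𝓘(ℝ, E × (Fin n → R))) q₀).baseSet := hq
  have h1 : (trivializationAt R A q₀.base).symmL ℝ q.base (𝓐.prCoord q₀ q v).1 = 𝓐.prFst q v :=
    Trivialization.symmL_continuousLinearMapAt _ hq.2 _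
  refine 𝓐.pr_ext ?_ ?_
  · rw [𝓐.prFst_prSymm hq, h1]
  · rw [𝓐.prSnd_prSymm hq, ← Trivialization.symmL_continuousLinearMapAt (R := ℝ) _ hq'
      (𝓐.prSnd q v)]
    simp only [prSymmSnd, ContinuousLinearMap.comp_apply]
    congr 1
    refine Prod.ext ?_ rfl
    rw [← 𝓐.mfderiv_base hq, ← 𝓐.pr_eq v, ← h1]
    rfl

theorem prCoord_prSymm {n : ℕ} {q₀ q : 𝓐.HigherBundle n} (hq : q.base ∈ chartDomain E R A q₀.base)
    (f : R × (Fin n → R)) : 𝓐.prCoord q₀ q (𝓐.prSymm q₀ q f) = f := by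
  have hq' : q ∈ (trivializationAt (E × (Fin n → R))
    (TangentSpace 𝓘(ℝ, E × (Fin n → R))) q₀).baseSet := hq
  refine Prod.ext ?_ ?_
  · change (trivializationAt R A q₀.base).continuousLinearMapAt ℝ q.base
      (𝓐.prFst q (𝓐.prSymm q₀ q f)) = _
    rw [𝓐.prFst_prSymm hq, Trivialization.continuousLinearMapAt_symmL _ hq.2]
  · change ((trivializationAt (E × (Fin n → R)) (TangentSpace 𝓘(ℝ, E × (Fin n → R)))
      q₀).continuousLinearMapAt ℝ q (𝓐.prSnd q (𝓐.prSymm q₀ q f))).2 = _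
    rw [𝓐.prSnd_prSymm hq]
    simp only [prSymmSnd, ContinuousLinearMap.comp_apply]
    rw [Trivialization.continuousLinearMapAt_symmL _ hq']
    rfl

theorem isOpen_base_preimage (n : ℕ) (p : M) :
    IsOpen {q : 𝓐.HigherBundle n | q.base ∈ chartDomain E R A p} :=
  (isOpen_chartDomain p).preimage (𝓐.contMDiff_base n).continuous

/-- The local trivialization of the prolongation defined by the local coordinates. -/
def prPretrivialization {n : ℕ} (q₀ : 𝓐.HigherBundle n) :
    Pretrivialization (R × (Fin n → R)) (π (R × (Fin n → R)) (𝓐.Prolongation n)) where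
  toFun v := (v.proj, 𝓐.prCoord q₀ v.proj v.2)
  invFun z := ⟨z.1, 𝓐.prSymm q₀ z.1 z.2⟩
  source := {v : TotalSpace (R × (Fin n → R)) (𝓐.Prolongation n) | v.proj.base ∈ chartDomain E R A q₀.base}
  target := {q : 𝓐.HigherBundle n | q.base ∈ chartDomain E R A q₀.base} ×ˢ univ
  baseSet := {q : 𝓐.HigherBundle n | q.base ∈ chartDomain E R A q₀.base}
  map_source' v hv := ⟨hv, mem_univ _⟩
  map_target' z hz := hz.1
  left_inv' v hv := by
    obtain ⟨q, v⟩ := v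
    exact congrArg (TotalSpace.mk q) (𝓐.prSymm_prCoord hv v)
  right_inv' z hz := Prod.ext rfl (𝓐.prCoord_prSymm hz.1 z.2)
  open_target := (𝓐.isOpen_base_preimage n _).prod isOpen_univ
  open_baseSet := 𝓐.isOpen_base_preimage n _
  source_eq := rfl
  target_eq := rfl
  proj_toFun _ _ := rfl

/-- The transition functions of the prolongation. -/
def prChange {n : ℕ} (q₀ q₁ q : 𝓐.HigherBundle n) : R × (Fin n → R) →L[ℝ] R × (Fin n → R) :=
  (((trivializationAt R A q₀.base).coordChangeL ℝ (trivializationAt R A q₁.base) q.base :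
      R →L[ℝ] R).comp (ContinuousLinearMap.fst ℝ R (Fin n → R))).prod
    ((ContinuousLinearMap.snd ℝ E (Fin n → R)).comp
      (((trivializationAt (E × (Fin n → R)) (TangentSpace 𝓘(ℝ, E × (Fin n → R))) q₀).coordChangeL ℝ
        (trivializationAt (E × (Fin n → R)) (TangentSpace 𝓘(ℝ, E × (Fin n → R))) q₁) q :
          (E × (Fin n → R)) →L[ℝ] E × (Fin n → R)).comp
        (((𝓐.localAnchorMap q₀.base q.base).comp (ContinuousLinearMap.fst ℝ R (Fin n → R))).prod
          (ContinuousLinearMap.snd ℝ R (Fin n → R)))))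

theorem contMDiffOn_prChange {n : ℕ} (q₀ q₁ : 𝓐.HigherBundle n) :
    ContMDiffOn 𝓘(ℝ, E × (Fin n → R))
      𝓘(ℝ, R × (Fin n → R) →L[ℝ] R × (Fin n → R)) ∞ (𝓐.prChange q₀ q₁)
      ({q : 𝓐.HigherBundle n | q.base ∈ chartDomain E R A q₀.base} ∩ {q : 𝓐.HigherBundle n | q.base ∈ chartDomain E R A q₁.base}) := by
  have hb := (𝓐.contMDiff_base n).contMDiffOn (s := {q : 𝓐.HigherBundle n | q.base ∈ chartDomain E R A q₀.base} ∩
    {q : 𝓐.HigherBundle n | q.base ∈ chartDomain E R A q₁.base})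
  have h1 := (contMDiffOn_coordChangeL (IB := 𝓘(ℝ, E)) (n := ∞) (trivializationAt R A q₀.base)
    (trivializationAt R A q₁.base)).comp hb fun q hq ↦ ⟨hq.1.2, hq.2.2⟩
  have h2 := (contMDiffOn_coordChangeL (IB := 𝓘(ℝ, E × (Fin n → R))) (n := ∞)
    (trivializationAt (E × (Fin n → R)) (TangentSpace 𝓘(ℝ, E × (Fin n → R))) q₀)
    (trivializationAt (E × (Fin n → R)) (TangentSpace 𝓘(ℝ, E × (Fin n → R))) q₁)).mono
    (s := {q : 𝓐.HigherBundle n | q.base ∈ chartDomain E R A q₀.base} ∩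
    {q : 𝓐.HigherBundle n | q.base ∈ chartDomain E R A q₁.base}) fun q hq ↦ hq
  have h3 := (𝓐.contMDiffOn_localAnchorMap q₀.base).comp hb fun q hq ↦ hq.1
  refine contMDiffOn_clm fun f ↦ ?_
  exact (h1.clm_apply contMDiffOn_const).prodMk_space
    ((ContinuousLinearMap.snd ℝ E (Fin n → R)).contMDiff.comp_contMDiffOn
      (h2.clm_apply ((h3.clm_apply contMDiffOn_const).prodMk_space contMDiffOn_const)))

theorem prChange_apply {n : ℕ} {q₀ q₁ q : 𝓐.HigherBundle n}
    (h0 : q.base ∈ chartDomain E R A q₀.base) (h1 : q.base ∈ chartDomain E R A q₁.base)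
    (f : R × (Fin n → R)) :
    𝓐.prChange q₀ q₁ q f =
      (𝓐.prPretrivialization q₁ ⟨q, (𝓐.prPretrivialization q₀).symm q f⟩).2 := by
  have e : (⟨q, (𝓐.prPretrivialization q₀).symm q f⟩ :
      TotalSpace (R × (Fin n → R)) (𝓐.Prolongation n)) = ⟨q, 𝓐.prSymm q₀ q f⟩ :=
    (𝓐.prPretrivialization q₀).mk_symm h0 f
  rw [e]
  change _ = 𝓐.prCoord q₁ q (𝓐.prSymm q₀ q f)
  refine Prod.ext ?_ ?_
  · change _ = (trivializationAt R A q₁.base).continuousLinearMapAt ℝ q.base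
      (𝓐.prFst q (𝓐.prSymm q₀ q f))
    rw [𝓐.prFst_prSymm h0]
    change (trivializationAt R A q₀.base).coordChangeL ℝ (trivializationAt R A q₁.base) q.base f.1
      = _
    rw [Trivialization.coordChangeL_apply _ _ ⟨h0.2, h1.2⟩,
      Trivialization.continuousLinearMapAt_apply, Trivialization.linearMapAt_apply, if_pos h1.2,
      Trivialization.symmL_apply _ h0.2]
  · have h0' : q ∈ (trivializationAt (E × (Fin n → R))
      (TangentSpace 𝓘(ℝ, E × (Fin n → R))) q₀).baseSet := h0
    have h1' : q ∈ (trivializationAt (E × (Fin n → R))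
      (TangentSpace 𝓘(ℝ, E × (Fin n → R))) q₁).baseSet := h1
    change _ = ((trivializationAt (E × (Fin n → R)) (TangentSpace 𝓘(ℝ, E × (Fin n → R)))
      q₁).continuousLinearMapAt ℝ q (𝓐.prSnd q (𝓐.prSymm q₀ q f))).2
    rw [𝓐.prSnd_prSymm h0]
    change ((trivializationAt (E × (Fin n → R)) (TangentSpace 𝓘(ℝ, E × (Fin n → R)))
      q₀).coordChangeL ℝ (trivializationAt (E × (Fin n → R))
        (TangentSpace 𝓘(ℝ, E × (Fin n → R))) q₁) q
        (𝓐.localAnchorMap q₀.base q.base f.1, f.2)).2 = _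
    rw [Trivialization.coordChangeL_apply _ _ ⟨h0', h1'⟩,
      Trivialization.continuousLinearMapAt_apply, Trivialization.linearMapAt_apply, if_pos h1']
    simp only [prSymmSnd, ContinuousLinearMap.comp_apply]
    rw [Trivialization.symmL_apply _ h0']
    rfl

/-- The vector bundle structure of the prolongation. -/
def prPrebundle (n : ℕ) : VectorPrebundle ℝ (R × (Fin n → R)) (𝓐.Prolongation n) where
  pretrivializationAtlas := range 𝓐.prPretrivialization
  pretrivialization_linear' := by
    rintro _ ⟨q₀, rfl⟩
    exact ⟨fun q hq ↦ ⟨fun v w ↦ map_add (𝓐.prCoord q₀ q) v w,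
      fun t v ↦ map_smul (𝓐.prCoord q₀ q) t v⟩⟩
  pretrivializationAt := 𝓐.prPretrivialization
  mem_base_pretrivializationAt q := mem_chartDomain_self q.base
  pretrivialization_mem_atlas q := mem_range_self q
  exists_coordChange := by
    rintro _ ⟨q₀, rfl⟩ _ ⟨q₁, rfl⟩
    exact ⟨𝓐.prChange q₀ q₁, (𝓐.contMDiffOn_prChange q₀ q₁).continuousOn,
      fun q hq f ↦ 𝓐.prChange_apply hq.1 hq.2 f⟩
  totalSpaceMk_isInducing q := by
    have hq := mem_chartDomain_self (E := E) (R := R) (A := A) q.base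
    have h1 : IsInducing (𝓐.prCoord q q) := by
      have hc : Continuous fun f : R × (Fin n → R) ↦
          (((trivializationAt R A q.base).symmL ℝ q.base f.1, 𝓐.prSymmSnd q q f) :
            A q.base × TangentSpace 𝓘(ℝ, E × (Fin n → R)) q) :=
        (((trivializationAt R A q.base).symmL ℝ q.base).continuous.comp continuous_fst).prodMk
          (𝓐.prSymmSnd q q).continuous
      refine IsInducing.of_comp (𝓐.prCoord q q).continuous hc ?_
      have e : (fun f : R × (Fin n → R) ↦
          (((trivializationAt R A q.base).symmL ℝ q.base f.1, 𝓐.prSymmSnd q q f) :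
            A q.base × TangentSpace 𝓘(ℝ, E × (Fin n → R)) q)) ∘ 𝓐.prCoord q q =
          (Subtype.val : 𝓐.prolongationFibre n q → _) := by
        funext v
        refine Eq.trans ?_ (congrArg Subtype.val (𝓐.prSymm_prCoord hq v))
        rw [prSymm, dif_pos hq]
        rfl
      rw [e]
      exact IsInducing.subtypeVal
    have h2 : IsInducing fun f : R × (Fin n → R) ↦ (q, f) := isInducing_prodMkRight q
    exact h2.comp h1

instance (n : ℕ) : (𝓐.prPrebundle n).IsContMDiff 𝓘(ℝ, E × (Fin n → R)) ∞ where
  exists_contMDiffCoordChange := by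
    rintro _ ⟨q₀, rfl⟩ _ ⟨q₁, rfl⟩
    exact ⟨𝓐.prChange q₀ q₁, 𝓐.contMDiffOn_prChange q₀ q₁,
      fun q hq f ↦ 𝓐.prChange_apply hq.1 hq.2 f⟩

instance (n : ℕ) : TopologicalSpace (TotalSpace (R × (Fin n → R)) (𝓐.Prolongation n)) :=
  (𝓐.prPrebundle n).totalSpaceTopology

instance (n : ℕ) : FiberBundle (R × (Fin n → R)) (𝓐.Prolongation n) :=
  (𝓐.prPrebundle n).toFiberBundle

instance (n : ℕ) : VectorBundle ℝ (R × (Fin n → R)) (𝓐.Prolongation n) :=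
  (𝓐.prPrebundle n).toVectorBundle

instance (n : ℕ) : ContMDiffVectorBundle ∞ (R × (Fin n → R)) (𝓐.Prolongation n)
    𝓘(ℝ, E × (Fin n → R)) :=
  (𝓐.prPrebundle n).contMDiffVectorBundle 𝓘(ℝ, E × (Fin n → R))

theorem homogeneity_mem {n : ℕ} (t : ℝ) {q : 𝓐.HigherBundle n} (v : 𝓐.Prolongation n q) :
    (𝓐.prFst q v, mfderiv 𝓘(ℝ, E × (Fin n → R)) 𝓘(ℝ, E × (Fin n → R)) (𝓐.homogeneity n t) q
      (𝓐.prSnd q v)) ∈ 𝓐.prolongationFibre n (𝓐.homogeneity n t q) := by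
  have h1 := ((𝓐.contMDiff_base n).mdifferentiableAt (by simp)
    (x := 𝓐.homogeneity n t q)).hasMFDerivAt.comp q
    ((𝓐.contMDiff_homogeneity n t).mdifferentiableAt (by simp) (x := q)).hasMFDerivAt
  have h2 := ((𝓐.contMDiff_base n).mdifferentiableAt (by simp) (x := q)).hasMFDerivAt
  have h3 := congrArg (fun L ↦ L (𝓐.prSnd q v)) (hasMFDerivAt_unique h1 h2)
  exact (𝓐.pr_eq v).trans h3.symm

/-- The homogeneity structure of the prolongation: `(Y, Z) ↦ (Y, T(h t) Z)`. -/
def prHomogeneity {n : ℕ} (t : ℝ) (q : 𝓐.HigherBundle n) :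
    𝓐.Prolongation n q →L[ℝ] 𝓐.Prolongation n (𝓐.homogeneity n t q) :=
  ((𝓐.prFst q).prod ((mfderiv 𝓘(ℝ, E × (Fin n → R)) 𝓘(ℝ, E × (Fin n → R)) (𝓐.homogeneity n t)
    q).comp (𝓐.prSnd q))).codRestrict (𝓐.prolongationFibre n (𝓐.homogeneity n t q))
      fun v ↦ 𝓐.homogeneity_mem t v

end AnchoredBundle
end HigherAlgebroid

namespace HigherAlgebroid

variable {E R M : Type*} [NormedAddCommGroup E] [NormedSpace ℝ E] [NormedAddCommGroup R]
  [NormedSpace ℝ R] [TopologicalSpace M] [ChartedSpace E M] [IsManifold 𝓘(ℝ, E) ∞ M]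
  {A : M → Type*} [∀ x, AddCommGroup (A x)] [∀ x, Module ℝ (A x)] [∀ x, TopologicalSpace (A x)]
  [TopologicalSpace (TotalSpace R A)] [FiberBundle R A] [VectorBundle ℝ R A]
  [ContMDiffVectorBundle ∞ R A 𝓘(ℝ, E)]

/-- The derivative of the function `f` in the direction of the tangent vector `v`. -/
def dirDeriv (f : M → ℝ) {x : M} (v : TangentSpace 𝓘(ℝ, E) x) : ℝ :=
  mfderiv 𝓘(ℝ, E) 𝓘(ℝ, ℝ) f x v

variable (E R A) in
/-- An almost Lie algebroid: an anchored bundle with an `ℝ`-bilinear skew-symmetric bracket of smooth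
sections which satisfies the Leibniz rule and is compatible with the anchor:
`ρ([X, Y]) = [ρ(X), ρ(Y)]`. No Jacobi identity is assumed. -/
structure AlmostLieAlgebroid extends AnchoredBundle E R A where
  bracket : ContMDiffSection 𝓘(ℝ, E) R ∞ A → ContMDiffSection 𝓘(ℝ, E) R ∞ A →
    ContMDiffSection 𝓘(ℝ, E) R ∞ A
  bracket_add : ∀ X Y Y', bracket X (Y + Y') = bracket X Y + bracket X Y'
  bracket_smul : ∀ (t : ℝ) X Y, bracket X (t • Y) = t • bracket X Y
  bracket_skew : ∀ X Y, bracket X Y = -bracket Y X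
  leibniz : ∀ (X Y Y' : ContMDiffSection 𝓘(ℝ, E) R ∞ A) (f : M → ℝ),
    ContMDiff 𝓘(ℝ, E) 𝓘(ℝ, ℝ) ∞ f → (∀ x, Y' x = f x • Y x) →
    ∀ x, bracket X Y' x = f x • bracket X Y x +
      dirDeriv f (anchor x (X x)) • Y x
  anchor_bracket : ∀ (X Y : ContMDiffSection 𝓘(ℝ, E) R ∞ A) (x : M), anchor x (bracket X Y x) =
    VectorField.mlieBracket 𝓘(ℝ, E) (fun x ↦ anchor x (X x)) (fun x ↦ anchor x (Y x)) x

end HigherAlgebroid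

namespace GLBundle

variable {EN F N : Type*}
  [NormedAddCommGroup EN] [NormedSpace ℝ EN] [NormedAddCommGroup F] [NormedSpace ℝ F]
  [TopologicalSpace N] [ChartedSpace EN N] [IsManifold 𝓘(ℝ, EN) ∞ N]
  (V : N → Type*) [∀ q, AddCommGroup (V q)] [∀ q, Module ℝ (V q)] [∀ q, TopologicalSpace (V q)]
  [TopologicalSpace (TotalSpace F V)] [FiberBundle F V] [VectorBundle ℝ F V]
  [ContMDiffVectorBundle ∞ F V 𝓘(ℝ, EN)]

variable (F) in
/-- The total space of the dual bundle `V*`. -/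
abbrev DualTotal : Type _ := TotalSpace (F →L[ℝ] ℝ) (fun q : N ↦ V q →L[ℝ] ℝ)

variable (EN F) in
/-- The cotangent bundle `T*V` of the total space of `V`. -/
abbrev CotangentTotal : Type _ :=
  TotalSpace (EN × F →L[ℝ] ℝ)
    (fun e : TotalSpace F V ↦ TangentSpace (𝓘(ℝ, EN).prod 𝓘(ℝ, F)) e →L[ℝ] ℝ)

variable (EN F) in
/-- The tangent bundle `T(V*)` of the total space of `V*`. -/
abbrev TangentDualTotal : Type _ :=
  TangentBundle (𝓘(ℝ, EN).prod 𝓘(ℝ, F →L[ℝ] ℝ)) (DualTotal F V)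

variable {V}

section Actions

variable {h : ℝ → N → N} (hV : ∀ t q, V q →L[ℝ] V (h t q))

variable (F) in
/-- The map of the total space of `V` given by the fibrewise linear maps `hV t` over `h t`. -/
def scale (t : ℝ) (e : TotalSpace F V) : TotalSpace F V := ⟨h t e.proj, hV t e.proj e.2⟩

variable (F) in
/-- The induced map of `V*`, for `t ≠ 0`: the inverse transpose of `hV t`, multiplied by
`t ^ (k - 1)`, so that a linear coordinate on `V*` dual to one of weight `w` on `V`
has weight `k - 1 - w`. -/
def dualScale (k : ℕ) (t : ℝ) (ξ : DualTotal F V) : DualTotal F V :=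
  ⟨h t ξ.proj, t ^ (k - 1) • ξ.2.comp (hV t ξ.proj).inverse⟩

end Actions

variable (F V) in
/-- Multiplication by `s` in the fibres of `V`. -/
def fibreScale (s : ℝ) (e : TotalSpace F V) : TotalSpace F V := ⟨e.proj, s • e.2⟩

variable (EN) in
/-- The phase lift, with factor `c`, of a diffeomorphism `φ` of the total space of `V`:
the covector `α` at `e` goes to `c • α ∘ (T_e φ)⁻¹` at `φ e`. -/
def phaseLift (c : ℝ) (φ : TotalSpace F V → TotalSpace F V) (α : CotangentTotal EN F V) :
    CotangentTotal EN F V :=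
  ⟨φ α.proj, c • α.2.comp
    (mfderiv (𝓘(ℝ, EN).prod 𝓘(ℝ, F)) (𝓘(ℝ, EN).prod 𝓘(ℝ, F)) φ α.proj).inverse⟩

variable (EN F) in
/-- The vertical tangent vector at `e ∈ V q` defined by `v ∈ V q`. -/
def verticalLift {q : N} (e v : V q) :
    TangentSpace (𝓘(ℝ, EN).prod 𝓘(ℝ, F)) (⟨q, e⟩ : TotalSpace F V) :=
  mfderiv 𝓘(ℝ, ℝ) (𝓘(ℝ, EN).prod 𝓘(ℝ, F))
    (fun s : ℝ ↦ (⟨q, e + s • v⟩ : TotalSpace F V)) 0 (1 : ℝ)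

/-- `ξ ∈ V*_q` is the image of the covector `α ∈ T*_e V`, `e ∈ V q`,
under the canonical projection `T*V → V*` (restriction of `α` to vertical vectors). -/
def Covers {q : N} (e : V q)
    (α : TangentSpace (𝓘(ℝ, EN).prod 𝓘(ℝ, F)) (⟨q, e⟩ : TotalSpace F V) →L[ℝ] ℝ)
    (ξ : V q →L[ℝ] ℝ) : Prop :=
  ∀ v : V q, α (verticalLift EN F e v) = ξ v

variable (V) in
/-- `V → N` with the maps `hV t` over `h t` is a graded-linear bundle of degree `k`: the maps
define an action of the monoid `(ℝ, ·)` by vector bundle morphisms, and around every point there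
are homogeneous local coordinates (a chart of `N` and a local trivialization of `V`), the
coordinates having weights at most `k - 1` with respect to this action.
(The second weight is that of the vector bundle structure.) -/
structure IsGradedLinear (k : ℕ) (h : ℝ → N → N) (hV : ∀ t q, V q →L[ℝ] V (h t q)) : Prop where
  one : scale F hV 1 = id
  mul : ∀ s t, scale F hV (s * t) = scale F hV s ∘ scale F hV t
  contMDiff : ContMDiff (𝓘(ℝ, ℝ).prod (𝓘(ℝ, EN).prod 𝓘(ℝ, F))) (𝓘(ℝ, EN).prod 𝓘(ℝ, F)) ∞
    (fun p : ℝ × TotalSpace F V ↦ scale F hV p.1 p.2)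
  homogeneous_coordinates : ∀ q₀ : N,
    ∃ φ ∈ IsManifold.maximalAtlas 𝓘(ℝ, EN) ∞ N, ∃ e : Trivialization F (π F V),
      MemTrivializationAtlas e ∧ q₀ ∈ φ.source ∧ φ.source ⊆ e.baseSet ∧
      ∃ (m m' : ℕ) (b : Module.Basis (Fin m) ℝ EN) (b' : Module.Basis (Fin m') ℝ F)
        (w : Fin m → ℕ) (w' : Fin m' → ℕ), (∀ i, w i ≤ k - 1) ∧ (∀ j, w' j ≤ k - 1) ∧
        ∀ (t : ℝ), ∀ q ∈ φ.source, h t q ∈ φ.source ∧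
          (∀ i, b.repr (φ (h t q)) i = t ^ w i * b.repr (φ q) i) ∧
          ∀ (v : V q) (j : Fin m'),
            b'.repr (e ⟨h t q, hV t q v⟩).2 j = t ^ w' j * b'.repr (e ⟨q, v⟩).2 j

/-- A weighted algebroid structure on a graded-linear bundle `V` of degree `k`: a morphism
`ε : T*V → T V*` of triple graded bundles covering the identity of `V*`. -/
structure WeightedAlgebroid (k : ℕ) (h : ℝ → N → N) (hV : ∀ t q, V q →L[ℝ] V (h t q)) where
  ε : CotangentTotal EN F V → TangentDualTotal EN F V
  contMDiff : ContMDiff ((𝓘(ℝ, EN).prod 𝓘(ℝ, F)).prod 𝓘(ℝ, EN × F →L[ℝ] ℝ))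
    ((𝓘(ℝ, EN).prod 𝓘(ℝ, F →L[ℝ] ℝ)).tangent) ∞ ε
  /-- `ε` covers the identity of `V*`. -/
  covers_id : ∀ (q : N) (e : V q)
    (α : TangentSpace (𝓘(ℝ, EN).prod 𝓘(ℝ, F)) (⟨q, e⟩ : TotalSpace F V) →L[ℝ] ℝ)
    (ξ : V q →L[ℝ] ℝ), Covers e α ξ → (ε ⟨⟨q, e⟩, α⟩).proj = ⟨q, ξ⟩
  /-- The first weights: on `T*V` the `(k-1)`-phase lift of the first weight of `V`,
  on `T V*` the tangent lift of the first weight of `V*`. -/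
  map_weight₁ : ∀ t : ℝ, t ≠ 0 → ∀ α, ε (phaseLift EN (t ^ (k - 1)) (scale F hV t) α) =
    tangentMap (𝓘(ℝ, EN).prod 𝓘(ℝ, F →L[ℝ] ℝ)) (𝓘(ℝ, EN).prod 𝓘(ℝ, F →L[ℝ] ℝ))
      (dualScale F hV k t) (ε α)
  /-- The second weights: the linear structures of `T*V → V*` and of `T V* → V*`. -/
  map_weight₂ : ∀ s : ℝ, s ≠ 0 → ∀ α,
    ε (phaseLift EN s (fibreScale F V s) α) = ⟨(ε α).proj, s • (ε α).2⟩
  /-- The third weights: the linear structures of `T*V → V` and of `T V* → T N`. -/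
  map_weight₃ : ∀ s : ℝ, s ≠ 0 → ∀ α : CotangentTotal EN F V, ε ⟨α.proj, s • α.2⟩ =
    tangentMap (𝓘(ℝ, EN).prod 𝓘(ℝ, F →L[ℝ] ℝ)) (𝓘(ℝ, EN).prod 𝓘(ℝ, F →L[ℝ] ℝ))
      (fibreScale (F →L[ℝ] ℝ) (fun q : N ↦ V q →L[ℝ] ℝ) s) (ε α)

/-- The linear function on `V*` defined by a section of `V`. -/
def linearFunction (X : ContMDiffSection 𝓘(ℝ, EN) F ∞ V) (ξ : DualTotal F V) : ℝ := ξ.2 (X ξ.proj)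

/-- `β = R α` for the canonical anti-symplectic isomorphism `R : T*V → T*V*`
(in coordinates `(x, y, p, ξ) ↦ (x, ξ, -p, y)`), where `α` is a covector at the value `X q` of a
section `X` of `V` lying over `ξ ∈ V*_q` and `β` is a covector at `ξ`. -/
def IsDualCovector (X : ContMDiffSection 𝓘(ℝ, EN) F ∞ V) {q : N} (ξ : V q →L[ℝ] ℝ)
    (α : TangentSpace (𝓘(ℝ, EN).prod 𝓘(ℝ, F)) (⟨q, X q⟩ : TotalSpace F V) →L[ℝ] ℝ)
    (β : TangentSpace (𝓘(ℝ, EN).prod 𝓘(ℝ, F →L[ℝ] ℝ)) (⟨q, ξ⟩ : DualTotal F V) →L[ℝ] ℝ) : Prop :=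
  Covers (X q) α ξ ∧
  ∀ v : TangentSpace (𝓘(ℝ, EN).prod 𝓘(ℝ, F →L[ℝ] ℝ)) (⟨q, ξ⟩ : DualTotal F V),
    β v + α (mfderiv 𝓘(ℝ, EN) (𝓘(ℝ, EN).prod 𝓘(ℝ, F)) (fun x ↦ (⟨x, X x⟩ : TotalSpace F V)) q
        (mfderiv (𝓘(ℝ, EN).prod 𝓘(ℝ, F →L[ℝ] ℝ)) 𝓘(ℝ, EN)
          (fun η : DualTotal F V ↦ η.proj) ⟨q, ξ⟩ v)) =
      mfderiv (𝓘(ℝ, EN).prod 𝓘(ℝ, F →L[ℝ] ℝ)) 𝓘(ℝ, ℝ) (linearFunction X) ⟨q, ξ⟩ v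

namespace WeightedAlgebroid

variable {k : ℕ} {h : ℝ → N → N} {hV : ∀ t q, V q →L[ℝ] V (h t q)}
  (𝓔 : WeightedAlgebroid (EN := EN) (F := F) k h hV)

/-- The associated contravariant tensor `Λ(R α, R α') = ⟨R α', ε α⟩` on `V*` is a bivector
field. -/
def IsSkew : Prop :=
  ∀ (X X' : ContMDiffSection 𝓘(ℝ, EN) F ∞ V) (q : N) (ξ : V q →L[ℝ] ℝ)
    (α : TangentSpace (𝓘(ℝ, EN).prod 𝓘(ℝ, F)) (⟨q, X q⟩ : TotalSpace F V) →L[ℝ] ℝ)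
    (α' : TangentSpace (𝓘(ℝ, EN).prod 𝓘(ℝ, F)) (⟨q, X' q⟩ : TotalSpace F V) →L[ℝ] ℝ)
    (β β' : TangentSpace (𝓘(ℝ, EN).prod 𝓘(ℝ, F →L[ℝ] ℝ)) (⟨q, ξ⟩ : DualTotal F V) →L[ℝ] ℝ)
    (u u' : TangentSpace (𝓘(ℝ, EN).prod 𝓘(ℝ, F →L[ℝ] ℝ)) (⟨q, ξ⟩ : DualTotal F V)),
    IsDualCovector X ξ α β → IsDualCovector X' ξ α' β' →
    𝓔.ε ⟨⟨q, X q⟩, α⟩ = ⟨⟨q, ξ⟩, u⟩ → 𝓔.ε ⟨⟨q, X' q⟩, α'⟩ = ⟨⟨q, ξ⟩, u'⟩ →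
    β' u + β u' = 0

/-- `ρ` is the anchor of the algebroid: the map `V → T N` underlying `ε`. -/
def HasAnchor (ρ : ∀ q, V q →L[ℝ] TangentSpace 𝓘(ℝ, EN) q) : Prop :=
  ∀ α : CotangentTotal EN F V,
    tangentMap (𝓘(ℝ, EN).prod 𝓘(ℝ, F →L[ℝ] ℝ)) 𝓘(ℝ, EN) (fun η : DualTotal F V ↦ η.proj) (𝓔.ε α) =
      ⟨α.proj.proj, ρ α.proj.proj α.proj.2⟩

/-- `Z = [X, Y]` for the bracket of sections of `V` defined by the algebroid. The bracket is
characterised by `ι_{[X, Y]} = {ι_X, ι_Y}`, the right-hand side being the bracket of linear functions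
defined by the tensor `Λ`; here `dι_X = R α` at `ξ` for the covector `α` at `X q`
over `ξ` which annihilates the vectors tangent to the image of `X`. -/
def IsBracket (X Y Z : ContMDiffSection 𝓘(ℝ, EN) F ∞ V) : Prop :=
  ∀ (q : N) (ξ : V q →L[ℝ] ℝ)
    (α : TangentSpace (𝓘(ℝ, EN).prod 𝓘(ℝ, F)) (⟨q, X q⟩ : TotalSpace F V) →L[ℝ] ℝ)
    (β : TangentSpace (𝓘(ℝ, EN).prod 𝓘(ℝ, F →L[ℝ] ℝ)) (⟨q, ξ⟩ : DualTotal F V) →L[ℝ] ℝ),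
    IsDualCovector X ξ α β →
    β = mfderiv (𝓘(ℝ, EN).prod 𝓘(ℝ, F →L[ℝ] ℝ)) 𝓘(ℝ, ℝ) (linearFunction X) ⟨q, ξ⟩ →
    mfderiv (𝓘(ℝ, EN).prod 𝓘(ℝ, F →L[ℝ] ℝ)) 𝓘(ℝ, ℝ) (linearFunction Y) (𝓔.ε ⟨⟨q, X q⟩, α⟩).proj
      (𝓔.ε ⟨⟨q, X q⟩, α⟩).2 = ξ (Z q)

end WeightedAlgebroid

end GLBundle

end

/-!
A skew algebroid structure on a vector bundle `V → N` is a smooth anchor together with a bracket of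
sections which, in the trivialization around `q₀`, reads
`[S, S'] = dS' (ρ S) - dS (ρ S') + C (S, S')`, with skew-symmetric structure functions `C`.
It defines `ε : T*V → T V*`, in coordinates
`(x, y, p, φ) ↦ (x, φ, ρ y, y' ↦ p (ρ y') + φ (C (y, y')))`.
That these local formulas agree in all coordinates is not verified by means of the transformation
laws of `ρ` and `C`. Instead, `ε α` is characterized without coordinates: it lies over the anchor,
and its action on the linear function of a section `S'` is given by the bracket `[S, S']`, for `S`
a section through the point under `α` (`SkewStructure.mfderiv_linearFunction_of_coord`). So it is
enough to have, through any two vectors of a fibre, sections with a bracket given by the above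
formula in all coordinates at once; this is the last field of `SkewStructure`. The bracket formula,
the skew symmetry of the tensor of `ε`, and the weights can be read off in coordinates. For the
first weight one needs that the homogeneity structure is linear in suitable coordinates and
preserves `ρ` and `C` (`SkewStructure.IsChartAutomorphism`).

For the prolongation `D(A^k)` such sections are the projectable ones. Given `(X ∘ τ, V)` and
`(X' ∘ τ, V')`, the vector fields `V`, `V'` project to `ρ X`, `ρ X'`, so `[V, V']` projects to
`[ρ X, ρ X'] = ρ [X, X']`, and the pair `([X, X'] ∘ τ, [V, V'])` is again a section of the
prolongation (`bracket_mem_prolongationFibre`). Its coordinates are those of `[X, X']` and the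
components of `[V, V']` along the fibres of `τ`. The Leibniz rule gives `[X, X']` the form above
with structure functions `C` of `A` (`localRep_bracket`), and in the chart the Lie bracket is
`dV' (V) - dV (V')` (`baseCoord_mlieBracket`); together they give the form above for the
prolongation, with the structure functions `((r, v), (s, w)) ↦ (C (r, s), 0)`
(`localRep_projectableBracket`). Projectable sections pass through every vector of the prolongation
(`exists_projectable_section`).

In the adapted coordinates the homogeneity structure multiplies `y_w` by `t ^ w`, on the base as
well as in the fibres of the prolongation. The structure functions and the anchor involve only `x`
and the component in `A`, both of weight `0`, so they are preserved.
-/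

noncomputable section

namespace GLBundle

open HigherAlgebroid

variable {EN F N : Type*}
  [NormedAddCommGroup EN] [NormedSpace ℝ EN] [NormedAddCommGroup F] [NormedSpace ℝ F]
  [TopologicalSpace N] [ChartedSpace EN N] [IsManifold 𝓘(ℝ, EN) ∞ N]
  {V : N → Type*} [∀ q, AddCommGroup (V q)] [∀ q, Module ℝ (V q)] [∀ q, TopologicalSpace (V q)]
  [TopologicalSpace (TotalSpace F V)] [FiberBundle F V] [VectorBundle ℝ F V]
  [ContMDiffVectorBundle ∞ F V 𝓘(ℝ, EN)]

/-! ### Adapted coordinates on the total space of a vector bundle -/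

/-- The derivative of a pair of maps, the target being the model vector space `X × Y` instead of a
product of manifolds. -/
theorem hasMFDerivAt_prodMk_space {X Y B H P : Type*} [NormedAddCommGroup X] [NormedSpace ℝ X]
    [NormedAddCommGroup Y] [NormedSpace ℝ Y] [NormedAddCommGroup B] [NormedSpace ℝ B]
    [TopologicalSpace H] {I : ModelWithCorners ℝ B H} [TopologicalSpace P] [ChartedSpace H P]
    {f : P → X} {g : P → Y} {q : P} {f' : TangentSpace I q →L[ℝ] X} {g' : TangentSpace I q →L[ℝ] Y}
    (hf : HasMFDerivAt I 𝓘(ℝ, X) f q f') (hg : HasMFDerivAt I 𝓘(ℝ, Y) g q g') :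
    HasMFDerivAt I 𝓘(ℝ, X × Y) (fun x ↦ (f x, g x)) q (f'.prod g') :=
  ⟨hf.1.prodMk hg.1, hf.2.prodMk hg.2⟩

variable (F V) in
/-- The coordinates of a vector of the fibre `V q` in the trivialization around `q₀`; they are `0` if
the trivialization is not defined at `q`. -/
abbrev fibreCoord (q₀ q : N) : V q →L[ℝ] F := (trivializationAt F V q₀).continuousLinearMapAt ℝ q

variable (F V) in
/-- The vector of the fibre `V q` with given coordinates in the trivialization around `q₀`. -/
abbrev fibreVec (q₀ q : N) : F →L[ℝ] V q := (trivializationAt F V q₀).symmL ℝ q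

variable (EN) in
/-- The coordinates of a tangent vector of `N` at `q` in the chart around `q₀`. -/
abbrev baseCoord (q₀ q : N) : TangentSpace 𝓘(ℝ, EN) q →L[ℝ] EN :=
  (trivializationAt EN (TangentSpace 𝓘(ℝ, EN)) q₀).continuousLinearMapAt ℝ q

variable (EN) in
/-- The tangent vector of `N` at `q` with given coordinates in the chart around `q₀`. -/
abbrev baseVec (q₀ q : N) : EN →L[ℝ] TangentSpace 𝓘(ℝ, EN) q :=
  (trivializationAt EN (TangentSpace 𝓘(ℝ, EN)) q₀).symmL ℝ q

variable (EN) in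
/-- The coordinates of a tangent vector of the total space of `V` in the adapted chart
around `q₀`: the components along the base and along the fibre. -/
abbrev totalCoord (q₀ : N) (η : TotalSpace F V) :
    TangentSpace (𝓘(ℝ, EN).prod 𝓘(ℝ, F)) η →L[ℝ] EN × F :=
  (trivializationAt (EN × F) (TangentSpace (𝓘(ℝ, EN).prod 𝓘(ℝ, F)))
    (⟨q₀, 0⟩ : TotalSpace F V)).continuousLinearMapAt ℝ η

variable (EN) in
/-- The tangent vector of the total space of `V` with given coordinates in the adapted chart
around `q₀`. -/
abbrev totalVec (q₀ : N) (η : TotalSpace F V) :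
    EN × F →L[ℝ] TangentSpace (𝓘(ℝ, EN).prod 𝓘(ℝ, F)) η :=
  (trivializationAt (EN × F) (TangentSpace (𝓘(ℝ, EN).prod 𝓘(ℝ, F)))
    (⟨q₀, 0⟩ : TotalSpace F V)).symmL ℝ η

theorem mem_chart_source_total {q₀ : N} {η : TotalSpace F V}
    (h : η.proj ∈ chartDomain EN F V q₀) :
    η ∈ (chartAt (ModelProd EN F) (⟨q₀, 0⟩ : TotalSpace F V)).source := by
  have := mem_adaptedChart_source.2 h
  rwa [adaptedChart, extChartAt_source] at this

theorem mem_totalBaseSet {q₀ : N} {η : TotalSpace F V} (h : η.proj ∈ chartDomain EN F V q₀) :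
    η ∈ (trivializationAt (EN × F) (TangentSpace (𝓘(ℝ, EN).prod 𝓘(ℝ, F)))
      (⟨q₀, 0⟩ : TotalSpace F V)).baseSet :=
  mem_chart_source_total h

/-- The coordinates of a tangent vector are its image under the differential of the chart. -/
theorem totalCoord_eq_mfderiv {q₀ : N} {η : TotalSpace F V}
    (h : η.proj ∈ chartDomain EN F V q₀) :
    totalCoord EN q₀ η =
      mfderiv (𝓘(ℝ, EN).prod 𝓘(ℝ, F)) 𝓘(ℝ, EN × F) (adaptedChart EN F V q₀) η :=
  TangentBundle.continuousLinearMapAt_trivializationAt (mem_chart_source_total h)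

theorem hasMFDerivAt_adaptedChart {q₀ : N} {η : TotalSpace F V}
    (h : η.proj ∈ chartDomain EN F V q₀) :
    HasMFDerivAt (𝓘(ℝ, EN).prod 𝓘(ℝ, F)) 𝓘(ℝ, EN × F) (adaptedChart EN F V q₀) η
      (totalCoord EN q₀ η) := by
  rw [totalCoord_eq_mfderiv h]
  exact (mdifferentiableAt_extChartAt (mem_chart_source_total h)).hasMFDerivAt

theorem hasMFDerivAt_extChartAt_base {q₀ q : N} (h : q ∈ (chartAt EN q₀).source) :
    HasMFDerivAt 𝓘(ℝ, EN) 𝓘(ℝ, EN) (extChartAt 𝓘(ℝ, EN) q₀) q (baseCoord EN q₀ q) := by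
  rw [baseCoord, TangentBundle.continuousLinearMapAt_trivializationAt h]
  exact (mdifferentiableAt_extChartAt h).hasMFDerivAt

theorem totalVec_totalCoord {q₀ : N} {η : TotalSpace F V} (h : η.proj ∈ chartDomain EN F V q₀)
    (w : TangentSpace (𝓘(ℝ, EN).prod 𝓘(ℝ, F)) η) :
    totalVec EN q₀ η (totalCoord EN q₀ η w) = w :=
  Trivialization.symmL_continuousLinearMapAt (trivializationAt (EN × F)
    (TangentSpace (𝓘(ℝ, EN).prod 𝓘(ℝ, F))) (⟨q₀, 0⟩ : TotalSpace F V)) (mem_totalBaseSet h) w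

theorem totalCoord_totalVec {q₀ : N} {η : TotalSpace F V} (h : η.proj ∈ chartDomain EN F V q₀)
    (z : EN × F) : totalCoord EN q₀ η (totalVec EN q₀ η z) = z :=
  Trivialization.continuousLinearMapAt_symmL (trivializationAt (EN × F)
    (TangentSpace (𝓘(ℝ, EN).prod 𝓘(ℝ, F))) (⟨q₀, 0⟩ : TotalSpace F V)) (mem_totalBaseSet h) z

theorem totalCoord_injective {q₀ : N} {η : TotalSpace F V} (h : η.proj ∈ chartDomain EN F V q₀) :
    Function.Injective (totalCoord EN q₀ η) :=
  Function.LeftInverse.injective (totalVec_totalCoord h)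

theorem fibreVec_fibreCoord {q₀ q : N} (h : q ∈ chartDomain EN F V q₀) (v : V q) :
    fibreVec F V q₀ q (fibreCoord F V q₀ q v) = v :=
  Trivialization.symmL_continuousLinearMapAt _ h.2 v

theorem fibreCoord_fibreVec {q₀ q : N} (h : q ∈ chartDomain EN F V q₀) (y : F) :
    fibreCoord F V q₀ q (fibreVec F V q₀ q y) = y :=
  Trivialization.continuousLinearMapAt_symmL _ h.2 y

theorem baseVec_baseCoord {q₀ q : N} (h : q ∈ (chartAt EN q₀).source)
    (v : TangentSpace 𝓘(ℝ, EN) q) : baseVec EN q₀ q (baseCoord EN q₀ q v) = v :=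
  Trivialization.symmL_continuousLinearMapAt _ h v

theorem baseCoord_baseVec {q₀ q : N} (h : q ∈ (chartAt EN q₀).source) (y : EN) :
    baseCoord EN q₀ q (baseVec EN q₀ q y) = y :=
  Trivialization.continuousLinearMapAt_symmL _ h y

theorem baseCoord_injective {q₀ q : N} (h : q ∈ (chartAt EN q₀).source) :
    Function.Injective (baseCoord EN q₀ q) :=
  Function.LeftInverse.injective (baseVec_baseCoord h)

theorem adaptedChart_mk {q₀ q : N} (h : q ∈ chartDomain EN F V q₀) (v : V q) :
    adaptedChart EN F V q₀ ⟨q, v⟩ = (extChartAt 𝓘(ℝ, EN) q₀ q, fibreCoord F V q₀ q v) := by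
  rw [adaptedChart_apply (show (⟨q, v⟩ : TotalSpace F V).proj ∈ _ from h)]
  refine Prod.ext rfl ?_
  exact (Trivialization.continuousLinearMapAt_apply_of_mem ℝ _ h.2 v).symm

theorem eventually_mem_chartDomain_proj {q₀ : N} {η : TotalSpace F V}
    (h : η.proj ∈ chartDomain EN F V q₀) : ∀ᶠ η' : TotalSpace F V in 𝓝 η,
      η'.proj ∈ chartDomain EN F V q₀ :=
  (FiberBundle.continuous_proj F V).continuousAt.eventually ((isOpen_chartDomain q₀).mem_nhds h)

theorem eventually_mem_chartDomain {q₀ q : N} (h : q ∈ chartDomain EN F V q₀) :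
    ∀ᶠ q' in 𝓝 q, q' ∈ chartDomain EN F V q₀ := (isOpen_chartDomain q₀).mem_nhds h

theorem eq_of_adaptedChart_eq {q₀ : N} {η η' : TotalSpace F V}
    (h : η.proj ∈ chartDomain EN F V q₀) (h' : η'.proj ∈ chartDomain EN F V q₀)
    (e : adaptedChart EN F V q₀ η = adaptedChart EN F V q₀ η') : η = η' :=
  (adaptedChart EN F V q₀).injOn (mem_adaptedChart_source.2 h) (mem_adaptedChart_source.2 h') e

/-- The projection `T V → T N` is the projection to the component along the base. -/
theorem baseCoord_mfderiv_proj {q₀ : N} {η : TotalSpace F V}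
    (h : η.proj ∈ chartDomain EN F V q₀) (w : TangentSpace (𝓘(ℝ, EN).prod 𝓘(ℝ, F)) η) :
    baseCoord EN q₀ η.proj (mfderiv (𝓘(ℝ, EN).prod 𝓘(ℝ, F)) 𝓘(ℝ, EN)
      (fun η : TotalSpace F V ↦ η.proj) η w) = (totalCoord EN q₀ η w).1 := by
  have h1 := (hasMFDerivAt_extChartAt_base h.1).comp η
    ((contMDiff_proj V (IB := 𝓘(ℝ, EN)) (n := ∞)).mdifferentiableAt (by simp) (x := η)).hasMFDerivAt
  have h2 := ((ContinuousLinearMap.fst ℝ EN F).hasMFDerivAt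
    (x := adaptedChart EN F V q₀ η)).comp η (hasMFDerivAt_adaptedChart h)
  have h3 := h2.congr_of_eventuallyEq (f₁ := fun η' : TotalSpace F V ↦
      extChartAt 𝓘(ℝ, EN) q₀ η'.proj) (by
    filter_upwards [eventually_mem_chartDomain_proj h] with η' h'
    rw [Function.comp_apply, adaptedChart_apply h']
    rfl)
  exact congrArg (fun L ↦ L w) (hasMFDerivAt_unique h1 h3)

variable (F) in
/-- The section `S` of `V` in the trivialization around `q₀`. -/
def localRep (q₀ : N) (S : ∀ q, V q) (q : N) : F := fibreCoord F V q₀ q (S q)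

variable (EN F) in
/-- The derivative at `q` of the section `S` in the trivialization around `q₀`. -/
def localDeriv (q₀ : N) (S : ∀ q, V q) (q : N) : TangentSpace 𝓘(ℝ, EN) q →L[ℝ] F :=
  mfderiv 𝓘(ℝ, EN) 𝓘(ℝ, F) (localRep F q₀ S) q

theorem localRep_eq {q₀ q : N} (S : ∀ q, V q) (h : q ∈ (trivializationAt F V q₀).baseSet) :
    localRep F q₀ S q = (trivializationAt F V q₀ ⟨q, S q⟩).2 :=
  Trivialization.continuousLinearMapAt_apply_of_mem ℝ _ h (S q)

theorem contMDiffOn_localRep (q₀ : N) (S : ContMDiffSection 𝓘(ℝ, EN) F ∞ V) :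
    ContMDiffOn 𝓘(ℝ, EN) 𝓘(ℝ, F) ∞ (localRep F q₀ S) (trivializationAt F V q₀).baseSet := by
  have h := (trivializationAt F V q₀).contMDiffOn_section_baseSet_iff
    (IB := 𝓘(ℝ, EN)) (n := ∞) (s := S)
  refine (h.1 S.contMDiff.contMDiffOn).congr fun q hq ↦ localRep_eq _ hq

theorem hasMFDerivAt_localRep {q₀ q : N} (S : ContMDiffSection 𝓘(ℝ, EN) F ∞ V)
    (h : q ∈ chartDomain EN F V q₀) :
    HasMFDerivAt 𝓘(ℝ, EN) 𝓘(ℝ, F) (localRep F q₀ S) q (localDeriv EN F q₀ S q) :=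
  (((contMDiffOn_localRep q₀ S).contMDiffAt
    ((trivializationAt F V q₀).open_baseSet.mem_nhds h.2)).mdifferentiableAt (by simp)).hasMFDerivAt

/-- The tangent map of a section in coordinates. -/
theorem totalCoord_mfderiv_section {q₀ q : N} (S : ContMDiffSection 𝓘(ℝ, EN) F ∞ V)
    (h : q ∈ chartDomain EN F V q₀) (u : TangentSpace 𝓘(ℝ, EN) q) :
    totalCoord EN q₀ (⟨q, S q⟩ : TotalSpace F V) (mfderiv 𝓘(ℝ, EN) (𝓘(ℝ, EN).prod 𝓘(ℝ, F))
      (fun x ↦ (⟨x, S x⟩ : TotalSpace F V)) q u) =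
      (baseCoord EN q₀ q u, localDeriv EN F q₀ S q u) := by
  have h0 : MDifferentiableAt 𝓘(ℝ, EN) (𝓘(ℝ, EN).prod 𝓘(ℝ, F))
      (fun x ↦ (⟨x, S x⟩ : TotalSpace F V)) q := S.contMDiff.mdifferentiableAt (by simp)
  have h1 := (hasMFDerivAt_adaptedChart (η := (⟨q, S q⟩ : TotalSpace F V)) h).comp q
    h0.hasMFDerivAt
  have h2 := hasMFDerivAt_prodMk_space (hasMFDerivAt_extChartAt_base h.1) (hasMFDerivAt_localRep S h)
  have h3 := h2.congr_of_eventuallyEq (f₁ := adaptedChart EN F V q₀ ∘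
      fun x ↦ (⟨x, S x⟩ : TotalSpace F V)) (by
    filter_upwards [eventually_mem_chartDomain h] with x hx
    exact adaptedChart_mk hx (S x))
  exact congrArg (fun L ↦ L u) (hasMFDerivAt_unique h1 h3)

/-- The vertical vectors are those with vanishing component along the base. -/
theorem totalCoord_verticalLift {q₀ q : N} (h : q ∈ chartDomain EN F V q₀) (e v : V q) :
    totalCoord EN q₀ (⟨q, e⟩ : TotalSpace F V) (verticalLift EN F e v) =
      (0, fibreCoord F V q₀ q v) := by
  have h2 : HasMFDerivAt 𝓘(ℝ, ℝ) 𝓘(ℝ, EN × F)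
      (fun s : ℝ ↦ (extChartAt 𝓘(ℝ, EN) q₀ q, fibreCoord F V q₀ q e + s • fibreCoord F V q₀ q v)) 0
      (ContinuousLinearMap.toSpanSingleton ℝ ((0 : EN), fibreCoord F V q₀ q v)) := by
    have h0 : HasDerivAt
        (fun s : ℝ ↦ (extChartAt 𝓘(ℝ, EN) q₀ q, fibreCoord F V q₀ q e + s • fibreCoord F V q₀ q v))
        ((0 : EN), fibreCoord F V q₀ q v) 0 := by
      simpa using (hasDerivAt_const (0 : ℝ) (extChartAt 𝓘(ℝ, EN) q₀ q)).prodMk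
        (((hasDerivAt_id (0 : ℝ)).smul_const (fibreCoord F V q₀ q v)).const_add
          (fibreCoord F V q₀ q e))
    exact h0.hasFDerivAt.hasMFDerivAt
  have e1 : ∀ s : ℝ, adaptedChart EN F V q₀ (⟨q, e + s • v⟩ : TotalSpace F V) =
      (extChartAt 𝓘(ℝ, EN) q₀ q, fibreCoord F V q₀ q e + s • fibreCoord F V q₀ q v) := by
    intro s
    rw [adaptedChart_mk h, map_add, map_smul]
  have h0 : MDifferentiableAt 𝓘(ℝ, ℝ) (𝓘(ℝ, EN).prod 𝓘(ℝ, F))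
      (fun s : ℝ ↦ (⟨q, e + s • v⟩ : TotalSpace F V)) 0 := by
    have e2 : (fun s : ℝ ↦ (⟨q, e + s • v⟩ : TotalSpace F V)) = (adaptedChart EN F V q₀).symm ∘
        fun s : ℝ ↦ (extChartAt 𝓘(ℝ, EN) q₀ q,
          fibreCoord F V q₀ q e + s • fibreCoord F V q₀ q v) := by
      funext s
      rw [Function.comp_apply, ← e1, (adaptedChart EN F V q₀).left_inv
        (mem_adaptedChart_source.2 h)]
    rw [e2]
    refine MDifferentiableAt.comp (I' := 𝓘(ℝ, EN × F)) 0 ?_ h2.mdifferentiableAt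
    refine ((contMDiffOn_adaptedChart_symm q₀).contMDiffAt
      ((isOpen_adaptedChart_target q₀).mem_nhds ?_)).mdifferentiableAt (by simp)
    rw [← e1]
    exact (adaptedChart EN F V q₀).map_source (mem_adaptedChart_source.2 h)
  have h4 : (⟨q, e + (0 : ℝ) • v⟩ : TotalSpace F V) = ⟨q, e⟩ := by simp
  have h1 := (hasMFDerivAt_adaptedChart (η := (⟨q, e + (0 : ℝ) • v⟩ : TotalSpace F V)) h).comp 0
    h0.hasMFDerivAt
  have h3 := h2.congr_of_eventuallyEq (f₁ := adaptedChart EN F V q₀ ∘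
      fun s : ℝ ↦ (⟨q, e + s • v⟩ : TotalSpace F V)) (Eventually.of_forall e1)
  have h5 := congrArg (fun L ↦ L (1 : ℝ)) (hasMFDerivAt_unique h1 h3)
  have h6 : totalCoord EN q₀ (⟨q, e + (0 : ℝ) • v⟩ : TotalSpace F V) (verticalLift EN F e v) =
      (0, fibreCoord F V q₀ q v) := by
    refine h5.trans ?_
    change (1 : ℝ) • ((0 : EN), fibreCoord F V q₀ q v) = _
    rw [one_smul]
  rw [h4] at h6
  exact h6

/-! ### Coordinates on the dual bundle and on the cotangent bundle -/

/-- The dual bundle is trivialized over the same sets as `V`. -/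
theorem chartDomain_dual (q₀ : N) :
    chartDomain EN (F →L[ℝ] ℝ) (fun q : N ↦ V q →L[ℝ] ℝ) q₀ = chartDomain EN F V q₀ := by
  simp only [chartDomain]
  congr 1
  exact inter_univ _

theorem mem_chartDomain_dual {q₀ q : N} (h : q ∈ chartDomain EN F V q₀) :
    q ∈ chartDomain EN (F →L[ℝ] ℝ) (fun q : N ↦ V q →L[ℝ] ℝ) q₀ := by
  rwa [chartDomain_dual]

theorem fibreCoord_dual {q₀ q : N} (h : q ∈ chartDomain EN F V q₀) (ξ : V q →L[ℝ] ℝ) :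
    fibreCoord (F →L[ℝ] ℝ) (fun q : N ↦ V q →L[ℝ] ℝ) q₀ q ξ = ξ.comp (fibreVec F V q₀ q) := by
  rw [fibreCoord, Trivialization.continuousLinearMapAt_apply_of_mem ℝ _
    (mem_chartDomain_dual h).2, hom_trivializationAt_apply]
  ext y
  change (trivializationAt ℝ (Bundle.Trivial N ℝ) q₀).continuousLinearMapAt ℝ q
    (ξ (fibreVec F V q₀ q y)) = _
  simp

/-- The differential of the linear function defined by a section, in coordinates. -/
theorem mfderiv_linearFunction {q₀ q : N} (S : ContMDiffSection 𝓘(ℝ, EN) F ∞ V)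
    (h : q ∈ chartDomain EN F V q₀) (ξ : V q →L[ℝ] ℝ)
    (w : TangentSpace (𝓘(ℝ, EN).prod 𝓘(ℝ, F →L[ℝ] ℝ)) (⟨q, ξ⟩ : DualTotal F V)) :
    mfderiv (𝓘(ℝ, EN).prod 𝓘(ℝ, F →L[ℝ] ℝ)) 𝓘(ℝ, ℝ) (linearFunction S) ⟨q, ξ⟩ w =
      (totalCoord EN q₀ (⟨q, ξ⟩ : DualTotal F V) w).2 (localRep F q₀ S q) +
      ξ (fibreVec F V q₀ q (localDeriv EN F q₀ S q
        (mfderiv (𝓘(ℝ, EN).prod 𝓘(ℝ, F →L[ℝ] ℝ)) 𝓘(ℝ, EN)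
          (fun η : DualTotal F V ↦ η.proj) ⟨q, ξ⟩ w))) := by
  have hd := mem_chartDomain_dual h
  have h1 := ((ContinuousLinearMap.snd ℝ EN (F →L[ℝ] ℝ)).hasMFDerivAt
    (x := adaptedChart EN (F →L[ℝ] ℝ) (fun q : N ↦ V q →L[ℝ] ℝ) q₀ ⟨q, ξ⟩)).comp _
      (hasMFDerivAt_adaptedChart (η := (⟨q, ξ⟩ : DualTotal F V)) hd)
  have h2 := (hasMFDerivAt_localRep S h).comp (⟨q, ξ⟩ : DualTotal F V)
    ((contMDiff_proj (fun q : N ↦ V q →L[ℝ] ℝ) (IB := 𝓘(ℝ, EN))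
      (n := ∞)).mdifferentiableAt (by simp) (x := (⟨q, ξ⟩ : DualTotal F V))).hasMFDerivAt
  have h3 := ((isBoundedBilinearMap_apply (𝕜 := ℝ) (E := F) (F := ℝ)).hasFDerivAt
    ((adaptedChart EN (F →L[ℝ] ℝ) (fun q : N ↦ V q →L[ℝ] ℝ) q₀ ⟨q, ξ⟩).2,
      localRep F q₀ S q)).hasMFDerivAt.comp (⟨q, ξ⟩ : DualTotal F V) (hasMFDerivAt_prodMk_space h1 h2)
  have h4 := h3.congr_of_eventuallyEq (f₁ := linearFunction S) (by
    filter_upwards [eventually_mem_chartDomain_proj hd] with η hη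
    have hη' : η.proj ∈ chartDomain EN F V q₀ := by rwa [chartDomain_dual] at hη
    simp only [Function.comp_apply, ContinuousLinearMap.coe_snd']
    have := adaptedChart_mk hη η.2
    rw [show adaptedChart EN (F →L[ℝ] ℝ) (fun q : N ↦ V q →L[ℝ] ℝ) q₀ η = _ from this,
      fibreCoord_dual hη', ContinuousLinearMap.comp_apply, localRep, fibreVec_fibreCoord hη']
    rfl)
  rw [h4.mfderiv]
  refine (add_comm _ _).trans (congrArg₂ (· + ·) rfl ?_)
  change (adaptedChart EN (F →L[ℝ] ℝ) (fun q : N ↦ V q →L[ℝ] ℝ) q₀ ⟨q, ξ⟩).2 _ = _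
  rw [adaptedChart_mk hd, fibreCoord_dual h]
  rfl

variable (EN) in
/-- The components of a covector on the total space of `V` in the adapted chart around `q₀`. -/
def cotCoord (q₀ : N) (α : CotangentTotal EN F V) : EN × F →L[ℝ] ℝ :=
  α.2.comp (totalVec EN q₀ α.proj)

theorem cotCoord_apply_totalCoord {q₀ : N} {α : CotangentTotal EN F V}
    (h : α.proj.proj ∈ chartDomain EN F V q₀)
    (w : TangentSpace (𝓘(ℝ, EN).prod 𝓘(ℝ, F)) α.proj) :
    cotCoord EN q₀ α (totalCoord EN q₀ α.proj w) = α.2 w :=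
  congrArg α.2 (totalVec_totalCoord h w)

/-- The covector lies over `ξ ∈ V*` iff its components along the fibre are those of `ξ`. -/
theorem covers_iff {q₀ q : N} (h : q ∈ chartDomain EN F V q₀) {e : V q}
    {α : TangentSpace (𝓘(ℝ, EN).prod 𝓘(ℝ, F)) (⟨q, e⟩ : TotalSpace F V) →L[ℝ] ℝ}
    {ξ : V q →L[ℝ] ℝ} : Covers e α ξ ↔
      (cotCoord EN q₀ ⟨⟨q, e⟩, α⟩).comp (ContinuousLinearMap.inr ℝ EN F) =
        ξ.comp (fibreVec F V q₀ q) := by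
  have key : ∀ v : V q, α (verticalLift EN F e v) =
      cotCoord EN q₀ ⟨⟨q, e⟩, α⟩ (0, fibreCoord F V q₀ q v) := fun v ↦ by
    rw [← totalCoord_verticalLift h e v]
    exact (cotCoord_apply_totalCoord (α := ⟨⟨q, e⟩, α⟩) h _).symm
  constructor
  · intro hc
    ext y
    have := (key (fibreVec F V q₀ q y)).symm.trans (hc _)
    rw [fibreCoord_fibreVec h] at this
    exact this
  · intro hc v
    rw [key]
    have := congrArg (fun L ↦ L (fibreCoord F V q₀ q v)) hc
    refine this.trans ?_
    change ξ (fibreVec F V q₀ q (fibreCoord F V q₀ q v)) = _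
    rw [fibreVec_fibreCoord h]

/-! ### Maps which are linear in adapted coordinates -/

/-- A map which is linear in adapted coordinates has that linear map as its derivative. -/
theorem hasMFDerivAt_of_linear {q₀ : N} {g : TotalSpace F V → TotalSpace F V}
    {L : EN × F →L[ℝ] EN × F}
    (hg : ∀ η : TotalSpace F V, η.proj ∈ chartDomain EN F V q₀ →
      (g η).proj ∈ chartDomain EN F V q₀ ∧
        adaptedChart EN F V q₀ (g η) = L (adaptedChart EN F V q₀ η))
    {η : TotalSpace F V} (h : η.proj ∈ chartDomain EN F V q₀) :
    HasMFDerivAt (𝓘(ℝ, EN).prod 𝓘(ℝ, F)) (𝓘(ℝ, EN).prod 𝓘(ℝ, F)) g η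
      ((totalVec EN q₀ (g η)).comp (L.comp (totalCoord EN q₀ η))) := by
  have h2 := (L.hasMFDerivAt (x := adaptedChart EN F V q₀ η)).comp η (hasMFDerivAt_adaptedChart h)
  have e : adaptedChart EN F V q₀ ∘ g =ᶠ[𝓝 η] L ∘ adaptedChart EN F V q₀ := by
    filter_upwards [eventually_mem_chartDomain_proj h] with η' h' using (hg η' h').2
  have hd : MDifferentiableAt (𝓘(ℝ, EN).prod 𝓘(ℝ, F)) (𝓘(ℝ, EN).prod 𝓘(ℝ, F)) g η := by
    have h3 : MDifferentiableAt 𝓘(ℝ, EN × F) (𝓘(ℝ, EN).prod 𝓘(ℝ, F)) (adaptedChart EN F V q₀).symm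
        ((L ∘ adaptedChart EN F V q₀) η) := by
      refine ((contMDiffOn_adaptedChart_symm q₀).contMDiffAt
        ((isOpen_adaptedChart_target q₀).mem_nhds ?_)).mdifferentiableAt (by simp)
      rw [← e.self_of_nhds]
      exact (adaptedChart EN F V q₀).map_source (mem_adaptedChart_source.2 (hg η h).1)
    refine (h3.comp η h2.mdifferentiableAt).congr_of_eventuallyEq ?_
    filter_upwards [eventually_mem_chartDomain_proj h] with η' h'
    simp only [Function.comp_apply]
    rw [← (hg η' h').2, (adaptedChart EN F V q₀).left_inv (mem_adaptedChart_source.2 (hg η' h').1)]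
  have h4 := (hasMFDerivAt_adaptedChart (hg η h).1).comp η hd.hasMFDerivAt
  have h5 := hasMFDerivAt_unique h4 (h2.congr_of_eventuallyEq e)
  have h6 : mfderiv (𝓘(ℝ, EN).prod 𝓘(ℝ, F)) (𝓘(ℝ, EN).prod 𝓘(ℝ, F)) g η =
      (totalVec EN q₀ (g η)).comp (L.comp (totalCoord EN q₀ η)) := by
    ext w
    have := congrArg (fun L ↦ totalVec EN q₀ (g η) (L w)) h5
    exact (totalVec_totalCoord (hg η h).1 _).symm.trans this
  rw [← h6]
  exact hd.hasMFDerivAt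

/-- The tangent map of a map which is linear in adapted coordinates. -/
theorem totalCoord_tangentMap {q₀ : N} {g : TotalSpace F V → TotalSpace F V}
    {L : EN × F →L[ℝ] EN × F}
    (hg : ∀ η : TotalSpace F V, η.proj ∈ chartDomain EN F V q₀ →
      (g η).proj ∈ chartDomain EN F V q₀ ∧
        adaptedChart EN F V q₀ (g η) = L (adaptedChart EN F V q₀ η))
    (w : TangentBundle (𝓘(ℝ, EN).prod 𝓘(ℝ, F)) (TotalSpace F V))
    (h : w.proj.proj ∈ chartDomain EN F V q₀) :
    totalCoord EN q₀ (g w.proj)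
      (tangentMap (𝓘(ℝ, EN).prod 𝓘(ℝ, F)) (𝓘(ℝ, EN).prod 𝓘(ℝ, F)) g w).2 =
        L (totalCoord EN q₀ w.proj w.2) := by
  simp only [tangentMap]
  rw [(hasMFDerivAt_of_linear hg h).mfderiv]
  exact totalCoord_totalVec (hg _ h).1 _

/-- The phase lift of a map which is linear in adapted coordinates. -/
theorem cotCoord_phaseLift {q₀ : N} {g : TotalSpace F V → TotalSpace F V}
    {L : (EN × F) ≃L[ℝ] EN × F}
    (hg : ∀ η : TotalSpace F V, η.proj ∈ chartDomain EN F V q₀ →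
      (g η).proj ∈ chartDomain EN F V q₀ ∧
        adaptedChart EN F V q₀ (g η) = L (adaptedChart EN F V q₀ η))
    (c : ℝ) (α : CotangentTotal EN F V) (h : α.proj.proj ∈ chartDomain EN F V q₀) :
    cotCoord EN q₀ (phaseLift EN c g α) =
      c • (cotCoord EN q₀ α).comp (L.symm : EN × F →L[ℝ] EN × F) := by
  have h1 := (hasMFDerivAt_of_linear (L := (L : EN × F →L[ℝ] EN × F)) hg h).mfderiv
  have h2 : ((totalVec EN q₀ (g α.proj)).comp ((L : EN × F →L[ℝ] EN × F).comp
      (totalCoord EN q₀ α.proj))).inverse = (totalVec EN q₀ α.proj).comp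
        ((L.symm : EN × F →L[ℝ] EN × F).comp (totalCoord EN q₀ (g α.proj))) := by
    refine ContinuousLinearMap.inverse_eq ?_ ?_
    · ext1 w
      simp only [ContinuousLinearMap.comp_apply, ContinuousLinearEquiv.coe_coe]
      rw [totalCoord_totalVec h, L.apply_symm_apply, totalVec_totalCoord (hg _ h).1]
      rfl
    · ext1 w
      simp only [ContinuousLinearMap.comp_apply, ContinuousLinearEquiv.coe_coe]
      rw [totalCoord_totalVec (hg _ h).1, L.symm_apply_apply, totalVec_totalCoord h]
      rfl
  refine ContinuousLinearMap.ext fun z ↦ ?_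
  change (c • α.2.comp (mfderiv (𝓘(ℝ, EN).prod 𝓘(ℝ, F)) (𝓘(ℝ, EN).prod 𝓘(ℝ, F)) g
    α.proj).inverse) (totalVec EN q₀ (g α.proj) z) = c • α.2 (totalVec EN q₀ α.proj (L.symm z))
  rw [h1, h2]
  simp only [smul_apply, ContinuousLinearMap.comp_apply]
  rw [totalCoord_totalVec (hg _ h).1]
  rfl

/-! ### The morphism `T*V → T V*` of a skew algebroid -/

variable (EN) in
/-- The bundle map `ρ : V → T N` in the trivializations around `q₀`. -/
def anchorRep (ρ : ∀ q, V q →L[ℝ] TangentSpace 𝓘(ℝ, EN) q) (q₀ q : N) : F →L[ℝ] EN :=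
  (baseCoord EN q₀ q).comp ((ρ q).comp (fibreVec F V q₀ q))

/-- The bracket of two sections in the trivialization around `q₀`, for the anchor `ρ` and the
structure functions `C`. -/
def bracketRep (ρ : ∀ q, V q →L[ℝ] TangentSpace 𝓘(ℝ, EN) q) (C : N → N → F →L[ℝ] F →L[ℝ] F)
    (q₀ : N) (S S' : ∀ q, V q) (q : N) : F :=
  localDeriv EN F q₀ S' q (ρ q (S q)) - localDeriv EN F q₀ S q (ρ q (S' q)) +
    C q₀ q (localRep F q₀ S q) (localRep F q₀ S' q)

variable (EN F V) in
/-- A skew algebroid structure on `V`, given by its anchor and by its structure functions `C q₀` in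
each of the trivializations. That the structure functions belong to one and the same bracket is
expressed by the existence of sufficiently many sections with a bracket which is the same in all
trivializations. -/
structure SkewStructure where
  anchor : ∀ q, V q →L[ℝ] TangentSpace 𝓘(ℝ, EN) q
  C : N → N → F →L[ℝ] F →L[ℝ] F
  contMDiffOn_anchorRep : ∀ q₀, ContMDiffOn 𝓘(ℝ, EN) 𝓘(ℝ, F →L[ℝ] EN) ∞
    (anchorRep (F := F) EN anchor q₀) (chartDomain EN F V q₀)
  contMDiffOn_C : ∀ q₀, ContMDiffOn 𝓘(ℝ, EN) 𝓘(ℝ, F →L[ℝ] F →L[ℝ] F) ∞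
    (C q₀) (chartDomain EN F V q₀)
  skew : ∀ q₀, ∀ q ∈ chartDomain EN F V q₀, ∀ y y', C q₀ q y y' = -C q₀ q y' y
  exists_bracket : ∀ (q : N) (e e' : V q), ∃ S S' Z : ContMDiffSection 𝓘(ℝ, EN) F ∞ V,
    S q = e ∧ S' q = e' ∧ ∀ q₀, q ∈ chartDomain EN F V q₀ →
      localRep F q₀ Z q = bracketRep anchor C q₀ S S' q

/-- The components along `TN` and along the fibres of the value of `ε` in local coordinates: the
covector `(p, φ)` at the point with fibre coordinate `y` goes to
`(ρ y, y' ↦ p (ρ y') + φ (C (y, y')))`. -/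
def epsRep (a : F →L[ℝ] EN) (C : F →L[ℝ] F →L[ℝ] F) (y : F) (α : EN × F →L[ℝ] ℝ) :
    EN × (F →L[ℝ] ℝ) :=
  (a y, (α.comp (ContinuousLinearMap.inl ℝ EN F)).comp a +
    (α.comp (ContinuousLinearMap.inr ℝ EN F)).comp (C y))

theorem epsRep_snd_apply (a : F →L[ℝ] EN) (C : F →L[ℝ] F →L[ℝ] F) (y y' : F)
    (α : EN × F →L[ℝ] ℝ) : (epsRep a C y α).2 y' = α (a y', C y y') := by
  change α (a y', 0) + α (0, C y y') = _
  rw [← map_add]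
  simp

namespace SkewStructure

variable (𝓢 : SkewStructure EN F V)

/-- The value of `ε` in the coordinates around `q₀`. -/
def epsCoord (q₀ : N) (α : CotangentTotal EN F V) : EN × (F →L[ℝ] ℝ) :=
  epsRep (anchorRep EN 𝓢.anchor q₀ α.proj.proj) (𝓢.C q₀ α.proj.proj)
    (fibreCoord F V q₀ α.proj.proj α.proj.2) (cotCoord EN q₀ α)

/-- The point of `V*` under a covector on the total space of `V`. -/
def under (α : CotangentTotal EN F V) : DualTotal F V :=
  ⟨α.proj.proj, ((cotCoord EN α.proj.proj α).comp (ContinuousLinearMap.inr ℝ EN F)).comp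
    (fibreCoord F V α.proj.proj α.proj.proj)⟩

/-- The morphism `ε : T*V → T V*` of a skew algebroid, defined at each point by means of the
coordinates around this very point. -/
def eps (α : CotangentTotal EN F V) : TangentDualTotal EN F V :=
  ⟨under α, totalVec EN α.proj.proj (under α) (𝓢.epsCoord α.proj.proj α)⟩

theorem covers_under (α : CotangentTotal EN F V) :
    Covers α.proj.2 α.2 (under α).2 := by
  have h := mem_chartDomain_self (E := EN) (R := F) (A := V) α.proj.proj
  refine (covers_iff h (e := α.proj.2)).2 ?_
  ext y
  change _ = cotCoord EN α.proj.proj α (0, fibreCoord F V α.proj.proj α.proj.proj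
    (fibreVec F V α.proj.proj α.proj.proj y))
  rw [fibreCoord_fibreVec h]
  rfl

theorem Covers.unique {q : N} {e : V q}
    {α : TangentSpace (𝓘(ℝ, EN).prod 𝓘(ℝ, F)) (⟨q, e⟩ : TotalSpace F V) →L[ℝ] ℝ}
    {ξ ξ' : V q →L[ℝ] ℝ} (h : Covers e α ξ) (h' : Covers e α ξ') : ξ = ξ' :=
  ContinuousLinearMap.ext fun v ↦ (h v).symm.trans (h' v)

theorem under_eq {q : N} {e : V q}
    {α : TangentSpace (𝓘(ℝ, EN).prod 𝓘(ℝ, F)) (⟨q, e⟩ : TotalSpace F V) →L[ℝ] ℝ}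
    {ξ : V q →L[ℝ] ℝ} (h : Covers e α ξ) : under (⟨⟨q, e⟩, α⟩ : CotangentTotal EN F V) = ⟨q, ξ⟩ :=
  congrArg (TotalSpace.mk q) (Covers.unique (covers_under ⟨⟨q, e⟩, α⟩) h)

/-- A tangent vector of `V*` with the coordinates of `ε α` lies over the anchor. -/
theorem mfderiv_proj_of_coord {q₀ q : N} (h : q ∈ chartDomain EN F V q₀) {e : V q}
    {α : TangentSpace (𝓘(ℝ, EN).prod 𝓘(ℝ, F)) (⟨q, e⟩ : TotalSpace F V) →L[ℝ] ℝ}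
    {ξ : V q →L[ℝ] ℝ}
    {w : TangentSpace (𝓘(ℝ, EN).prod 𝓘(ℝ, F →L[ℝ] ℝ)) (⟨q, ξ⟩ : DualTotal F V)}
    (hw : totalCoord EN q₀ (⟨q, ξ⟩ : DualTotal F V) w = 𝓢.epsCoord q₀ ⟨⟨q, e⟩, α⟩) :
    mfderiv (𝓘(ℝ, EN).prod 𝓘(ℝ, F →L[ℝ] ℝ)) 𝓘(ℝ, EN)
      (fun η : DualTotal F V ↦ η.proj) ⟨q, ξ⟩ w = 𝓢.anchor q e := by
  apply baseCoord_injective h.1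
  rw [baseCoord_mfderiv_proj (η := (⟨q, ξ⟩ : DualTotal F V)) (mem_chartDomain_dual h), hw]
  change baseCoord EN q₀ q (𝓢.anchor q (fibreVec F V q₀ q (fibreCoord F V q₀ q e))) = _
  rw [fibreVec_fibreCoord h]

/-- The derivative of the linear function of a section `S'` along `ε α` is given by the bracket.
This property does not involve coordinates, and it characterizes `ε α`. -/
theorem mfderiv_linearFunction_of_coord {q₀ q : N} (h : q ∈ chartDomain EN F V q₀)
    (S S' : ContMDiffSection 𝓘(ℝ, EN) F ∞ V)
    {α : TangentSpace (𝓘(ℝ, EN).prod 𝓘(ℝ, F)) (⟨q, S q⟩ : TotalSpace F V) →L[ℝ] ℝ}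
    {ξ : V q →L[ℝ] ℝ} (hα : Covers (S q) α ξ)
    {w : TangentSpace (𝓘(ℝ, EN).prod 𝓘(ℝ, F →L[ℝ] ℝ)) (⟨q, ξ⟩ : DualTotal F V)}
    (hw : totalCoord EN q₀ (⟨q, ξ⟩ : DualTotal F V) w = 𝓢.epsCoord q₀ ⟨⟨q, S q⟩, α⟩) :
    mfderiv (𝓘(ℝ, EN).prod 𝓘(ℝ, F →L[ℝ] ℝ)) 𝓘(ℝ, ℝ) (linearFunction S') ⟨q, ξ⟩ w =
      ξ (fibreVec F V q₀ q (bracketRep 𝓢.anchor 𝓢.C q₀ S S' q)) +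
      α (mfderiv 𝓘(ℝ, EN) (𝓘(ℝ, EN).prod 𝓘(ℝ, F)) (fun x ↦ (⟨x, S x⟩ : TotalSpace F V)) q
        (𝓢.anchor q (S' q))) := by
  set α₀ := cotCoord EN q₀ (⟨⟨q, S q⟩, α⟩ : CotangentTotal EN F V) with hα₀
  have hξ : ∀ y, ξ (fibreVec F V q₀ q y) = α₀ (0, y) := fun y ↦
    (congrArg (fun L ↦ L y) ((covers_iff h).1 hα)).symm
  have h1 : anchorRep EN 𝓢.anchor q₀ q (localRep F q₀ S' q) =
      baseCoord EN q₀ q (𝓢.anchor q (S' q)) := by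
    change baseCoord EN q₀ q (𝓢.anchor q (fibreVec F V q₀ q (fibreCoord F V q₀ q (S' q)))) = _
    rw [fibreVec_fibreCoord h]
  have h2 : α (mfderiv 𝓘(ℝ, EN) (𝓘(ℝ, EN).prod 𝓘(ℝ, F)) (fun x ↦ (⟨x, S x⟩ : TotalSpace F V)) q
        (𝓢.anchor q (S' q))) = α₀ (baseCoord EN q₀ q (𝓢.anchor q (S' q)),
          localDeriv EN F q₀ S q (𝓢.anchor q (S' q))) := by
    rw [← totalCoord_mfderiv_section S h]
    exact (cotCoord_apply_totalCoord (α := ⟨⟨q, S q⟩, α⟩) h _).symm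
  rw [mfderiv_linearFunction S' h, 𝓢.mfderiv_proj_of_coord h hw, hw, h2, epsCoord, epsRep_snd_apply,
    hξ, hξ]
  change α₀ (anchorRep EN 𝓢.anchor q₀ q (localRep F q₀ S' q),
    𝓢.C q₀ q (localRep F q₀ S q) (localRep F q₀ S' q)) + _ = _
  rw [h1, ← map_add, ← map_add]
  congr 1
  refine Prod.ext ?_ ?_
  · simp
  · simp only [Prod.snd_add, bracketRep]
    abel

/-- The value of `ε` is given by the same formula in the coordinates around any point. -/
theorem totalCoord_eps {q₀ : N} (α : CotangentTotal EN F V)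
    (h : α.proj.proj ∈ chartDomain EN F V q₀) :
    totalCoord EN q₀ (𝓢.eps α).proj (𝓢.eps α).2 = 𝓢.epsCoord q₀ α := by
  obtain ⟨⟨q, e⟩, α⟩ := α
  change q ∈ _ at h
  have hq := mem_chartDomain_self (E := EN) (R := F) (A := V) q
  have hc := covers_under (⟨⟨q, e⟩, α⟩ : CotangentTotal EN F V)
  change Covers e α _ at hc
  change totalCoord EN q₀ (⟨q, (under (⟨⟨q, e⟩, α⟩ : CotangentTotal EN F V)).2⟩ : DualTotal F V)
    (totalVec EN q (⟨q, _⟩ : DualTotal F V) (𝓢.epsCoord q ⟨⟨q, e⟩, α⟩)) = _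
  set ξ : V q →L[ℝ] ℝ := (under (⟨⟨q, e⟩, α⟩ : CotangentTotal EN F V)).2 with hξ
  set w : TangentSpace (𝓘(ℝ, EN).prod 𝓘(ℝ, F →L[ℝ] ℝ)) (⟨q, ξ⟩ : DualTotal F V) :=
    totalVec EN q (⟨q, ξ⟩ : DualTotal F V) (𝓢.epsCoord q ⟨⟨q, e⟩, α⟩) with hw
  set w' : TangentSpace (𝓘(ℝ, EN).prod 𝓘(ℝ, F →L[ℝ] ℝ)) (⟨q, ξ⟩ : DualTotal F V) :=
    totalVec EN q₀ (⟨q, ξ⟩ : DualTotal F V) (𝓢.epsCoord q₀ ⟨⟨q, e⟩, α⟩) with hw'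
  have e1 : totalCoord EN q (⟨q, ξ⟩ : DualTotal F V) w = 𝓢.epsCoord q ⟨⟨q, e⟩, α⟩ :=
    totalCoord_totalVec (η := (⟨q, ξ⟩ : DualTotal F V)) (mem_chartDomain_dual hq) _
  have e2 : totalCoord EN q₀ (⟨q, ξ⟩ : DualTotal F V) w' = 𝓢.epsCoord q₀ ⟨⟨q, e⟩, α⟩ :=
    totalCoord_totalVec (η := (⟨q, ξ⟩ : DualTotal F V)) (mem_chartDomain_dual h) _
  have e3 := (𝓢.mfderiv_proj_of_coord hq e1).trans (𝓢.mfderiv_proj_of_coord h e2).symm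
  rw [← e2]
  refine Prod.ext ?_ (ContinuousLinearMap.ext fun y ↦ ?_)
  · rw [← baseCoord_mfderiv_proj (η := (⟨q, ξ⟩ : DualTotal F V)) (mem_chartDomain_dual h),
      ← baseCoord_mfderiv_proj (η := (⟨q, ξ⟩ : DualTotal F V)) (mem_chartDomain_dual h)]
    exact congrArg _ e3
  -- both tangent vectors act in the same way on the linear function of `S'`, by the formula for the
  -- bracket in the two coordinate systems
  · obtain ⟨S, S', Z, rfl, hS', hZ⟩ := 𝓢.exists_bracket q e (fibreVec F V q₀ q y)
    have e4 := 𝓢.mfderiv_linearFunction_of_coord hq S S' hc e1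
    have e5 := 𝓢.mfderiv_linearFunction_of_coord h S S' hc e2
    rw [← hZ q hq, localRep, fibreVec_fibreCoord hq] at e4
    rw [← hZ q₀ h, localRep, fibreVec_fibreCoord h] at e5
    have e6 := e4.trans e5.symm
    rw [mfderiv_linearFunction S' h, mfderiv_linearFunction S' h, e3] at e6
    have e7 := add_right_cancel (G := ℝ) e6
    rwa [localRep, hS', fibreCoord_fibreVec h] at e7

end SkewStructure

/-! ### Smoothness of the morphism and the linear structures -/

/-- Tangent vectors of the total space of `V` with the same coordinates are equal. -/
theorem tangent_ext {q₀ : N}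
    {w w' : TangentBundle (𝓘(ℝ, EN).prod 𝓘(ℝ, F)) (TotalSpace F V)}
    (h : w.proj.proj ∈ chartDomain EN F V q₀) (h' : w'.proj.proj ∈ chartDomain EN F V q₀)
    (e₁ : adaptedChart EN F V q₀ w.proj = adaptedChart EN F V q₀ w'.proj)
    (e₂ : totalCoord EN q₀ w.proj w.2 = totalCoord EN q₀ w'.proj w'.2) : w = w' := by
  obtain ⟨η, w⟩ := w
  obtain ⟨η', w'⟩ := w'
  obtain rfl : η = η' := eq_of_adaptedChart_eq h h' e₁
  exact congrArg (TotalSpace.mk η) (totalCoord_injective h e₂)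

/-- The point under a covector in coordinates: the components of the covector along the fibre. -/
theorem adaptedChart_under {q₀ : N} {α : CotangentTotal EN F V}
    (h : α.proj.proj ∈ chartDomain EN F V q₀) :
    adaptedChart EN (F →L[ℝ] ℝ) (fun q : N ↦ V q →L[ℝ] ℝ) q₀ (SkewStructure.under α) =
      (extChartAt 𝓘(ℝ, EN) q₀ α.proj.proj,
        (cotCoord EN q₀ α).comp (ContinuousLinearMap.inr ℝ EN F)) := by
  refine (adaptedChart_mk (mem_chartDomain_dual h) (SkewStructure.under α).2).trans ?_
  exact Prod.ext rfl ((fibreCoord_dual h (SkewStructure.under α).2).trans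
    ((covers_iff h).1 (SkewStructure.covers_under α)).symm)

theorem totalCoord_eq_snd {q₀ : N} {η : TotalSpace F V} (h : η.proj ∈ chartDomain EN F V q₀)
    (w : TangentSpace (𝓘(ℝ, EN).prod 𝓘(ℝ, F)) η) :
    totalCoord EN q₀ η w = (trivializationAt (EN × F) (TangentSpace (𝓘(ℝ, EN).prod 𝓘(ℝ, F)))
      (⟨q₀, 0⟩ : TotalSpace F V) ⟨η, w⟩).2 :=
  Trivialization.continuousLinearMapAt_apply_of_mem ℝ (trivializationAt (EN × F)
    (TangentSpace (𝓘(ℝ, EN).prod 𝓘(ℝ, F))) (⟨q₀, 0⟩ : TotalSpace F V)) (mem_totalBaseSet h) w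

/-- The trivialization of the tangent bundle of the total space around a point depends only on the
projection of this point. -/
theorem trivializationAt_tangent_total (η : TotalSpace F V) :
    trivializationAt (EN × F) (TangentSpace (𝓘(ℝ, EN).prod 𝓘(ℝ, F))) η =
      trivializationAt (EN × F) (TangentSpace (𝓘(ℝ, EN).prod 𝓘(ℝ, F)))
        (⟨η.proj, 0⟩ : TotalSpace F V) := by
  rw [TangentBundle.trivializationAt_eq_localTriv, TangentBundle.trivializationAt_eq_localTriv]
  congr 1
  refine Subtype.ext ?_
  rw [coe_achart, coe_achart, FiberBundle.chartedSpace_chartAt, FiberBundle.chartedSpace_chartAt]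

theorem totalCoord_smul {q₀ : N} {η : TotalSpace F V} (s : ℝ)
    (w : TangentSpace (𝓘(ℝ, EN).prod 𝓘(ℝ, F)) η) :
    totalCoord EN q₀ η (s • w) = s • totalCoord EN q₀ η w := map_smul _ s w

theorem contMDiffAt_cotCoord (α₀ : CotangentTotal EN F V) :
    ContMDiffAt ((𝓘(ℝ, EN).prod 𝓘(ℝ, F)).prod 𝓘(ℝ, EN × F →L[ℝ] ℝ)) 𝓘(ℝ, EN × F →L[ℝ] ℝ) ∞
      (cotCoord EN α₀.proj.proj) α₀ := by
  have h := (contMDiffAt_totalSpace.1 (contMDiffAt_id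
    (I := (𝓘(ℝ, EN).prod 𝓘(ℝ, F)).prod 𝓘(ℝ, EN × F →L[ℝ] ℝ)) (n := ∞) (x := α₀))).2
  refine h.congr_of_eventuallyEq (Eventually.of_forall fun α ↦ ?_)
  change _ = ContinuousLinearMap.inCoordinates _ _ _ _ _ _ _ _ _
  refine ContinuousLinearMap.ext fun z ↦ ?_
  simp only [ContinuousLinearMap.inCoordinates, ContinuousLinearMap.comp_apply, id,
    trivializationAt_tangent_total α₀.proj]
  simp [cotCoord]

theorem contMDiffAt_fibreCoord (e₀ : TotalSpace F V) :
    ContMDiffAt (𝓘(ℝ, EN).prod 𝓘(ℝ, F)) 𝓘(ℝ, F) ∞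
      (fun e : TotalSpace F V ↦ fibreCoord F V e₀.proj e.proj e.2) e₀ := by
  have h := (contMDiffAt_totalSpace.1 (contMDiffAt_id
    (I := 𝓘(ℝ, EN).prod 𝓘(ℝ, F)) (n := ∞) (x := e₀))).2
  refine h.congr_of_eventuallyEq ?_
  filter_upwards [eventually_mem_chartDomain_proj (mem_chartDomain_self (E := EN) e₀.proj)]
    with e he
  exact Trivialization.continuousLinearMapAt_apply_of_mem ℝ _ he.2 _

namespace SkewStructure

variable (𝓢 : SkewStructure EN F V)

/-- Smoothness near a covector over `q₀` follows from the formula for `ε` in the coordinates around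
the fixed point `q₀`. -/
theorem contMDiff_eps : ContMDiff ((𝓘(ℝ, EN).prod 𝓘(ℝ, F)).prod 𝓘(ℝ, EN × F →L[ℝ] ℝ))
    ((𝓘(ℝ, EN).prod 𝓘(ℝ, F →L[ℝ] ℝ)).tangent) ∞ 𝓢.eps := by
  intro α₀
  set q₀ := α₀.proj.proj with hq₀
  have hself := mem_chartDomain_self (E := EN) (R := F) (A := V) q₀
  have hp : ContMDiffAt ((𝓘(ℝ, EN).prod 𝓘(ℝ, F)).prod 𝓘(ℝ, EN × F →L[ℝ] ℝ))
      (𝓘(ℝ, EN).prod 𝓘(ℝ, F)) ∞ (fun α : CotangentTotal EN F V ↦ α.proj) α₀ :=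
    contMDiffAt_proj _
  have hpp : ContMDiffAt ((𝓘(ℝ, EN).prod 𝓘(ℝ, F)).prod 𝓘(ℝ, EN × F →L[ℝ] ℝ))
      𝓘(ℝ, EN) ∞ (fun α : CotangentTotal EN F V ↦ α.proj.proj) α₀ :=
    (contMDiffAt_proj V).comp α₀ hp
  have hev : ∀ᶠ α : CotangentTotal EN F V in 𝓝 α₀, α.proj.proj ∈ chartDomain EN F V q₀ :=
    hpp.continuousAt.eventually ((isOpen_chartDomain q₀).mem_nhds hself)
  have hy := (contMDiffAt_fibreCoord (EN := EN) α₀.proj).comp α₀ hp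
  have hc := contMDiffAt_cotCoord α₀
  have ha := ((𝓢.contMDiffOn_anchorRep q₀).contMDiffAt
    ((isOpen_chartDomain q₀).mem_nhds hself)).comp α₀ hpp
  have hC := ((𝓢.contMDiffOn_C q₀).contMDiffAt
    ((isOpen_chartDomain q₀).mem_nhds hself)).comp α₀ hpp
  rw [contMDiffAt_totalSpace]
  constructor
  · rw [contMDiffAt_totalSpace]
    refine ⟨hpp, ?_⟩
    refine (hc.clm_comp (contMDiffAt_const (c := ContinuousLinearMap.inr ℝ EN F))
      ).congr_of_eventuallyEq ?_
    filter_upwards [hev] with α hα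
    have h1 := adaptedChart_under hα
    rw [adaptedChart_apply (show (SkewStructure.under α).proj ∈ _ from
      mem_chartDomain_dual hα)] at h1
    exact congrArg Prod.snd h1
  · have h1 : ContMDiffAt ((𝓘(ℝ, EN).prod 𝓘(ℝ, F)).prod 𝓘(ℝ, EN × F →L[ℝ] ℝ))
        𝓘(ℝ, EN × (F →L[ℝ] ℝ)) ∞ (𝓢.epsCoord q₀) α₀ := by
      refine (ha.clm_apply hy).prodMk_space ?_
      exact ((hc.clm_comp (contMDiffAt_const (c := ContinuousLinearMap.inl ℝ EN F))).clm_comp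
        ha).add ((hc.clm_comp (contMDiffAt_const (c := ContinuousLinearMap.inr ℝ EN F))).clm_comp
          (hC.clm_apply hy))
    refine h1.congr_of_eventuallyEq ?_
    filter_upwards [hev] with α hα
    rw [← 𝓢.totalCoord_eps α hα]
    exact (totalCoord_eq_snd (η := under α) (mem_chartDomain_dual hα) (𝓢.eps α).2).symm

/-- The compatibility of `ε` with the linear structures over `V*`. -/
theorem eps_fibreScale (s : ℝ) (hs : s ≠ 0) (α : CotangentTotal EN F V) :
    𝓢.eps (phaseLift EN s (fibreScale F V s) α) = ⟨(𝓢.eps α).proj, s • (𝓢.eps α).2⟩ := by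
  obtain ⟨⟨q, e⟩, α⟩ := α
  have hq := mem_chartDomain_self (E := EN) (R := F) (A := V) q
  let L : (EN × F) ≃L[ℝ] EN × F := (ContinuousLinearEquiv.refl ℝ EN).prodCongr
    (ContinuousLinearEquiv.smulLeft (Units.mk0 s hs))
  have hg : ∀ η : TotalSpace F V, η.proj ∈ chartDomain EN F V q →
      (fibreScale F V s η).proj ∈ chartDomain EN F V q ∧
        adaptedChart EN F V q (fibreScale F V s η) = L (adaptedChart EN F V q η) := by
    rintro ⟨q', v⟩ h'
    refine ⟨h', ?_⟩
    rw [fibreScale, adaptedChart_mk h', adaptedChart_mk h', map_smul]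
    rfl
  have hc := cotCoord_phaseLift hg s ⟨⟨q, e⟩, α⟩ hq
  refine tangent_ext (mem_chartDomain_dual hq) (mem_chartDomain_dual hq) ?_ ?_
  · refine (adaptedChart_under hq).trans (Eq.trans ?_ (adaptedChart_under hq).symm)
    rw [hc]
    refine Prod.ext rfl (ContinuousLinearMap.ext fun y ↦ ?_)
    change s * (cotCoord EN q (⟨⟨q, e⟩, α⟩ : CotangentTotal EN F V)) (0, s⁻¹ • y) = _
    rw [← smul_eq_mul, ← map_smul, Prod.smul_mk, smul_zero, smul_inv_smul₀ hs]
    rfl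
  · have h1 : totalCoord EN q (𝓢.eps ⟨⟨q, e⟩, α⟩).proj (s • (𝓢.eps ⟨⟨q, e⟩, α⟩).2) =
        s • 𝓢.epsCoord q ⟨⟨q, e⟩, α⟩ := by
      rw [totalCoord_smul, 𝓢.totalCoord_eps ⟨⟨q, e⟩, α⟩ hq]
    refine (𝓢.totalCoord_eps (phaseLift EN s (fibreScale F V s) ⟨⟨q, e⟩, α⟩) hq).trans
      (Eq.trans ?_ h1.symm)
    rw [epsCoord, hc]
    refine Prod.ext ?_ (ContinuousLinearMap.ext fun y ↦ ?_)
    · change anchorRep EN 𝓢.anchor q q (fibreCoord F V q q (s • e)) =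
        s • anchorRep EN 𝓢.anchor q q (fibreCoord F V q q e)
      rw [map_smul, map_smul]
    · rw [epsRep_snd_apply]
      refine Eq.trans ?_ (congrArg (s • ·) (epsRep_snd_apply _ _ _ _ _).symm)
      change s * (cotCoord EN q (⟨⟨q, e⟩, α⟩ : CotangentTotal EN F V))
        (anchorRep EN 𝓢.anchor q q y, s⁻¹ • 𝓢.C q q (fibreCoord F V q q (s • e)) y) = s * _
      rw [map_smul, map_smul, smul_apply, inv_smul_smul₀ hs]

end SkewStructure

namespace SkewStructure

variable (𝓢 : SkewStructure EN F V)

/-- The compatibility of `ε` with the linear structures over `V` and over `T N`. -/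
theorem eps_smul (s : ℝ) (α : CotangentTotal EN F V) : 𝓢.eps ⟨α.proj, s • α.2⟩ =
    tangentMap (𝓘(ℝ, EN).prod 𝓘(ℝ, F →L[ℝ] ℝ)) (𝓘(ℝ, EN).prod 𝓘(ℝ, F →L[ℝ] ℝ))
      (fibreScale (F →L[ℝ] ℝ) (fun q : N ↦ V q →L[ℝ] ℝ) s) (𝓢.eps α) := by
  have hq := mem_chartDomain_self (E := EN) (R := F) (A := V) α.proj.proj
  set q := α.proj.proj
  let L : EN × (F →L[ℝ] ℝ) →L[ℝ] EN × (F →L[ℝ] ℝ) :=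
    (ContinuousLinearMap.fst ℝ EN (F →L[ℝ] ℝ)).prod (s • ContinuousLinearMap.snd ℝ EN (F →L[ℝ] ℝ))
  have hg : ∀ η : DualTotal F V, η.proj ∈ chartDomain EN (F →L[ℝ] ℝ)
      (fun q : N ↦ V q →L[ℝ] ℝ) q →
      (fibreScale (F →L[ℝ] ℝ) (fun q : N ↦ V q →L[ℝ] ℝ) s η).proj ∈ chartDomain EN (F →L[ℝ] ℝ)
        (fun q : N ↦ V q →L[ℝ] ℝ) q ∧
        adaptedChart EN (F →L[ℝ] ℝ) (fun q : N ↦ V q →L[ℝ] ℝ) q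
          (fibreScale (F →L[ℝ] ℝ) (fun q : N ↦ V q →L[ℝ] ℝ) s η) =
        L (adaptedChart EN (F →L[ℝ] ℝ) (fun q : N ↦ V q →L[ℝ] ℝ) q η) := by
    rintro ⟨q', ξ⟩ h'
    refine ⟨h', ?_⟩
    rw [fibreScale, adaptedChart_mk h', adaptedChart_mk h', map_smul]
    rfl
  have hc : cotCoord EN q (⟨α.proj, s • α.2⟩ : CotangentTotal EN F V) = s • cotCoord EN q α := rfl
  have hd := mem_chartDomain_dual (F := F) (V := V) hq
  refine tangent_ext hd (hg (under α) hd).1 ?_ ?_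
  · refine (adaptedChart_under (α := ⟨α.proj, s • α.2⟩) hq).trans
      (Eq.trans ?_ (hg (under α) hd).2.symm)
    rw [adaptedChart_under hq, hc]
    rfl
  · refine (𝓢.totalCoord_eps ⟨α.proj, s • α.2⟩ hq).trans
      (Eq.trans ?_ (totalCoord_tangentMap hg (𝓢.eps α) hd).symm)
    rw [𝓢.totalCoord_eps α hq, epsCoord, hc]
    refine Prod.ext rfl (ContinuousLinearMap.ext fun y ↦ ?_)
    rw [epsRep_snd_apply]
    refine Eq.trans ?_ (congrArg (s • ·) (epsRep_snd_apply _ _ _ _ _).symm)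
    rfl

/-! ### Automorphisms and the first weight -/

/-- The fibrewise linear map `gV` over `g` is given by linear isomorphisms in the
coordinates around `q₀`, and these preserve the anchor and the structure functions. -/
structure IsChartAutomorphism (q₀ : N) (g : N → N) (gV : ∀ q, V q →L[ℝ] V (g q)) (ℓ : EN ≃L[ℝ] EN)
    (m : F ≃L[ℝ] F) : Prop where
  mem : ∀ q ∈ chartDomain EN F V q₀, g q ∈ chartDomain EN F V q₀
  base : ∀ q ∈ chartDomain EN F V q₀, extChartAt 𝓘(ℝ, EN) q₀ (g q) = ℓ (extChartAt 𝓘(ℝ, EN) q₀ q)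
  fibre : ∀ q ∈ chartDomain EN F V q₀, ∀ v : V q,
    fibreCoord F V q₀ (g q) (gV q v) = m (fibreCoord F V q₀ q v)
  anchor : ∀ q ∈ chartDomain EN F V q₀, ∀ y, anchorRep EN 𝓢.anchor q₀ (g q) (m y) =
    ℓ (anchorRep EN 𝓢.anchor q₀ q y)
  bracket : ∀ q ∈ chartDomain EN F V q₀, ∀ y y', 𝓢.C q₀ (g q) (m y) (m y') = m (𝓢.C q₀ q y y')

/-- The inverse of a map between fibres which is given by `m` in coordinates. -/
theorem inverse_of_fibre {q₀ q q' : N} (hq : q ∈ chartDomain EN F V q₀)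
    (hq' : q' ∈ chartDomain EN F V q₀) {L : V q →L[ℝ] V q'} {m : F ≃L[ℝ] F}
    (h : ∀ v : V q, fibreCoord F V q₀ q' (L v) = m (fibreCoord F V q₀ q v)) :
    L.inverse = (fibreVec F V q₀ q).comp
      ((m.symm : F →L[ℝ] F).comp (fibreCoord F V q₀ q')) := by
  have h' : ∀ v, L v = fibreVec F V q₀ q' (m (fibreCoord F V q₀ q v)) := fun v ↦ by
    rw [← h, fibreVec_fibreCoord hq']
  refine ContinuousLinearMap.inverse_eq ?_ ?_
  · ext1 w
    simp only [ContinuousLinearMap.comp_apply, ContinuousLinearEquiv.coe_coe]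
    rw [h', fibreCoord_fibreVec hq, m.apply_symm_apply, fibreVec_fibreCoord hq']
    rfl
  · ext1 w
    simp only [ContinuousLinearMap.comp_apply, ContinuousLinearEquiv.coe_coe]
    rw [h, m.symm_apply_apply, fibreVec_fibreCoord hq]
    rfl

/-- The compatibility of `ε` with the first weights. -/
theorem eps_phaseLift_scale {k : ℕ} {h : ℝ → N → N} {hV : ∀ t q, V q →L[ℝ] V (h t q)} (t : ℝ)
    (α : CotangentTotal EN F V) {q₀ : N} (hα : α.proj.proj ∈ chartDomain EN F V q₀)
    {ℓ : EN ≃L[ℝ] EN} {m : F ≃L[ℝ] F} (H : 𝓢.IsChartAutomorphism q₀ (h t) (hV t) ℓ m) :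
    𝓢.eps (phaseLift EN (t ^ (k - 1)) (scale F hV t) α) =
      tangentMap (𝓘(ℝ, EN).prod 𝓘(ℝ, F →L[ℝ] ℝ)) (𝓘(ℝ, EN).prod 𝓘(ℝ, F →L[ℝ] ℝ))
        (dualScale F hV k t) (𝓢.eps α) := by
  obtain ⟨⟨q, e⟩, α⟩ := α
  change q ∈ _ at hα
  set c := t ^ (k - 1) with hc
  have hgV : ∀ η : TotalSpace F V, η.proj ∈ chartDomain EN F V q₀ →
      (scale F hV t η).proj ∈ chartDomain EN F V q₀ ∧
        adaptedChart EN F V q₀ (scale F hV t η) = ℓ.prodCongr m (adaptedChart EN F V q₀ η) := by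
    rintro ⟨q', v⟩ h'
    refine ⟨H.mem q' h', ?_⟩
    rw [scale, adaptedChart_mk (H.mem q' h'), adaptedChart_mk h', H.base q' h', H.fibre q' h']
    rfl
  let L : EN × (F →L[ℝ] ℝ) →L[ℝ] EN × (F →L[ℝ] ℝ) :=
    (ℓ : EN →L[ℝ] EN).prodMap (c • (m.symm : F →L[ℝ] F).precomp ℝ)
  have hg : ∀ η : DualTotal F V, η.proj ∈ chartDomain EN (F →L[ℝ] ℝ)
      (fun q : N ↦ V q →L[ℝ] ℝ) q₀ →
      (dualScale F hV k t η).proj ∈ chartDomain EN (F →L[ℝ] ℝ)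
        (fun q : N ↦ V q →L[ℝ] ℝ) q₀ ∧
        adaptedChart EN (F →L[ℝ] ℝ) (fun q : N ↦ V q →L[ℝ] ℝ) q₀ (dualScale F hV k t η) =
        L (adaptedChart EN (F →L[ℝ] ℝ) (fun q : N ↦ V q →L[ℝ] ℝ) q₀ η) := by
    rintro ⟨q', ξ⟩ h'
    have h2 : q' ∈ chartDomain EN F V q₀ := by rwa [chartDomain_dual] at h'
    have h3 := mem_chartDomain_dual (H.mem q' h2)
    refine ⟨h3, ?_⟩
    rw [dualScale, adaptedChart_mk h3, adaptedChart_mk h', H.base q' h2,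
      fibreCoord_dual (H.mem q' h2), fibreCoord_dual h2,
      inverse_of_fibre h2 (H.mem q' h2) (H.fibre q' h2)]
    refine Prod.ext rfl (ContinuousLinearMap.ext fun y ↦ ?_)
    change c • ξ (fibreVec F V q₀ q' (m.symm (fibreCoord F V q₀ (h t q')
      (fibreVec F V q₀ (h t q') y)))) = _
    rw [fibreCoord_fibreVec (H.mem q' h2)]
    rfl
  have hcot := cotCoord_phaseLift hgV c ⟨⟨q, e⟩, α⟩ hα
  have hd := mem_chartDomain_dual (F := F) (V := V) hα
  refine tangent_ext (mem_chartDomain_dual (H.mem q hα)) (hg (under ⟨⟨q, e⟩, α⟩) hd).1 ?_ ?_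
  · refine (adaptedChart_under (α := phaseLift EN c (scale F hV t) ⟨⟨q, e⟩, α⟩)
      (H.mem q hα)).trans (Eq.trans ?_ (hg (under ⟨⟨q, e⟩, α⟩) hd).2.symm)
    rw [adaptedChart_under (α := ⟨⟨q, e⟩, α⟩) hα, hcot]
    refine Prod.ext (H.base q hα) (ContinuousLinearMap.ext fun y ↦ ?_)
    change c • cotCoord EN q₀ (⟨⟨q, e⟩, α⟩ : CotangentTotal EN F V) (ℓ.symm 0, m.symm y) =
      c • cotCoord EN q₀ (⟨⟨q, e⟩, α⟩ : CotangentTotal EN F V) (0, m.symm y)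
    rw [map_zero]
  · refine (𝓢.totalCoord_eps (phaseLift EN c (scale F hV t) ⟨⟨q, e⟩, α⟩) (H.mem q hα)).trans
      (Eq.trans ?_ (totalCoord_tangentMap hg (𝓢.eps ⟨⟨q, e⟩, α⟩) hd).symm)
    rw [𝓢.totalCoord_eps ⟨⟨q, e⟩, α⟩ hα, epsCoord, hcot]
    have h1 : fibreCoord F V q₀ (phaseLift EN c (scale F hV t)
        (⟨⟨q, e⟩, α⟩ : CotangentTotal EN F V)).proj.proj (phaseLift EN c (scale F hV t)
          (⟨⟨q, e⟩, α⟩ : CotangentTotal EN F V)).proj.2 = m (fibreCoord F V q₀ q e) :=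
      H.fibre q hα e
    rw [h1]
    refine Prod.ext (H.anchor q hα _) (ContinuousLinearMap.ext fun y ↦ ?_)
    rw [epsRep_snd_apply]
    refine Eq.trans ?_ (congrArg (c • ·) (epsRep_snd_apply (anchorRep EN 𝓢.anchor q₀ q) (𝓢.C q₀ q)
      (fibreCoord F V q₀ q e) (m.symm y) (cotCoord EN q₀ ⟨⟨q, e⟩, α⟩)).symm)
    change c • cotCoord EN q₀ (⟨⟨q, e⟩, α⟩ : CotangentTotal EN F V)
      (ℓ.symm (anchorRep EN 𝓢.anchor q₀ (h t q) y),
        m.symm (𝓢.C q₀ (h t q) (m (fibreCoord F V q₀ q e)) y)) = _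
    obtain ⟨y, rfl⟩ := m.surjective y
    rw [H.anchor q hα, H.bracket q hα, ℓ.symm_apply_apply, m.symm_apply_apply, m.symm_apply_apply]

/-! ### The weighted algebroid of a skew algebroid structure -/

/-- The weighted algebroid of a skew structure which is preserved by the homogeneity structure. -/
def toWeightedAlgebroid {k : ℕ} {h : ℝ → N → N} {hV : ∀ t q, V q →L[ℝ] V (h t q)}
    (H : ∀ t : ℝ, t ≠ 0 → ∀ q₀, ∃ (ℓ : EN ≃L[ℝ] EN) (m : F ≃L[ℝ] F),
      𝓢.IsChartAutomorphism q₀ (h t) (hV t) ℓ m) :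
    WeightedAlgebroid (EN := EN) (F := F) k h hV where
  ε := 𝓢.eps
  contMDiff := 𝓢.contMDiff_eps
  covers_id _ _ _ _ hξ := under_eq hξ
  map_weight₁ t ht α := by
    obtain ⟨ℓ, m, h⟩ := H t ht α.proj.proj
    exact 𝓢.eps_phaseLift_scale t α (mem_chartDomain_self _) h
  map_weight₂ s hs α := 𝓢.eps_fibreScale s hs α
  map_weight₃ s _ α := 𝓢.eps_smul s α

variable {k : ℕ} {h : ℝ → N → N} {hV : ∀ t q, V q →L[ℝ] V (h t q)}
    (H : ∀ t : ℝ, t ≠ 0 → ∀ q₀, ∃ (ℓ : EN ≃L[ℝ] EN) (m : F ≃L[ℝ] F),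
      𝓢.IsChartAutomorphism q₀ (h t) (hV t) ℓ m)

theorem hasAnchor : (𝓢.toWeightedAlgebroid (k := k) H).HasAnchor 𝓢.anchor := by
  rintro ⟨⟨q, e⟩, α⟩
  have hq := mem_chartDomain_self (E := EN) (R := F) (A := V) q
  exact congrArg (TotalSpace.mk q) (𝓢.mfderiv_proj_of_coord hq
    (𝓢.totalCoord_eps ⟨⟨q, e⟩, α⟩ hq))

theorem bracketRep_skew {q : N} (X X' : ∀ q, V q) :
    bracketRep 𝓢.anchor 𝓢.C q X' X q = -bracketRep 𝓢.anchor 𝓢.C q X X' q := by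
  rw [bracketRep, bracketRep, 𝓢.skew q q (mem_chartDomain_self q)]
  abel

/-- Both `β' (ε α)` and `β (ε α')` are, up to a sign, equal to the value of `ξ` on the bracket of `X`
and `X'`, plus the same terms depending on `α` and `α'`. -/
theorem isSkew : (𝓢.toWeightedAlgebroid (k := k) H).IsSkew := by
  intro X X' q ξ α α' β β' u u' hβ hβ' hu hu'
  have hq := mem_chartDomain_self (E := EN) (R := F) (A := V) q
  change 𝓢.eps _ = _ at hu hu'
  have hc := 𝓢.totalCoord_eps ⟨⟨q, X q⟩, α⟩ hq
  have hc' := 𝓢.totalCoord_eps ⟨⟨q, X' q⟩, α'⟩ hq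
  rw [hu] at hc
  rw [hu'] at hc'
  have h1 := hβ'.2 u
  have h2 := hβ.2 u'
  have h3 := 𝓢.mfderiv_linearFunction_of_coord hq X X' hβ.1 hc
  have h4 := 𝓢.mfderiv_linearFunction_of_coord hq X' X hβ'.1 hc'
  rw [𝓢.bracketRep_skew, map_neg, map_neg] at h4
  have h5 := 𝓢.mfderiv_proj_of_coord hq hc
  have h6 := 𝓢.mfderiv_proj_of_coord hq hc'
  rw [h5] at h1
  rw [h6] at h2
  have h7 := h1.trans h3
  have h8 := h2.trans h4
  have key : ∀ a b c d e : ℝ, a + b = c + d → e + d = -c + b → a + e = 0 := by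
    intros
    linarith
  exact key _ _ _ _ _ h7 h8

/-- If `β` is the differential of the linear function of `X`, then `α` vanishes on the vectors tangent
to the image of `X`, so only the bracket remains in the derivative along `ε α`. -/
theorem isBracket {X Y Z : ContMDiffSection 𝓘(ℝ, EN) F ∞ V}
    (hZ : ∀ q, localRep F q Z q = bracketRep 𝓢.anchor 𝓢.C q X Y q) :
    (𝓢.toWeightedAlgebroid (k := k) H).IsBracket X Y Z := by
  intro q ξ α β hβ hβX
  have hq := mem_chartDomain_self (E := EN) (R := F) (A := V) q
  have hd := mem_chartDomain_dual (F := F) (V := V) hq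
  change mfderiv _ _ (linearFunction Y) (𝓢.eps ⟨⟨q, X q⟩, α⟩).proj (𝓢.eps ⟨⟨q, X q⟩, α⟩).2 = _
  have hc := 𝓢.totalCoord_eps ⟨⟨q, X q⟩, α⟩ hq
  obtain ⟨u, hu⟩ : ∃ u : TangentSpace (𝓘(ℝ, EN).prod 𝓘(ℝ, F →L[ℝ] ℝ)) (⟨q, ξ⟩ : DualTotal F V),
      𝓢.eps ⟨⟨q, X q⟩, α⟩ = ⟨⟨q, ξ⟩, u⟩ := by
    have h1 := under_eq hβ.1
    have h2 : (𝓢.eps ⟨⟨q, X q⟩, α⟩).proj = ⟨q, ξ⟩ := h1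
    rw [← h2]
    exact ⟨_, rfl⟩
  rw [hu] at hc ⊢
  have h3 := 𝓢.mfderiv_linearFunction_of_coord hq X Y hβ.1 hc
  refine h3.trans ?_
  rw [← hZ q, localRep, fibreVec_fibreCoord hq]
  -- the anchor of `Y q` is the projection of a tangent vector of `V*`
  have h4 := hβ.2 (totalVec EN q (⟨q, ξ⟩ : DualTotal F V)
    (baseCoord EN q q (𝓢.anchor q (Y q)), 0))
  rw [hβX] at h4
  have h5 : mfderiv (𝓘(ℝ, EN).prod 𝓘(ℝ, F →L[ℝ] ℝ)) 𝓘(ℝ, EN)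
      (fun η : DualTotal F V ↦ η.proj) ⟨q, ξ⟩ (totalVec EN q (⟨q, ξ⟩ : DualTotal F V)
    (baseCoord EN q q (𝓢.anchor q (Y q)), 0)) = 𝓢.anchor q (Y q) := by
    apply baseCoord_injective hq.1
    rw [baseCoord_mfderiv_proj (η := (⟨q, ξ⟩ : DualTotal F V)) hd,
      totalCoord_totalVec (η := (⟨q, ξ⟩ : DualTotal F V)) hd]
  rw [h5] at h4
  exact (congrArg (ξ (Z q) + ·) (left_eq_add.1 h4.symm)).trans (add_zero _)

end SkewStructure

/-! ### Sections with prescribed local representatives -/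

theorem exists_cutoff [FiniteDimensional ℝ EN] [T2Space N] {U : Set N} {x : N} (hU : U ∈ 𝓝 x) :
    ∃ χ : N → ℝ, ContMDiff 𝓘(ℝ, EN) 𝓘(ℝ, ℝ) ∞ χ ∧ tsupport χ ⊆ U ∧ χ =ᶠ[𝓝 x] 1 := by
  obtain ⟨f, -, hf⟩ := (SmoothBumpFunction.nhds_basis_tsupport (I := 𝓘(ℝ, EN)) x).mem_iff.1 hU
  exact ⟨f, f.contMDiff, hf, f.eventuallyEq_one⟩

/-- A section over a chart domain, given by its representative `f`, multiplied by a cut-off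
function `χ`. -/
theorem contMDiff_cutoff_section {q₀ : N} {χ : N → ℝ} {f : N → F}
    (hχ : ContMDiff 𝓘(ℝ, EN) 𝓘(ℝ, ℝ) ∞ χ) (hs : tsupport χ ⊆ chartDomain EN F V q₀)
    (hf : ContMDiffOn 𝓘(ℝ, EN) 𝓘(ℝ, F) ∞ f (chartDomain EN F V q₀)) :
    ContMDiff 𝓘(ℝ, EN) (𝓘(ℝ, EN).prod 𝓘(ℝ, F)) ∞
      (fun q ↦ (⟨q, χ q • fibreVec F V q₀ q (f q)⟩ : TotalSpace F V)) := by
  refine ContMDiffOn.smul_section_of_tsupport (s := fun q ↦ fibreVec F V q₀ q (f q))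
    hχ.contMDiffOn (isOpen_chartDomain q₀) hs ?_
  refine ((trivializationAt F V q₀).contMDiffOn_section_iff (IB := 𝓘(ℝ, EN)) (n := ∞)
    (isOpen_chartDomain q₀) inter_subset_right).2 (hf.congr fun q hq ↦ ?_)
  rw [← localRep_eq (fun q ↦ fibreVec F V q₀ q (f q)) hq.2]
  exact fibreCoord_fibreVec hq (f q)

theorem localRep_cutoff {q₀ q : N} (h : q ∈ chartDomain EN F V q₀) {χ : N → ℝ} {f : N → F}
    (hχ : χ =ᶠ[𝓝 q] 1) :
    localRep F q₀ (fun q ↦ χ q • fibreVec F V q₀ q (f q)) =ᶠ[𝓝 q] f := by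
  filter_upwards [eventually_mem_chartDomain h, hχ] with x hx h1
  rw [localRep, h1, Pi.one_apply, one_smul, fibreCoord_fibreVec hx]

/-- Near every point of a chart domain there are global sections with constant representatives,
depending linearly on the constant. -/
theorem exists_constant_sections [FiniteDimensional ℝ EN] [T2Space N] {q₀ q : N}
    (h : q ∈ chartDomain EN F V q₀) :
    ∃ L : F →ₗ[ℝ] ContMDiffSection 𝓘(ℝ, EN) F ∞ V,
      ∀ y, localRep F q₀ (L y) =ᶠ[𝓝 q] fun _ ↦ y := by
  obtain ⟨χ, h1, h2, h3⟩ := exists_cutoff (EN := EN) (eventually_mem_chartDomain h)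
  refine ⟨{ toFun := fun y ↦ ⟨_, contMDiff_cutoff_section h1 h2
              (contMDiffOn_const (c := y))⟩, map_add' := ?_, map_smul' := ?_ },
    fun y ↦ localRep_cutoff h h3⟩
  · intro y y'
    ext q
    change χ q • fibreVec F V q₀ q (y + y') = χ q • _ + χ q • _
    rw [map_add, smul_add]
  · intro t y
    ext q
    change χ q • fibreVec F V q₀ q (t • y) = t • χ q • _
    rw [map_smul, smul_comm]

theorem localDeriv_of_eventuallyEq_const {q₀ q : N} {S : ∀ q, V q} {y : F}
    (h : localRep F q₀ S =ᶠ[𝓝 q] fun _ ↦ y) : localDeriv EN F q₀ S q = 0 := by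
  rw [localDeriv, h.mfderiv_eq, mfderiv_const]
  rfl

theorem localDeriv_sub {q₀ q : N} (h : q ∈ chartDomain EN F V q₀)
    (S S' : ContMDiffSection 𝓘(ℝ, EN) F ∞ V) :
    localDeriv EN F q₀ (S - S' : ContMDiffSection 𝓘(ℝ, EN) F ∞ V) q =
      localDeriv EN F q₀ S q - localDeriv EN F q₀ S' q := by
  refine HasMFDerivAt.mfderiv ?_
  have := (hasMFDerivAt_localRep S h).sub (hasMFDerivAt_localRep S' h)
  have e : localRep F q₀ (S - S' : ContMDiffSection 𝓘(ℝ, EN) F ∞ V) =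
      localRep F q₀ S - localRep F q₀ S' :=
    funext fun x ↦ map_sub (fibreCoord F V q₀ x) (S x) (S' x)
  rw [e]
  exact this

end GLBundle

namespace HigherAlgebroid

open GLBundle

variable {E R M : Type*} [NormedAddCommGroup E] [NormedSpace ℝ E] [NormedAddCommGroup R]
  [NormedSpace ℝ R] [TopologicalSpace M] [ChartedSpace E M] [IsManifold 𝓘(ℝ, E) ∞ M]
  {A : M → Type*} [∀ x, AddCommGroup (A x)] [∀ x, Module ℝ (A x)] [∀ x, TopologicalSpace (A x)]
  [TopologicalSpace (TotalSpace R A)] [FiberBundle R A] [VectorBundle ℝ R A]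
  [ContMDiffVectorBundle ∞ R A 𝓘(ℝ, E)]

namespace AlmostLieAlgebroid

variable (𝓐 : AlmostLieAlgebroid E R A)

/-! ### Structure functions of an almost Lie algebroid -/

/-- The bracket with a fixed section. -/
def bracketLeft (X : ContMDiffSection 𝓘(ℝ, E) R ∞ A) :
    ContMDiffSection 𝓘(ℝ, E) R ∞ A →ₗ[ℝ] ContMDiffSection 𝓘(ℝ, E) R ∞ A where
  toFun := 𝓐.bracket X
  map_add' := 𝓐.bracket_add X
  map_smul' t Y := 𝓐.bracket_smul t X Y

theorem bracket_sub (X Y Y' : ContMDiffSection 𝓘(ℝ, E) R ∞ A) :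
    𝓐.bracket X (Y - Y') = 𝓐.bracket X Y - 𝓐.bracket X Y' :=
  map_sub (𝓐.bracketLeft X) Y Y'

variable [FiniteDimensional ℝ E] [FiniteDimensional ℝ R] [T2Space M]

/-- At a zero of the section `Y`, the bracket `[X, Y]` is the derivative of `Y` along the
anchor of `X`: this follows by expanding `Y` in a local frame. -/
theorem localRep_bracket_of_eq_zero {p x : M} (hx : x ∈ chartDomain E R A p)
    (X Y : ContMDiffSection 𝓘(ℝ, E) R ∞ A) (hY : Y x = 0) :
    localRep R p (𝓐.bracket X Y) x = localDeriv E R p Y x (𝓐.anchor x (X x)) := by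
  obtain ⟨χ, h1, h2, h3⟩ := exists_cutoff (EN := E) (eventually_mem_chartDomain hx)
  let b := Module.finBasis ℝ R
  -- the cut-off frame `e i` and the cut-off coefficients `f i`; `∑ i, f i • e i = χ ^ 2 • Y`
  let e : Fin (Module.finrank ℝ R) → ContMDiffSection 𝓘(ℝ, E) R ∞ A := fun i ↦
    ⟨_, contMDiff_cutoff_section h1 h2 (contMDiffOn_const (c := b i))⟩
  let l : Fin (Module.finrank ℝ R) → R →L[ℝ] ℝ := fun i ↦ (b.coord i).toContinuousLinearMap
  let f : Fin (Module.finrank ℝ R) → M → ℝ := fun i y ↦ χ y • l i (localRep R p Y y)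
  have hf : ∀ i, ContMDiff 𝓘(ℝ, E) 𝓘(ℝ, ℝ) ∞ (f i) := by
    intro i
    have hl : ContMDiffOn 𝓘(ℝ, E) 𝓘(ℝ, ℝ) ∞ (fun y ↦ l i (localRep R p Y y))
        (chartDomain E R A p) :=
      (l i).contMDiff.comp_contMDiffOn ((contMDiffOn_localRep p Y).mono inter_subset_right)
    refine contMDiff_of_tsupport fun y hy ↦ ?_
    have hy' := h2 (closure_mono (Function.support_smul_subset_left χ _) hy)
    exact h1.contMDiffAt.smul (hl.contMDiffAt ((isOpen_chartDomain p).mem_nhds hy'))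
  have hχ0 : ∀ y, y ∉ chartDomain E R A p → χ y = 0 := fun y hy ↦
    image_eq_zero_of_notMem_tsupport fun h ↦ hy (h2 h)
  let Y₂ : ContMDiffSection 𝓘(ℝ, E) R ∞ A :=
    ⟨fun y ↦ (χ y * χ y) • Y y, (h1.mul h1).smul_section Y.contMDiff⟩
  have hfe : ∀ i, ContMDiff 𝓘(ℝ, E) (𝓘(ℝ, E).prod 𝓘(ℝ, R)) ∞
      (fun y ↦ (⟨y, f i y • e i y⟩ : TotalSpace R A)) := fun i ↦
    (hf i).smul_section (e i).contMDiff
  let g : Fin (Module.finrank ℝ R) → ContMDiffSection 𝓘(ℝ, E) R ∞ A := fun i ↦ ⟨_, hfe i⟩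
  have hsum : ∀ (s : Fin (Module.finrank ℝ R) → ContMDiffSection 𝓘(ℝ, E) R ∞ A) (y : M),
      (∑ i, s i : ContMDiffSection 𝓘(ℝ, E) R ∞ A) y = ∑ i, s i y := by
    intro s y
    have := map_sum (ContMDiffSection.coeAddHom 𝓘(ℝ, E) R ∞ A) s Finset.univ
    exact (congrFun this y).trans (Finset.sum_apply _ _ _)
  have hY₂ : Y₂ = ∑ i, g i := by
    ext y
    rw [hsum]
    change (χ y * χ y) • Y y = ∑ i, (χ y • l i (localRep R p Y y)) • χ y • fibreVec R A p y (b i)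
    by_cases hy : y ∈ chartDomain E R A p
    · have h4 : ∑ i, l i (localRep R p Y y) • b i = localRep R p Y y := b.sum_repr _
      have h5 := congrArg (fibreVec R A p y) h4
      rw [localRep, fibreVec_fibreCoord hy, map_sum] at h5
      rw [← h5, Finset.smul_sum]
      refine Finset.sum_congr rfl fun i _ ↦ ?_
      rw [map_smul, smul_smul, smul_smul, smul_eq_mul]
      congr 1
      change χ y * χ y * l i (localRep R p Y y) = _
      ring
    · simp [hχ0 y hy]
  have hχ1 : χ x = 1 := h3.self_of_nhds
  -- the derivative of `χ ^ 2` does not contribute, as `Y x = 0`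
  have e1 : 𝓐.bracket X Y₂ x = 𝓐.bracket X Y x := by
    have := 𝓐.leibniz X Y Y₂ _ (h1.mul h1) (fun _ ↦ rfl) x
    rw [this, hY, smul_zero, add_zero]
    change (χ x * χ x) • _ = _
    rw [hχ1, one_mul, one_smul]
  have hrep : localRep R p Y x = 0 := by rw [localRep, hY, map_zero]
  have e2 : ∀ i, 𝓐.bracket X (g i) x = l i (localDeriv E R p Y x (𝓐.anchor x (X x))) •
      fibreVec R A p x (b i) := by
    intro i
    have := 𝓐.leibniz X (e i) (g i) (f i) (hf i) (fun _ ↦ rfl) x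
    have hfx : f i x = 0 := by
      change χ x • l i (localRep R p Y x) = 0
      rw [hrep, map_zero, smul_zero]
    have hd : dirDeriv (f i) (𝓐.anchor x (X x)) =
        l i (localDeriv E R p Y x (𝓐.anchor x (X x))) := by
      have h6 := ((l i).hasMFDerivAt (x := localRep R p Y x)).comp x (hasMFDerivAt_localRep Y hx)
      have h7 := h6.congr_of_eventuallyEq (f₁ := f i) (by
        filter_upwards [h3] with y hy
        change χ y • _ = _
        rw [hy, Pi.one_apply, one_smul]
        rfl)
      rw [dirDeriv, h7.mfderiv]
      rfl
    rw [this, hfx, zero_smul, zero_add, hd]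
    congr 1
    change χ x • fibreVec R A p x (b i) = _
    rw [hχ1, one_smul]
  have e3 : 𝓐.bracket X Y₂ x = ∑ i, 𝓐.bracket X (g i) x := by
    rw [hY₂, ← hsum]
    exact congrArg (fun s : ContMDiffSection 𝓘(ℝ, E) R ∞ A ↦ s x)
      (map_sum (𝓐.bracketLeft X) g Finset.univ)
  rw [localRep, ← e1, e3, map_sum, ← b.sum_repr (localDeriv E R p Y x (𝓐.anchor x (X x)))]
  refine Finset.sum_congr rfl fun i _ ↦ ?_
  rw [e2 i, map_smul, fibreCoord_fibreVec hx]
  rfl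

/-- The part of the bracket which does not involve derivatives of the representatives in the
trivialization around `p`; its value at `x` depends only on those of `X` and `Y` at `x`. -/
def bracketTensor (p : M) (X Y : ContMDiffSection 𝓘(ℝ, E) R ∞ A) (x : M) : R :=
  localRep R p (𝓐.bracket X Y) x - localDeriv E R p Y x (𝓐.anchor x (X x)) +
    localDeriv E R p X x (𝓐.anchor x (Y x))

theorem bracketTensor_skew (p : M) (X Y : ContMDiffSection 𝓘(ℝ, E) R ∞ A) (x : M) :
    𝓐.bracketTensor p X Y x = -𝓐.bracketTensor p Y X x := by
  have h : localRep R p (𝓐.bracket X Y) x = -localRep R p (𝓐.bracket Y X) x := by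
    rw [𝓐.bracket_skew X Y]
    exact map_neg (fibreCoord R A p x) _
  rw [bracketTensor, bracketTensor, h]
  abel

theorem bracketTensor_congr_right {p x : M} (hx : x ∈ chartDomain E R A p)
    {X Y Y' : ContMDiffSection 𝓘(ℝ, E) R ∞ A} (h : Y x = Y' x) :
    𝓐.bracketTensor p X Y x = 𝓐.bracketTensor p X Y' x := by
  have h0 : (Y - Y' : ContMDiffSection 𝓘(ℝ, E) R ∞ A) x = 0 := sub_eq_zero.2 h
  have h1 := 𝓐.localRep_bracket_of_eq_zero hx X (Y - Y') h0
  rw [bracket_sub, localDeriv_sub hx] at h1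
  have h2 : localRep R p (𝓐.bracket X Y - 𝓐.bracket X Y' : ContMDiffSection 𝓘(ℝ, E) R ∞ A) x =
      localRep R p (𝓐.bracket X Y) x - localRep R p (𝓐.bracket X Y') x :=
    map_sub (fibreCoord R A p x) _ _
  rw [h2, sub_apply] at h1
  rw [bracketTensor, bracketTensor, h, sub_eq_sub_iff_sub_eq_sub.1 h1]

theorem bracketTensor_congr {p x : M} (hx : x ∈ chartDomain E R A p)
    {X X' Y Y' : ContMDiffSection 𝓘(ℝ, E) R ∞ A} (hX : X x = X' x) (hY : Y x = Y' x) :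
    𝓐.bracketTensor p X Y x = 𝓐.bracketTensor p X' Y' x := by
  rw [𝓐.bracketTensor_congr_right hx hY, bracketTensor_skew, 𝓐.bracketTensor_congr_right hx hX,
    ← bracketTensor_skew]

/-- The bracket of the sections `L r` and `L s` at `x`, in the trivialization around `p`. -/
def bracketOf (L : R →ₗ[ℝ] ContMDiffSection 𝓘(ℝ, E) R ∞ A) (p x : M) : R →L[ℝ] R →L[ℝ] R :=
  LinearMap.toContinuousLinearMap
    ((LinearMap.toContinuousLinearMap : (R →ₗ[ℝ] R) ≃ₗ[ℝ] R →L[ℝ] R).toLinearMap ∘ₗ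
      LinearMap.mk₂ ℝ (fun r s ↦ localRep R p (𝓐.bracket (L r) (L s)) x)
        (fun r r' s ↦ by
          rw [𝓐.bracket_skew, map_add, 𝓐.bracket_add, neg_add, ← 𝓐.bracket_skew,
            ← 𝓐.bracket_skew]
          exact map_add (fibreCoord R A p x) _ _)
        (fun t r s ↦ by
          rw [𝓐.bracket_skew, map_smul, 𝓐.bracket_smul, ← smul_neg, ← 𝓐.bracket_skew]
          exact map_smul (fibreCoord R A p x) t _)
        (fun r s s' ↦ by
          rw [map_add, 𝓐.bracket_add]
          exact map_add (fibreCoord R A p x) _ _)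
        (fun t r s ↦ by
          rw [map_smul, 𝓐.bracket_smul]
          exact map_smul (fibreCoord R A p x) t _))

open Classical in
/-- The structure functions of the bracket in the trivialization around `p`: the brackets at `x` of
sections which are constant near `x`. They are `0` outside of the chart domain. -/
def structFun (p x : M) : R →L[ℝ] R →L[ℝ] R :=
  if h : x ∈ chartDomain E R A p then 𝓐.bracketOf (exists_constant_sections h).choose p x else 0

theorem structFun_apply {p x : M} (hx : x ∈ chartDomain E R A p)
    (X Y : ContMDiffSection 𝓘(ℝ, E) R ∞ A) :
    𝓐.structFun p x (localRep R p X x) (localRep R p Y x) = 𝓐.bracketTensor p X Y x := by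
  have hL := (exists_constant_sections hx).choose_spec
  set L := (exists_constant_sections hx).choose with hL'
  have key : ∀ Z : ContMDiffSection 𝓘(ℝ, E) R ∞ A, L (localRep R p Z x) x = Z x := by
    intro Z
    rw [← fibreVec_fibreCoord hx (L (localRep R p Z x) x), ← fibreVec_fibreCoord hx (Z x)]
    exact congrArg _ (hL _).self_of_nhds
  rw [← 𝓐.bracketTensor_congr hx (key X) (key Y), bracketTensor,
    localDeriv_of_eventuallyEq_const (hL _), localDeriv_of_eventuallyEq_const (hL _), structFun,
    dif_pos hx, zero_apply, zero_apply, sub_zero, add_zero]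
  rfl

/-- The bracket of sections of `A` in the trivialization around `p`. -/
theorem localRep_bracket {p x : M} (hx : x ∈ chartDomain E R A p)
    (X Y : ContMDiffSection 𝓘(ℝ, E) R ∞ A) :
    localRep R p (𝓐.bracket X Y) x =
      localDeriv E R p Y x (𝓐.anchor x (X x)) - localDeriv E R p X x (𝓐.anchor x (Y x)) +
        𝓐.structFun p x (localRep R p X x) (localRep R p Y x) := by
  rw [𝓐.structFun_apply hx, bracketTensor]
  abel

theorem structFun_skew {p x : M} (hx : x ∈ chartDomain E R A p) (r s : R) :
    𝓐.structFun p x r s = -𝓐.structFun p x s r := by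
  obtain ⟨L, hL⟩ := exists_constant_sections (EN := E) (F := R) (V := A) hx
  have h : ∀ y, localRep R p (L y) x = y := fun y ↦ (hL y).self_of_nhds
  rw [← h r, ← h s, 𝓐.structFun_apply hx, 𝓐.structFun_apply hx, bracketTensor_skew]

theorem contMDiffOn_structFun (p : M) :
    ContMDiffOn 𝓘(ℝ, E) 𝓘(ℝ, R →L[ℝ] R →L[ℝ] R) ∞ (𝓐.structFun p) (chartDomain E R A p) := by
  refine contMDiffOn_clm fun r ↦ contMDiffOn_clm fun s ↦ fun x hx ↦ ?_
  obtain ⟨L, hL⟩ := exists_constant_sections (EN := E) (F := R) (V := A) hx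
  have h1 := ((contMDiffOn_localRep p (𝓐.bracket (L r) (L s))).contMDiffAt
    ((trivializationAt R A p).open_baseSet.mem_nhds hx.2))
  refine (h1.congr_of_eventuallyEq ?_).contMDiffWithinAt
  filter_upwards [(hL r).eventuallyEq_nhds, (hL s).eventuallyEq_nhds,
    eventually_mem_chartDomain hx] with y hr hs hy
  rw [𝓐.localRep_bracket hy, localDeriv_of_eventuallyEq_const hr,
    localDeriv_of_eventuallyEq_const hs, hr.self_of_nhds, hs.self_of_nhds, zero_apply, zero_apply,
    sub_zero, zero_add]

end AlmostLieAlgebroid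
end HigherAlgebroid

namespace GLBundle

open HigherAlgebroid

variable {EN N : Type*} [NormedAddCommGroup EN] [NormedSpace ℝ EN]
  [TopologicalSpace N] [ChartedSpace EN N] [IsManifold 𝓘(ℝ, EN) ∞ N]

/-! ### The Lie bracket of vector fields in coordinates -/

theorem minSmoothness_two_le : minSmoothness ℝ 2 ≤ ∞ := by
  rw [minSmoothness_of_isRCLikeNormedField]
  exact WithTop.coe_le_coe.2 (le_top : (2 : ℕ∞) ≤ ⊤)

theorem isManifold_minSmoothness_two : IsManifold 𝓘(ℝ, EN) (minSmoothness ℝ 2) N :=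
  IsManifold.of_le minSmoothness_two_le

theorem mem_chartDomain_tangent {q₀ q : N} (h : q ∈ (chartAt EN q₀).source) :
    q ∈ chartDomain EN EN (TangentSpace 𝓘(ℝ, EN) : N → Type _) q₀ := ⟨h, h⟩

theorem mfderiv_extChartAt_symm_inverse {q₀ : N} {z : EN} (hz : z ∈ (extChartAt 𝓘(ℝ, EN) q₀).target) :
    (mfderiv 𝓘(ℝ, EN) 𝓘(ℝ, EN) (extChartAt 𝓘(ℝ, EN) q₀).symm z).inverse =
      baseCoord EN q₀ ((extChartAt 𝓘(ℝ, EN) q₀).symm z) := by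
  have hq : (extChartAt 𝓘(ℝ, EN) q₀).symm z ∈ (chartAt EN q₀).source := by
    rw [← extChartAt_source 𝓘(ℝ, EN)]
    exact (extChartAt 𝓘(ℝ, EN) q₀).map_target hz
  have hf : MDifferentiableAt 𝓘(ℝ, EN) 𝓘(ℝ, EN) (extChartAt 𝓘(ℝ, EN) q₀).symm z :=
    ((contMDiffOn_extChartAt_symm (I := 𝓘(ℝ, EN)) (n := ∞) q₀).contMDiffAt
      ((isOpen_extChartAt_target q₀).mem_nhds hz)).mdifferentiableAt (by simp)
  have h1 := (hasMFDerivAt_extChartAt_base hq).comp z hf.hasMFDerivAt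
  have h2 := (hasMFDerivAt_id (I := 𝓘(ℝ, EN)) z).congr_of_eventuallyEq (f₁ :=
    extChartAt 𝓘(ℝ, EN) q₀ ∘ (extChartAt 𝓘(ℝ, EN) q₀).symm) (by
      filter_upwards [(isOpen_extChartAt_target (I := 𝓘(ℝ, EN)) q₀).mem_nhds hz] with y hy
      exact (extChartAt 𝓘(ℝ, EN) q₀).right_inv hy)
  have h3 := hasMFDerivAt_unique h1 h2
  refine ContinuousLinearMap.inverse_eq ?_ h3
  refine ContinuousLinearMap.ext fun v ↦ baseCoord_injective hq ?_
  exact congrArg (fun L ↦ L (baseCoord EN q₀ _ v)) h3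

/-- The Lie bracket of vector fields in the chart around `q₀`. -/
theorem baseCoord_mlieBracket [CompleteSpace EN] {q₀ q : N} (h : q ∈ (chartAt EN q₀).source)
    (X Y : ContMDiffSection 𝓘(ℝ, EN) EN ∞ (TangentSpace 𝓘(ℝ, EN) : N → Type _)) :
    baseCoord EN q₀ q (VectorField.mlieBracket 𝓘(ℝ, EN) X Y q) =
      localDeriv EN EN q₀ Y q (X q) - localDeriv EN EN q₀ X q (Y q) := by
  have h' : q ∈ (extChartAt 𝓘(ℝ, EN) q₀).source := by rwa [extChartAt_source]
  have hz := (extChartAt 𝓘(ℝ, EN) q₀).map_source h'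
  have hq := (extChartAt 𝓘(ℝ, EN) q₀).left_inv h'
  set f := (extChartAt 𝓘(ℝ, EN) q₀).symm with hf
  set z := extChartAt 𝓘(ℝ, EN) q₀ q with hz'
  -- the pull-back of a vector field by the inverse of the chart is its coordinate representative
  have hp : ∀ W : ContMDiffSection 𝓘(ℝ, EN) EN ∞ (TangentSpace 𝓘(ℝ, EN) : N → Type _),
      VectorField.mpullback 𝓘(ℝ, EN) 𝓘(ℝ, EN) f W =ᶠ[𝓝 z] localRep EN q₀ W ∘ f := by
    intro W
    filter_upwards [(isOpen_extChartAt_target (I := 𝓘(ℝ, EN)) q₀).mem_nhds hz] with y hy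
    rw [VectorField.mpullback_apply, mfderiv_extChartAt_symm_inverse hy]
    rfl
  have hd : ∀ W : ContMDiffSection 𝓘(ℝ, EN) EN ∞ (TangentSpace 𝓘(ℝ, EN) : N → Type _),
      ∀ v : TangentSpace 𝓘(ℝ, EN) q, fderiv ℝ (localRep EN q₀ W ∘ f) z (baseCoord EN q₀ q v) =
        localDeriv EN EN q₀ W q v := by
    intro W v
    have h1 := hasMFDerivAt_localRep W (mem_chartDomain_tangent h)
    have h2 : MDifferentiableAt 𝓘(ℝ, EN) 𝓘(ℝ, EN) (localRep EN q₀ W ∘ f) z := by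
      have h3 : MDifferentiableAt 𝓘(ℝ, EN) 𝓘(ℝ, EN) f z :=
        ((contMDiffOn_extChartAt_symm (I := 𝓘(ℝ, EN)) (n := ∞) q₀).contMDiffAt
          ((isOpen_extChartAt_target q₀).mem_nhds hz)).mdifferentiableAt (by simp)
      refine MDifferentiableAt.comp z ?_ h3
      rw [hq]
      exact h1.mdifferentiableAt
    have h4 := h2.hasMFDerivAt.comp q (hasMFDerivAt_extChartAt_base h)
    have h5 := h1.congr_of_eventuallyEq (f₁ := (localRep EN q₀ W ∘ f) ∘ extChartAt 𝓘(ℝ, EN) q₀) (by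
      filter_upwards [(isOpen_extChartAt_source (I := 𝓘(ℝ, EN)) q₀).mem_nhds h'] with y hy
      rw [Function.comp_apply, Function.comp_apply, (extChartAt 𝓘(ℝ, EN) q₀).left_inv hy])
    rw [← mfderiv_eq_fderiv]
    exact congrArg (fun L ↦ L v) (hasMFDerivAt_unique h4 h5)
  have : IsManifold 𝓘(ℝ, EN) (minSmoothness ℝ 2) N := isManifold_minSmoothness_two
  have h2 := VectorField.mpullback_mlieBracket (I := 𝓘(ℝ, EN)) (I' := 𝓘(ℝ, EN)) (f := f) (x₀ := z)
    (V := X) (W := Y) (n := ∞) (X.contMDiff.mdifferentiableAt (by simp))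
    (Y.contMDiff.mdifferentiableAt (by simp))
    ((contMDiffOn_extChartAt_symm (I := 𝓘(ℝ, EN)) (n := ∞) q₀).contMDiffAt
          ((isOpen_extChartAt_target q₀).mem_nhds hz)) minSmoothness_two_le
  have h3 : ∀ X' Y' : ∀ x : EN, TangentSpace 𝓘(ℝ, EN) x,
      VectorField.mlieBracket 𝓘(ℝ, EN) X' Y' z = VectorField.lieBracket ℝ X' Y' z := by
    intro X' Y'
    rw [← VectorField.mlieBracketWithin_univ, VectorField.mlieBracketWithin_eq_lieBracketWithin]
    exact congrFun (VectorField.lieBracketWithin_univ (𝕜 := ℝ) (E := EN)) z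
  rw [VectorField.mpullback_apply, mfderiv_extChartAt_symm_inverse hz,
    Filter.EventuallyEq.mlieBracket_vectorField_eq (hp X) (hp Y)] at h2
  have h4 : baseCoord EN q₀ (f z) (VectorField.mlieBracket 𝓘(ℝ, EN) X Y (f z)) =
      fderiv ℝ (localRep EN q₀ Y ∘ f) z (localRep EN q₀ X (f z)) -
        fderiv ℝ (localRep EN q₀ X ∘ f) z (localRep EN q₀ Y (f z)) := h2.trans (h3 _ _)
  rw [hq] at h4
  rw [h4, ← hd, ← hd]
  rfl

end GLBundle

namespace HigherAlgebroid

open GLBundle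

variable {E R M : Type*} [NormedAddCommGroup E] [NormedSpace ℝ E] [NormedAddCommGroup R]
  [NormedSpace ℝ R] [TopologicalSpace M] [ChartedSpace E M] [IsManifold 𝓘(ℝ, E) ∞ M]
  {A : M → Type*} [∀ x, AddCommGroup (A x)] [∀ x, Module ℝ (A x)] [∀ x, TopologicalSpace (A x)]
  [TopologicalSpace (TotalSpace R A)] [FiberBundle R A] [VectorBundle ℝ R A]
  [ContMDiffVectorBundle ∞ R A 𝓘(ℝ, E)]

namespace AnchoredBundle

variable (𝓐 : AnchoredBundle E R A) [FiniteDimensional ℝ E] [FiniteDimensional ℝ R]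

/-! ### Sections of the prolongation in coordinates -/

theorem mem_chartDomain_prolongation {n : ℕ} {q₀ q : 𝓐.HigherBundle n} :
    q ∈ chartDomain (E × (Fin n → R)) (R × (Fin n → R)) (𝓐.Prolongation n) q₀ ↔
      q.base ∈ chartDomain E R A q₀.base :=
  ⟨fun h ↦ h.1, fun h ↦ ⟨h, h⟩⟩

theorem fibreCoord_prolongation {n : ℕ} {q₀ q : 𝓐.HigherBundle n}
    (h : q.base ∈ chartDomain E R A q₀.base) :
    fibreCoord (R × (Fin n → R)) (𝓐.Prolongation n) q₀ q = 𝓐.prCoord q₀ q :=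
  ContinuousLinearMap.ext fun v ↦ Trivialization.continuousLinearMapAt_apply_of_mem ℝ _
    (𝓐.mem_chartDomain_prolongation.2 h).2 v

theorem fibreVec_prolongation {n : ℕ} {q₀ q : 𝓐.HigherBundle n}
    (h : q.base ∈ chartDomain E R A q₀.base) (z : R × (Fin n → R)) :
    fibreVec (R × (Fin n → R)) (𝓐.Prolongation n) q₀ q z = 𝓐.prSymm q₀ q z := by
  rw [← fibreVec_fibreCoord (𝓐.mem_chartDomain_prolongation.2 h) (𝓐.prSymm q₀ q z),
    𝓐.fibreCoord_prolongation h, 𝓐.prCoord_prSymm h]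

/-- The map `(Y, Z) ↦ Z` in coordinates: the component of `Z` along `M` is the anchor of `Y`. -/
theorem anchorRep_prSnd {n : ℕ} {q₀ q : 𝓐.HigherBundle n}
    (h : q.base ∈ chartDomain E R A q₀.base) :
    anchorRep (F := R × (Fin n → R)) (E × (Fin n → R)) 𝓐.prSnd q₀ q =
      ((𝓐.localAnchorMap q₀.base q.base).comp (ContinuousLinearMap.fst ℝ R (Fin n → R))).prod
        (ContinuousLinearMap.snd ℝ R (Fin n → R)) := by
  refine ContinuousLinearMap.ext fun z ↦ ?_
  change baseCoord _ q₀ q (𝓐.prSnd q (fibreVec _ _ q₀ q z)) = _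
  rw [𝓐.fibreVec_prolongation h, 𝓐.prSnd_prSymm h]
  exact baseCoord_baseVec (EN := E × (Fin n → R)) (q₀ := q₀) (q := q) h _

theorem baseCoord_prSnd {n : ℕ} {q₀ q : 𝓐.HigherBundle n}
    (h : q.base ∈ chartDomain E R A q₀.base) (v : 𝓐.Prolongation n q) :
    baseCoord (E × (Fin n → R)) q₀ q (𝓐.prSnd q v) =
      (𝓐.localAnchorMap q₀.base q.base (𝓐.prCoord q₀ q v).1, (𝓐.prCoord q₀ q v).2) := by
  have := congrArg (fun L ↦ L (𝓐.prCoord q₀ q v)) (𝓐.anchorRep_prSnd h)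
  change baseCoord _ q₀ q (𝓐.prSnd q (fibreVec _ _ q₀ q (𝓐.prCoord q₀ q v))) = _ at this
  rwa [𝓐.fibreVec_prolongation h, 𝓐.prSymm_prCoord h] at this

theorem contMDiffOn_localAnchorMap_base (n : ℕ) (q₀ : 𝓐.HigherBundle n) :
    ContMDiffOn 𝓘(ℝ, E × (Fin n → R)) 𝓘(ℝ, R →L[ℝ] E) ∞
      (fun q : 𝓐.HigherBundle n ↦ 𝓐.localAnchorMap q₀.base q.base)
      (chartDomain (E × (Fin n → R)) (R × (Fin n → R)) (𝓐.Prolongation n) q₀) :=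
  (𝓐.contMDiffOn_localAnchorMap q₀.base).comp (𝓐.contMDiff_base n).contMDiffOn
    fun _ h ↦ 𝓐.mem_chartDomain_prolongation.1 h

/-- The second component of a smooth section of the prolongation is a smooth vector field. -/
theorem contMDiff_prSnd {n : ℕ}
    (S : ContMDiffSection 𝓘(ℝ, E × (Fin n → R)) (R × (Fin n → R)) ∞ (𝓐.Prolongation n)) :
    ContMDiff 𝓘(ℝ, E × (Fin n → R)) (𝓘(ℝ, E × (Fin n → R)).prod 𝓘(ℝ, E × (Fin n → R))) ∞
      (fun q ↦ (⟨q, 𝓐.prSnd q (S q)⟩ :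
        TotalSpace (E × (Fin n → R)) (TangentSpace 𝓘(ℝ, E × (Fin n → R)) :
          𝓐.HigherBundle n → Type _))) := by
  intro q₀
  have h0 := mem_chartDomain_self (E := E × (Fin n → R)) (R := R × (Fin n → R))
    (A := 𝓐.Prolongation n) q₀
  refine (((trivializationAt (E × (Fin n → R)) (TangentSpace 𝓘(ℝ, E × (Fin n → R)) :
          𝓐.HigherBundle n → Type _) q₀).contMDiffOn_section_iff
    (IB := 𝓘(ℝ, E × (Fin n → R))) (n := ∞)
    (isOpen_chartDomain (E := E × (Fin n → R)) (R := R × (Fin n → R))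
      (A := 𝓐.Prolongation n) q₀) inter_subset_left).2 ?_).contMDiffAt
      ((isOpen_chartDomain q₀).mem_nhds h0)
  have h1 := (contMDiffOn_localRep q₀ S).mono (t := chartDomain (E × (Fin n → R))
    (R × (Fin n → R)) (𝓐.Prolongation n) q₀) inter_subset_right
  have h2 := (𝓐.contMDiffOn_localAnchorMap_base n q₀).clm_apply
    ((ContinuousLinearMap.fst ℝ R (Fin n → R)).contMDiff.comp_contMDiffOn h1)
  refine (h2.prodMk_space ((ContinuousLinearMap.snd ℝ R (Fin n → R)).contMDiff.comp_contMDiffOn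
    h1)).congr fun q hq ↦ ?_
  have hq' := 𝓐.mem_chartDomain_prolongation.1 hq
  refine (Trivialization.continuousLinearMapAt_apply_of_mem ℝ (trivializationAt (E × (Fin n → R))
    (TangentSpace 𝓘(ℝ, E × (Fin n → R)) : 𝓐.HigherBundle n → Type _) q₀)
      (show q ∈ _ from hq.1) _).symm.trans ?_
  refine (𝓐.baseCoord_prSnd hq' (S q)).trans ?_
  rw [← 𝓐.fibreCoord_prolongation hq']
  rfl

/-- A section of the prolongation is smooth if both of its components are smooth, the first of them
being defined by a section of `A`. -/
theorem contMDiff_of_components {n : ℕ} {S : ∀ q, 𝓐.Prolongation n q}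
    {X : ContMDiffSection 𝓘(ℝ, E) R ∞ A} (hX : ∀ q, 𝓐.prFst q (S q) = X q.base)
    (hS : ContMDiff 𝓘(ℝ, E × (Fin n → R)) (𝓘(ℝ, E × (Fin n → R)).prod 𝓘(ℝ, E × (Fin n → R))) ∞
      (fun q ↦ (⟨q, 𝓐.prSnd q (S q)⟩ :
        TotalSpace (E × (Fin n → R)) (TangentSpace 𝓘(ℝ, E × (Fin n → R)) :
          𝓐.HigherBundle n → Type _)))) :
    ContMDiff 𝓘(ℝ, E × (Fin n → R)) (𝓘(ℝ, E × (Fin n → R)).prod 𝓘(ℝ, R × (Fin n → R))) ∞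
      (fun q ↦ (⟨q, S q⟩ : TotalSpace (R × (Fin n → R)) (𝓐.Prolongation n))) := by
  intro q₀
  have h0 := mem_chartDomain_self (E := E × (Fin n → R)) (R := R × (Fin n → R))
    (A := 𝓐.Prolongation n) q₀
  refine (((trivializationAt (R × (Fin n → R)) (𝓐.Prolongation n) q₀).contMDiffOn_section_iff
    (IB := 𝓘(ℝ, E × (Fin n → R))) (n := ∞)
    (isOpen_chartDomain (E := E × (Fin n → R)) q₀) inter_subset_right).2 ?_).contMDiffAt
      ((isOpen_chartDomain q₀).mem_nhds h0)
  have h1 := ((contMDiffOn_localRep q₀.base X).comp (𝓐.contMDiff_base n).contMDiffOn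
    (s := chartDomain (E × (Fin n → R)) (R × (Fin n → R)) (𝓐.Prolongation n) q₀)
    fun q hq ↦ (𝓐.mem_chartDomain_prolongation.1 hq).2)
  have h2 := (contMDiffOn_localRep q₀ (⟨_, hS⟩ : ContMDiffSection 𝓘(ℝ, E × (Fin n → R))
    (E × (Fin n → R)) ∞ (TangentSpace 𝓘(ℝ, E × (Fin n → R)) : 𝓐.HigherBundle n → Type _))).mono
      (t := chartDomain (E × (Fin n → R)) (R × (Fin n → R)) (𝓐.Prolongation n) q₀)
      inter_subset_left
  refine (h1.prodMk_space ((ContinuousLinearMap.snd ℝ E (Fin n → R)).contMDiff.comp_contMDiffOn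
    h2)).congr fun q hq ↦ ?_
  rw [← localRep_eq S hq.2]
  change fibreCoord _ _ q₀ q (S q) = _
  rw [𝓐.fibreCoord_prolongation (𝓐.mem_chartDomain_prolongation.1 hq)]
  refine Prod.ext ?_ rfl
  exact congrArg (fibreCoord R A q₀.base q.base) (hX q)

end AnchoredBundle
end HigherAlgebroid

namespace GLBundle

open HigherAlgebroid

variable {EN N : Type*} [NormedAddCommGroup EN] [NormedSpace ℝ EN]
  [TopologicalSpace N] [ChartedSpace EN N] [IsManifold 𝓘(ℝ, EN) ∞ N]

/-- The Lie bracket of smooth vector fields, as a smooth vector field. -/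
def lieSection [CompleteSpace EN]
    (X Y : ContMDiffSection 𝓘(ℝ, EN) EN ∞ (TangentSpace 𝓘(ℝ, EN) : N → Type _)) :
    ContMDiffSection 𝓘(ℝ, EN) EN ∞ (TangentSpace 𝓘(ℝ, EN) : N → Type _) :=
  ⟨VectorField.mlieBracket 𝓘(ℝ, EN) X Y, fun q ↦
    have : IsManifold 𝓘(ℝ, EN) (minSmoothness ℝ 2) N := isManifold_minSmoothness_two
    have : IsManifold 𝓘(ℝ, EN) ((⊤ : ℕ∞) + 1) N := inferInstanceAs (IsManifold 𝓘(ℝ, EN) ∞ N)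
    ContMDiffAt.mlieBracket_vectorField (m := ⊤) (n := ⊤) X.contMDiff.contMDiffAt
      Y.contMDiff.contMDiffAt (by rw [minSmoothness_of_isRCLikeNormedField]; exact le_rfl)⟩

end GLBundle

namespace HigherAlgebroid

open GLBundle

variable {E R M : Type*} [NormedAddCommGroup E] [NormedSpace ℝ E] [NormedAddCommGroup R]
  [NormedSpace ℝ R] [TopologicalSpace M] [ChartedSpace E M] [IsManifold 𝓘(ℝ, E) ∞ M]
  {A : M → Type*} [∀ x, AddCommGroup (A x)] [∀ x, Module ℝ (A x)] [∀ x, TopologicalSpace (A x)]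
  [TopologicalSpace (TotalSpace R A)] [FiberBundle R A] [VectorBundle ℝ R A]
  [ContMDiffVectorBundle ∞ R A 𝓘(ℝ, E)]

namespace AnchoredBundle

variable (𝓐 : AnchoredBundle E R A)

/-- The vector field `ρ ∘ X` on `M` defined by a section `X` of `A`. -/
def anchorSection (X : ContMDiffSection 𝓘(ℝ, E) R ∞ A) :
    ContMDiffSection 𝓘(ℝ, E) E ∞ (TangentSpace 𝓘(ℝ, E) : M → Type _) :=
  ⟨fun x ↦ 𝓐.anchor x (X x), 𝓐.contMDiff_anchor.comp X.contMDiff⟩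

variable [FiniteDimensional ℝ E] [FiniteDimensional ℝ R]

/-- The vector field on `A^n` defined by a section of the prolongation. -/
def prSndSection {n : ℕ}
    (S : ContMDiffSection 𝓘(ℝ, E × (Fin n → R)) (R × (Fin n → R)) ∞ (𝓐.Prolongation n)) :
    ContMDiffSection 𝓘(ℝ, E × (Fin n → R)) (E × (Fin n → R)) ∞
      (TangentSpace 𝓘(ℝ, E × (Fin n → R)) : 𝓐.HigherBundle n → Type _) :=
  ⟨fun q ↦ 𝓐.prSnd q (S q), 𝓐.contMDiff_prSnd S⟩

variable {𝓐} {n : ℕ}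

theorem eventually_base_mem {q₀ q : 𝓐.HigherBundle n} (h : q.base ∈ chartDomain E R A q₀.base) :
    ∀ᶠ q' : 𝓐.HigherBundle n in 𝓝 q, q'.base ∈ chartDomain E R A q₀.base :=
  (𝓐.isOpen_base_preimage n q₀.base).mem_nhds h

theorem hasMFDerivAt_base (q : 𝓐.HigherBundle n) :
    HasMFDerivAt 𝓘(ℝ, E × (Fin n → R)) 𝓘(ℝ, E) (HigherBundle.base : 𝓐.HigherBundle n → M) q
      (mfderiv 𝓘(ℝ, E × (Fin n → R)) 𝓘(ℝ, E) (HigherBundle.base : 𝓐.HigherBundle n → M) q) :=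
  ((𝓐.contMDiff_base n).mdifferentiableAt (by simp)).hasMFDerivAt

section Projectable

variable {S : ContMDiffSection 𝓘(ℝ, E × (Fin n → R)) (R × (Fin n → R)) ∞ (𝓐.Prolongation n)}
  {X : ContMDiffSection 𝓘(ℝ, E) R ∞ A}

/-- The vector field `prSnd ∘ S` projects to `ρ ∘ X`. -/
theorem prSnd_localRep_fst {q₀ q : 𝓐.HigherBundle n} (hS : ∀ q, 𝓐.prFst q (S q) = X q.base)
    (h : q.base ∈ chartDomain E R A q₀.base) :
    (localRep (E × (Fin n → R)) q₀ (𝓐.prSndSection S) q).1 =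
      localRep E q₀.base (𝓐.anchorSection X) q.base := by
  refine (𝓐.mfderiv_base h (𝓐.prSnd q (S q))).symm.trans ?_
  rw [← 𝓐.pr_eq, hS]
  rfl

theorem localRep_projectable {q₀ q : 𝓐.HigherBundle n} (hS : ∀ q, 𝓐.prFst q (S q) = X q.base)
    (h : q.base ∈ chartDomain E R A q₀.base) :
    localRep (R × (Fin n → R)) q₀ S q = (localRep R q₀.base X q.base,
      (localRep (E × (Fin n → R)) q₀ (𝓐.prSndSection S) q).2) := by
  rw [localRep, 𝓐.fibreCoord_prolongation h]
  refine Prod.ext ?_ rfl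
  exact congrArg (fibreCoord R A q₀.base q.base) (hS q)

/-- The vector fields `prSnd ∘ S` and `ρ ∘ X` are related by the projection to `M`; in coordinates
this also holds for their derivatives. -/
theorem localDeriv_prSnd_fst {q₀ q : 𝓐.HigherBundle n} (hS : ∀ q, 𝓐.prFst q (S q) = X q.base)
    (h : q.base ∈ chartDomain E R A q₀.base) (u : TangentSpace 𝓘(ℝ, E × (Fin n → R)) q) :
    (localDeriv (E × (Fin n → R)) (E × (Fin n → R)) q₀ (𝓐.prSndSection S) q u).1 =
      localDeriv E E q₀.base (𝓐.anchorSection X) q.base (mfderiv 𝓘(ℝ, E × (Fin n → R)) 𝓘(ℝ, E)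
        (HigherBundle.base : 𝓐.HigherBundle n → M) q u) := by
  have h1 := ((ContinuousLinearMap.fst ℝ E (Fin n → R)).hasMFDerivAt
    (x := localRep (E × (Fin n → R)) q₀ (𝓐.prSndSection S) q)).comp q
    (hasMFDerivAt_localRep (𝓐.prSndSection S)
      (mem_chartDomain_tangent (EN := E × (Fin n → R)) (q₀ := q₀) (q := q) h))
  have h2 := (hasMFDerivAt_localRep (𝓐.anchorSection X) (mem_chartDomain_tangent h.1)).comp q
    (hasMFDerivAt_base q)
  have h3 := h2.congr_of_eventuallyEq (f₁ := ContinuousLinearMap.fst ℝ E (Fin n → R) ∘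
    localRep (E × (Fin n → R)) q₀ (𝓐.prSndSection S)) (by
      filter_upwards [eventually_base_mem h] with q' hq'
      exact prSnd_localRep_fst hS hq')
  exact congrArg (fun L ↦ L u) (hasMFDerivAt_unique h1 h3)

theorem localDeriv_projectable {q₀ q : 𝓐.HigherBundle n} (hS : ∀ q, 𝓐.prFst q (S q) = X q.base)
    (h : q.base ∈ chartDomain E R A q₀.base) (u : TangentSpace 𝓘(ℝ, E × (Fin n → R)) q) :
    localDeriv (E × (Fin n → R)) (R × (Fin n → R)) q₀ S q u =
      (localDeriv E R q₀.base X q.base (mfderiv 𝓘(ℝ, E × (Fin n → R)) 𝓘(ℝ, E)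
        (HigherBundle.base : 𝓐.HigherBundle n → M) q u),
        (localDeriv (E × (Fin n → R)) (E × (Fin n → R)) q₀ (𝓐.prSndSection S) q u).2) := by
  have h1 := ((ContinuousLinearMap.snd ℝ E (Fin n → R)).hasMFDerivAt
    (x := localRep (E × (Fin n → R)) q₀ (𝓐.prSndSection S) q)).comp q
    (hasMFDerivAt_localRep (𝓐.prSndSection S)
      (mem_chartDomain_tangent (EN := E × (Fin n → R)) (q₀ := q₀) (q := q) h))
  have h2 := (hasMFDerivAt_localRep X h).comp q (hasMFDerivAt_base q)
  have h3 := (hasMFDerivAt_prodMk_space h2 h1).congr_of_eventuallyEq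
    (f₁ := localRep (R × (Fin n → R)) q₀ S) (by
      filter_upwards [eventually_base_mem h] with q' hq'
      exact localRep_projectable hS hq')
  exact congrArg (fun L ↦ L u) (hasMFDerivAt_unique
    (hasMFDerivAt_localRep S (𝓐.mem_chartDomain_prolongation.2 h)) h3)

end Projectable

end AnchoredBundle

namespace AlmostLieAlgebroid

variable (𝓐 : AlmostLieAlgebroid E R A) [FiniteDimensional ℝ E] [FiniteDimensional ℝ R]

/-! ### The bracket of projectable sections -/

section Projectable

variable {𝓐} {n : ℕ}
  {S S' : ContMDiffSection 𝓘(ℝ, E × (Fin n → R)) (R × (Fin n → R)) ∞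
    (𝓐.toAnchoredBundle.Prolongation n)}
  {X X' : ContMDiffSection 𝓘(ℝ, E) R ∞ A}

/-- The pair consisting of the brackets of the components of two projectable sections is again
in the prolongation, the anchor being compatible with the brackets. -/
theorem bracket_mem_prolongationFibre (hS : ∀ q, 𝓐.prFst q (S q) = X q.base)
    (hS' : ∀ q, 𝓐.prFst q (S' q) = X' q.base) (q : 𝓐.HigherBundle n) :
    (𝓐.bracket X X' q.base, VectorField.mlieBracket 𝓘(ℝ, E × (Fin n → R)) (𝓐.prSndSection S)
      (𝓐.prSndSection S') q) ∈ 𝓐.prolongationFibre n q := by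
  have h := mem_chartDomain_self (E := E) (R := R) (A := A) q.base
  change 𝓐.anchor q.base (𝓐.bracket X X' q.base) = mfderiv _ _ _ q _
  refine baseCoord_injective h.1 ?_
  have h1 := baseCoord_mlieBracket h.1 (𝓐.anchorSection X) (𝓐.anchorSection X')
  have h2 := baseCoord_mlieBracket (EN := E × (Fin n → R)) (q₀ := q) (q := q) h
    (𝓐.prSndSection S) (𝓐.prSndSection S')
  have h3 := 𝓐.mfderiv_base h (VectorField.mlieBracket 𝓘(ℝ, E × (Fin n → R)) (𝓐.prSndSection S)
      (𝓐.prSndSection S') q)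
  refine Eq.trans ?_ h3.symm
  refine Eq.trans ?_ (congrArg Prod.fst h2).symm
  rw [𝓐.anchor_bracket]
  refine h1.trans ?_
  rw [Prod.fst_sub, AnchoredBundle.localDeriv_prSnd_fst hS h,
    AnchoredBundle.localDeriv_prSnd_fst hS' h]
  have e : ∀ {S : ContMDiffSection 𝓘(ℝ, E × (Fin n → R)) (R × (Fin n → R)) ∞
      (𝓐.toAnchoredBundle.Prolongation n)} {X : ContMDiffSection 𝓘(ℝ, E) R ∞ A},
      (∀ q, 𝓐.prFst q (S q) = X q.base) → mfderiv 𝓘(ℝ, E × (Fin n → R)) 𝓘(ℝ, E)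
        (AnchoredBundle.HigherBundle.base : 𝓐.HigherBundle n → M) q (𝓐.prSndSection S q) =
          𝓐.anchorSection X q.base := fun hS ↦
    (𝓐.pr_eq _).symm.trans (congrArg _ (hS q))
  rw [e hS, e hS']

/-- The bracket of projectable sections: the pair of the brackets of the components. -/
def projectableBracket (hS : ∀ q, 𝓐.prFst q (S q) = X q.base)
    (hS' : ∀ q, 𝓐.prFst q (S' q) = X' q.base) :
    ContMDiffSection 𝓘(ℝ, E × (Fin n → R)) (R × (Fin n → R)) ∞
      (𝓐.toAnchoredBundle.Prolongation n) :=
  ⟨fun q ↦ 𝓐.prMk _ (bracket_mem_prolongationFibre hS hS' q),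
    𝓐.contMDiff_of_components (X := 𝓐.bracket X X') (fun _ ↦ rfl)
      (lieSection (𝓐.prSndSection S) (𝓐.prSndSection S')).contMDiff⟩

variable [T2Space M]

variable (𝓐) in
/-- The structure functions of the prolongation in the coordinates around `q₀`. Sections with constant
coordinates `(r, v)` consist of a section of `A` with constant coordinates `r` and of the vector
field `ρ r ∂ₓ + v ∂ᵧ`, where `ρ` does not depend on the fibre coordinates; so the bracket of two
of them has only a component in `A`, given by the structure functions of `A`. -/
def prStructFun (q₀ q : 𝓐.HigherBundle n) :
    R × (Fin n → R) →L[ℝ] R × (Fin n → R) →L[ℝ] R × (Fin n → R) :=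
  ((ContinuousLinearMap.inl ℝ R (Fin n → R)).postcomp (R × (Fin n → R))).comp
    ((((𝓐.structFun q₀.base q.base).flip.comp (ContinuousLinearMap.fst ℝ R (Fin n → R))).flip).comp
      (ContinuousLinearMap.fst ℝ R (Fin n → R)))

variable (𝓐) in
theorem prStructFun_apply (q₀ q : 𝓐.HigherBundle n) (z z' : R × (Fin n → R)) :
    𝓐.prStructFun q₀ q z z' = (𝓐.structFun q₀.base q.base z.1 z'.1, 0) := rfl

/-- In coordinates, the bracket of projectable sections is given by `prStructFun`. -/
theorem localRep_projectableBracket (hS : ∀ q, 𝓐.prFst q (S q) = X q.base)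
    (hS' : ∀ q, 𝓐.prFst q (S' q) = X' q.base) {q₀ q : 𝓐.HigherBundle n}
    (h : q.base ∈ chartDomain E R A q₀.base) :
    localRep (R × (Fin n → R)) q₀ (projectableBracket hS hS') q =
      bracketRep 𝓐.prSnd 𝓐.prStructFun q₀ S S' q := by
  have h1 := baseCoord_mlieBracket (EN := E × (Fin n → R)) (q₀ := q₀) (q := q) h
    (𝓐.prSndSection S) (𝓐.prSndSection S')
  rw [AnchoredBundle.localRep_projectable (X := 𝓐.bracket X X') (fun _ ↦ rfl) h, bracketRep,
    prStructFun_apply, AnchoredBundle.localDeriv_projectable hS h,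
    AnchoredBundle.localDeriv_projectable hS' h, AnchoredBundle.localRep_projectable hS h,
    AnchoredBundle.localRep_projectable hS' h, 𝓐.localRep_bracket h, ← 𝓐.pr_eq, ← 𝓐.pr_eq, hS, hS']
  refine Prod.ext rfl ?_
  change (baseCoord (E × (Fin n → R)) q₀ q (VectorField.mlieBracket 𝓘(ℝ, E × (Fin n → R))
    (𝓐.prSndSection S) (𝓐.prSndSection S') q)).2 = _
  rw [h1]
  exact (add_zero _).symm

end Projectable

end AlmostLieAlgebroid
end HigherAlgebroid

namespace HigherAlgebroid

open GLBundle

section Weights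

variable (P : Type*) {R : Type*} [NormedAddCommGroup P] [NormedSpace ℝ P] [NormedAddCommGroup R]
  [NormedSpace ℝ R] {n : ℕ}

/-! ### Homogeneous coordinates on the prolongation -/

/-- The action of `t` on `P × R ^ n` for which `P` has weight `0` and the `j`-th copy of `R` has
weight `j`, the copies being counted from `1`. -/
def weightMap (t : ℝ) : P × (Fin n → R) →L[ℝ] P × (Fin n → R) :=
  (ContinuousLinearMap.fst ℝ P (Fin n → R)).prod
    (ContinuousLinearMap.pi fun j : Fin n ↦ t ^ (j + 1 : ℕ) •
      (ContinuousLinearMap.proj j).comp (ContinuousLinearMap.snd ℝ P (Fin n → R)))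

variable {P}

theorem weightMap_apply (t : ℝ) (z : P × (Fin n → R)) :
    weightMap P t z = (z.1, fun j : Fin n ↦ t ^ (j + 1 : ℕ) • z.2 j) := rfl

theorem weightMap_one (z : P × (Fin n → R)) : weightMap P 1 z = z := by
  simp [weightMap_apply]

theorem weightMap_mul (s t : ℝ) (z : P × (Fin n → R)) :
    weightMap P (s * t) z = weightMap P s (weightMap P t z) := by
  simp [weightMap_apply, mul_pow, mul_smul]

variable (P) in
/-- The action of `t ≠ 0` on `P × R ^ n` as a linear automorphism. -/
def weightEquiv (t : ℝ) (ht : t ≠ 0) : (P × (Fin n → R)) ≃L[ℝ] P × (Fin n → R) :=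
  ContinuousLinearEquiv.equivOfInverse (weightMap P t) (weightMap P t⁻¹)
    (fun z ↦ by rw [← weightMap_mul, inv_mul_cancel₀ ht, weightMap_one])
    (fun z ↦ by rw [← weightMap_mul, mul_inv_cancel₀ ht, weightMap_one])

theorem contDiff_weightMap :
    ContDiff ℝ ∞ fun p : ℝ × (P × (Fin n → R)) ↦ weightMap P p.1 p.2 := by
  refine ContDiff.prodMk (contDiff_fst.comp contDiff_snd) (contDiff_pi.2 fun j ↦ ?_)
  refine ContDiff.smul (contDiff_fst.pow _) ?_
  exact ((ContinuousLinearMap.proj (R := ℝ) (φ := fun _ : Fin n ↦ R) j).comp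
    (ContinuousLinearMap.snd ℝ P (Fin n → R))).contDiff.comp contDiff_snd

theorem contMDiffAt_weightMap {G H N : Type*} [NormedAddCommGroup G] [NormedSpace ℝ G]
    [TopologicalSpace H] {I : ModelWithCorners ℝ G H} [TopologicalSpace N] [ChartedSpace H N]
    {τ : N → ℝ} {f : N → P × (Fin n → R)} {x : N} (hτ : ContMDiffAt I 𝓘(ℝ, ℝ) ∞ τ x)
    (hf : ContMDiffAt I 𝓘(ℝ, P × (Fin n → R)) ∞ f x) :
    ContMDiffAt I 𝓘(ℝ, P × (Fin n → R)) ∞ (fun y ↦ weightMap P (τ y) (f y)) x :=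
  ContMDiffAt.comp (I' := 𝓘(ℝ, ℝ × (P × (Fin n → R)))) x
    (g := fun p : ℝ × (P × (Fin n → R)) ↦ weightMap P p.1 p.2) (f := fun y ↦ (τ y, f y))
    contDiff_weightMap.contDiffAt.contMDiffAt (hτ.prodMk_space hf)

/-- The action `weightMap` is diagonal, with weights at most `n`. -/
theorem exists_homogeneous_basis [FiniteDimensional ℝ P] [FiniteDimensional ℝ R] :
    ∃ (m : ℕ) (b : Module.Basis (Fin m) ℝ (P × (Fin n → R))) (w : Fin m → ℕ),
      (∀ i, w i ≤ n) ∧ ∀ t z i, b.repr (weightMap P t z) i = t ^ w i * b.repr z i := by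
  let b₀ := (Module.finBasis ℝ P).prod (Pi.basis fun _ : Fin n ↦ Module.finBasis ℝ R)
  let e := Fintype.equivFin
    (Fin (Module.finrank ℝ P) ⊕ (Σ _ : Fin n, Fin (Module.finrank ℝ R)))
  let w₀ : Fin (Module.finrank ℝ P) ⊕ (Σ _ : Fin n, Fin (Module.finrank ℝ R)) → ℕ :=
    Sum.elim (fun _ ↦ 0) fun j ↦ j.1 + 1
  refine ⟨_, b₀.reindex e, w₀ ∘ e.symm, fun i ↦ ?_, fun t z i ↦ ?_⟩
  · rw [Function.comp_apply]
    cases e.symm i with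
    | inl i => exact Nat.zero_le _
    | inr j => exact j.1.2
  · rw [Module.Basis.repr_reindex_apply, Module.Basis.repr_reindex_apply, Function.comp_apply]
    cases e.symm i with
    | inl i => simp [b₀, w₀, weightMap_apply]
    | inr j => simp [b₀, w₀, weightMap_apply]

end Weights

variable {E R M : Type*} [NormedAddCommGroup E] [NormedSpace ℝ E] [NormedAddCommGroup R]
  [NormedSpace ℝ R] [TopologicalSpace M] [ChartedSpace E M] [IsManifold 𝓘(ℝ, E) ∞ M]
  {A : M → Type*} [∀ x, AddCommGroup (A x)] [∀ x, Module ℝ (A x)] [∀ x, TopologicalSpace (A x)]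
  [TopologicalSpace (TotalSpace R A)] [FiberBundle R A] [VectorBundle ℝ R A]
  [ContMDiffVectorBundle ∞ R A 𝓘(ℝ, E)]

namespace AnchoredBundle

variable (𝓐 : AnchoredBundle E R A) [FiniteDimensional ℝ E] [FiniteDimensional ℝ R] {n : ℕ}

theorem extChartAt_homogeneity (t : ℝ) {q₀ q : 𝓐.HigherBundle n}
    (h : q.base ∈ chartDomain E R A q₀.base) :
    extChartAt 𝓘(ℝ, E × (Fin n → R)) q₀ (𝓐.homogeneity n t q) =
      weightMap E t (extChartAt 𝓘(ℝ, E × (Fin n → R)) q₀ q) :=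
  𝓐.jetCoord_homogeneity t h

theorem baseCoord_mfderiv_homogeneity (t : ℝ) {q₀ q : 𝓐.HigherBundle n}
    (h : q.base ∈ chartDomain E R A q₀.base) (Z : TangentSpace 𝓘(ℝ, E × (Fin n → R)) q) :
    baseCoord (E × (Fin n → R)) q₀ (𝓐.homogeneity n t q) (mfderiv 𝓘(ℝ, E × (Fin n → R))
      𝓘(ℝ, E × (Fin n → R)) (𝓐.homogeneity n t) q Z) =
      weightMap E t (baseCoord (E × (Fin n → R)) q₀ q Z) := by
  have h1 := (hasMFDerivAt_extChartAt_base (EN := E × (Fin n → R)) (q₀ := q₀)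
    (q := 𝓐.homogeneity n t q) h).comp q
    ((𝓐.contMDiff_homogeneity n t).mdifferentiableAt (by simp) (x := q)).hasMFDerivAt
  have h2 := ((weightMap E t).hasMFDerivAt (x := extChartAt 𝓘(ℝ, E × (Fin n → R)) q₀ q)).comp q
    (hasMFDerivAt_extChartAt_base (EN := E × (Fin n → R)) (q₀ := q₀) (q := q) h)
  have h3 := h2.congr_of_eventuallyEq (f₁ := extChartAt 𝓘(ℝ, E × (Fin n → R)) q₀ ∘
    𝓐.homogeneity n t) (by
      filter_upwards [eventually_base_mem h] with q' hq'
      exact 𝓐.extChartAt_homogeneity t hq')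
  exact congrArg (fun L ↦ L Z) (hasMFDerivAt_unique h1 h3)

/-- The component in `A` of a vector of the prolongation has weight `0`, and its components along the
fibres of `A^n → M` have the weights of the corresponding coordinates of `A^n`. -/
theorem fibreCoord_prHomogeneity (t : ℝ) {q₀ q : 𝓐.HigherBundle n}
    (h : q.base ∈ chartDomain E R A q₀.base) (v : 𝓐.Prolongation n q) :
    fibreCoord (R × (Fin n → R)) (𝓐.Prolongation n) q₀ (𝓐.homogeneity n t q)
      (𝓐.prHomogeneity t q v) =
      weightMap R t (fibreCoord (R × (Fin n → R)) (𝓐.Prolongation n) q₀ q v) := by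
  rw [𝓐.fibreCoord_prolongation h, 𝓐.fibreCoord_prolongation (q := 𝓐.homogeneity n t q) h]
  refine Prod.ext rfl ?_
  exact congrArg (fun z : E × (Fin n → R) ↦ z.2) (𝓐.baseCoord_mfderiv_homogeneity t h (𝓐.prSnd q v))

theorem adaptedChart_scale (t : ℝ) {q₀ : 𝓐.HigherBundle n}
    {η : TotalSpace (R × (Fin n → R)) (𝓐.Prolongation n)}
    (h : η.proj.base ∈ chartDomain E R A q₀.base) :
    adaptedChart (E × (Fin n → R)) (R × (Fin n → R)) (𝓐.Prolongation n) q₀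
      (scale (R × (Fin n → R)) 𝓐.prHomogeneity t η) =
      (weightMap E t (adaptedChart (E × (Fin n → R)) (R × (Fin n → R)) (𝓐.Prolongation n) q₀ η).1,
       weightMap R t
        (adaptedChart (E × (Fin n → R)) (R × (Fin n → R)) (𝓐.Prolongation n) q₀ η).2) := by
  obtain ⟨q, v⟩ := η
  rw [scale, adaptedChart_mk (𝓐.mem_chartDomain_prolongation.2 h),
    adaptedChart_mk (q := 𝓐.homogeneity n t q) (𝓐.mem_chartDomain_prolongation.2 h),
    𝓐.extChartAt_homogeneity t h, 𝓐.fibreCoord_prHomogeneity t h]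

theorem contMDiff_scale (n : ℕ) :
    ContMDiff (𝓘(ℝ, ℝ).prod (𝓘(ℝ, E × (Fin n → R)).prod 𝓘(ℝ, R × (Fin n → R))))
      (𝓘(ℝ, E × (Fin n → R)).prod 𝓘(ℝ, R × (Fin n → R))) ∞
      (fun p : ℝ × TotalSpace (R × (Fin n → R)) (𝓐.Prolongation n) ↦
        scale (R × (Fin n → R)) 𝓐.prHomogeneity p.1 p.2) := by
  rintro ⟨t₀, η₀⟩
  let c := adaptedChart (E × (Fin n → R)) (R × (Fin n → R)) (𝓐.Prolongation n) η₀.proj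
  have h0 := mem_chartDomain_self (E := E) (R := R) (A := A) η₀.proj.base
  have hs : ∀ {η : TotalSpace (R × (Fin n → R)) (𝓐.Prolongation n)},
      η.proj.base ∈ chartDomain E R A η₀.proj.base → η ∈ c.source := fun h ↦
    mem_adaptedChart_source.2 (𝓐.mem_chartDomain_prolongation.2 h)
  have hc : ContMDiffAt (𝓘(ℝ, E × (Fin n → R)).prod 𝓘(ℝ, R × (Fin n → R)))
      𝓘(ℝ, (E × (Fin n → R)) × (R × (Fin n → R))) ∞ c η₀ :=
    contMDiffAt_extChartAt' (mem_chart_source_total (𝓐.mem_chartDomain_prolongation.2 h0))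
  have hcp : ContMDiffAt (𝓘(ℝ, ℝ).prod (𝓘(ℝ, E × (Fin n → R)).prod 𝓘(ℝ, R × (Fin n → R))))
      𝓘(ℝ, (E × (Fin n → R)) × (R × (Fin n → R))) ∞
      (fun p : ℝ × TotalSpace (R × (Fin n → R)) (𝓐.Prolongation n) ↦ c p.2) (t₀, η₀) :=
    hc.comp (t₀, η₀) contMDiffAt_snd
  have h4 : ContMDiffAt (𝓘(ℝ, ℝ).prod (𝓘(ℝ, E × (Fin n → R)).prod 𝓘(ℝ, R × (Fin n → R))))
      𝓘(ℝ, ℝ) ∞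
      (fun p : ℝ × TotalSpace (R × (Fin n → R)) (𝓐.Prolongation n) ↦ p.1) (t₀, η₀) :=
    contMDiffAt_fst
  have h1 := contMDiffAt_weightMap h4
    ((ContinuousLinearMap.fst ℝ (E × (Fin n → R)) (R × (Fin n → R))).contMDiff.contMDiffAt.comp
      (t₀, η₀) hcp)
  have h2 := contMDiffAt_weightMap h4
    ((ContinuousLinearMap.snd ℝ (E × (Fin n → R)) (R × (Fin n → R))).contMDiff.contMDiffAt.comp
      (t₀, η₀) hcp)
  have e : ∀ p : ℝ × TotalSpace (R × (Fin n → R)) (𝓐.Prolongation n),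
      p.2.proj.base ∈ chartDomain E R A η₀.proj.base →
      c (scale (R × (Fin n → R)) 𝓐.prHomogeneity p.1 p.2) =
        (weightMap E p.1 (c p.2).1, weightMap R p.1 (c p.2).2) := fun p hp ↦
    𝓐.adaptedChart_scale p.1 hp
  have ht : (weightMap E t₀ (c η₀).1, weightMap R t₀ (c η₀).2) ∈ c.target := by
    rw [← e (t₀, η₀) h0]
    exact c.map_source (hs h0)
  have h3 := ((contMDiffOn_adaptedChart_symm η₀.proj).contMDiffAt
    ((isOpen_adaptedChart_target η₀.proj).mem_nhds ht)).comp (t₀, η₀) (h1.prodMk_space h2)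
  refine h3.congr_of_eventuallyEq ?_
  -- near `(t₀, η₀)` the action is the composition of the chart, of `weightMap`, and of the inverse of
  -- the chart
  have hev : ∀ᶠ p : ℝ × TotalSpace (R × (Fin n → R)) (𝓐.Prolongation n) in 𝓝 (t₀, η₀),
      p.2.proj ∈ chartDomain (E × (Fin n → R)) (R × (Fin n → R)) (𝓐.Prolongation n) η₀.proj :=
    continuousAt_snd.eventually
      (eventually_mem_chartDomain_proj (𝓐.mem_chartDomain_prolongation.2 h0))
  filter_upwards [hev] with p hp
  have hp' := 𝓐.mem_chartDomain_prolongation.1 hp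
  change _ = c.symm (weightMap E p.1 (c p.2).1, weightMap R p.1 (c p.2).2)
  rw [← e p hp', c.left_inv]
  exact hs (η := scale (R × (Fin n → R)) 𝓐.prHomogeneity p.1 p.2) hp'

theorem isGradedLinear_prolongation (n : ℕ) :
    IsGradedLinear (EN := E × (Fin n → R)) (F := R × (Fin n → R))
      (𝓐.Prolongation n) (n + 1) (𝓐.homogeneity n) 𝓐.prHomogeneity where
  one := by
    funext η
    have h := mem_chartDomain_self (E := E) (R := R) (A := A) η.proj.base
    refine eq_of_adaptedChart_eq (EN := E × (Fin n → R)) (q₀ := η.proj)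
      (𝓐.mem_chartDomain_prolongation.2 h) (𝓐.mem_chartDomain_prolongation.2 h) ?_
    rw [𝓐.adaptedChart_scale 1 h, weightMap_one, weightMap_one]
    rfl
  mul s t := by
    funext η
    have h := mem_chartDomain_self (E := E) (R := R) (A := A) η.proj.base
    refine eq_of_adaptedChart_eq (EN := E × (Fin n → R)) (q₀ := η.proj)
      (𝓐.mem_chartDomain_prolongation.2 h) (𝓐.mem_chartDomain_prolongation.2 h) ?_
    rw [𝓐.adaptedChart_scale _ h, Function.comp_apply, 𝓐.adaptedChart_scale (q₀ := η.proj) s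
      (η := scale (R × (Fin n → R)) 𝓐.prHomogeneity t η) h, 𝓐.adaptedChart_scale t h,
      weightMap_mul, weightMap_mul]
  contMDiff := 𝓐.contMDiff_scale n
  homogeneous_coordinates q₀ := by
    obtain ⟨m, b, w, hw, hb⟩ := exists_homogeneous_basis (P := E) (R := R) (n := n)
    obtain ⟨m', b', w', hw', hb'⟩ := exists_homogeneous_basis (P := R) (R := R) (n := n)
    refine ⟨chartAt _ q₀, IsManifold.chart_mem_maximalAtlas q₀,
      trivializationAt (R × (Fin n → R)) (𝓐.Prolongation n) q₀, inferInstance,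
      mem_chart_source _ q₀, fun q hq ↦ hq, m, m', b, b', w, w', hw, hw',
      fun t q hq ↦ ⟨hq, fun i ↦ ?_, fun v j ↦ ?_⟩⟩
    · rw [← hb]
      exact congrArg (fun z ↦ b.repr z i) (𝓐.extChartAt_homogeneity t hq)
    · have h := 𝓐.mem_chartDomain_prolongation.2 hq
      have h' := 𝓐.mem_chartDomain_prolongation (q₀ := q₀) (q := 𝓐.homogeneity n t q).2 hq
      rw [← hb', ← Trivialization.continuousLinearMapAt_apply_of_mem ℝ _ h.2,
        ← Trivialization.continuousLinearMapAt_apply_of_mem ℝ _ h'.2]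
      exact congrArg (fun z ↦ b'.repr z j) (𝓐.fibreCoord_prHomogeneity t hq v)

end AnchoredBundle

namespace AlmostLieAlgebroid

variable (𝓐 : AlmostLieAlgebroid E R A) [FiniteDimensional ℝ E] [FiniteDimensional ℝ R] [T2Space M]

/-! ### The algebroid structure of the prolongation -/

/-- Every vector of the prolongation is the value of a projectable section. The section with constant
coordinates is cut off by a function on `M`, so that it remains projectable. -/
theorem exists_projectable_section {n : ℕ} {q : 𝓐.HigherBundle n}
    (v : 𝓐.toAnchoredBundle.Prolongation n q) :
    ∃ (S : ContMDiffSection 𝓘(ℝ, E × (Fin n → R)) (R × (Fin n → R)) ∞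
        (𝓐.toAnchoredBundle.Prolongation n)) (X : ContMDiffSection 𝓘(ℝ, E) R ∞ A),
      (∀ q, 𝓐.prFst q (S q) = X q.base) ∧ S q = v := by
  have h := mem_chartDomain_self (E := E) (R := R) (A := A) q.base
  have hq := 𝓐.mem_chartDomain_prolongation.2 h
  obtain ⟨χ, h1, h2, h3⟩ := exists_cutoff (EN := E) (eventually_mem_chartDomain h)
  set z := fibreCoord (R × (Fin n → R)) (𝓐.toAnchoredBundle.Prolongation n) q q v with hz
  refine ⟨⟨_, contMDiff_cutoff_section (V := 𝓐.toAnchoredBundle.Prolongation n) (q₀ := q)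
    (χ := fun q' ↦ χ q'.base) (h1.comp (𝓐.contMDiff_base n)) (fun q' hq' ↦ ?_)
    (contMDiffOn_const (c := z))⟩, ⟨_, contMDiff_cutoff_section h1 h2
      (contMDiffOn_const (c := z.1))⟩, fun q' ↦ ?_, ?_⟩
  · exact 𝓐.mem_chartDomain_prolongation.2 (h2 (tsupport_comp_subset_preimage χ
      (𝓐.contMDiff_base n).continuous hq'))
  · change 𝓐.prFst q' (χ q'.base • _) = χ q'.base • fibreVec R A q.base q'.base z.1
    rw [map_smul]
    by_cases hq' : q'.base ∈ chartDomain E R A q.base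
    · rw [𝓐.fibreVec_prolongation hq', 𝓐.prFst_prSymm hq']
    · rw [image_eq_zero_of_notMem_tsupport fun h ↦ hq' (h2 h), zero_smul, zero_smul]
  · change χ q.base • fibreVec _ _ q q z = v
    rw [h3.self_of_nhds, Pi.one_apply, one_smul, hz, fibreVec_fibreCoord hq]

/-- The skew algebroid structure on the prolongation: its anchor is `(Y, Z) ↦ Z`, and its bracket is
that of projectable sections. -/
def prSkewStructure (n : ℕ) : SkewStructure (E × (Fin n → R)) (R × (Fin n → R))
    (𝓐.toAnchoredBundle.Prolongation n) where
  anchor := 𝓐.prSnd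
  C := 𝓐.prStructFun
  contMDiffOn_anchorRep q₀ := by
    refine contMDiffOn_clm fun z ↦ ?_
    refine (((𝓐.contMDiffOn_localAnchorMap_base n q₀).clm_apply
      (contMDiffOn_const (c := z.1))).prodMk_space (contMDiffOn_const (c := z.2))).congr
        fun q hq ↦ ?_
    rw [𝓐.anchorRep_prSnd (𝓐.mem_chartDomain_prolongation.1 hq)]
    rfl
  contMDiffOn_C q₀ := by
    refine contMDiffOn_clm fun z ↦ contMDiffOn_clm fun z' ↦ ?_
    have h := (𝓐.contMDiffOn_structFun q₀.base).comp (𝓐.contMDiff_base n).contMDiffOn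
      (s := chartDomain (E × (Fin n → R)) (R × (Fin n → R))
        (𝓐.toAnchoredBundle.Prolongation n) q₀)
      fun q hq ↦ 𝓐.mem_chartDomain_prolongation.1 hq
    exact ((h.clm_apply (contMDiffOn_const (c := z.1))).clm_apply
      (contMDiffOn_const (c := z'.1))).prodMk_space contMDiffOn_const
  skew q₀ q hq z z' := by
    rw [prStructFun_apply, prStructFun_apply,
      𝓐.structFun_skew (𝓐.mem_chartDomain_prolongation.1 hq)]
    exact Prod.ext rfl neg_zero.symm
  exists_bracket q e e' := by
    obtain ⟨S, X, hS, rfl⟩ := 𝓐.exists_projectable_section e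
    obtain ⟨S', X', hS', rfl⟩ := 𝓐.exists_projectable_section e'
    exact ⟨S, S', projectableBracket hS hS', rfl, rfl, fun q₀ hq ↦
      localRep_projectableBracket hS hS' (𝓐.mem_chartDomain_prolongation.1 hq)⟩

/-- The homogeneity structure preserves the anchor and the structure functions of the
prolongation, since the latter do not involve the coordinates of positive weight. -/
theorem isChartAutomorphism_homogeneity {n : ℕ} {t : ℝ} (ht : t ≠ 0) (q₀ : 𝓐.HigherBundle n) :
    (𝓐.prSkewStructure n).IsChartAutomorphism q₀ (𝓐.homogeneity n t) (𝓐.prHomogeneity t)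
      (weightEquiv E t ht) (weightEquiv R t ht) where
  mem _ hq := hq
  base _ hq := 𝓐.extChartAt_homogeneity t (𝓐.mem_chartDomain_prolongation.1 hq)
  fibre _ hq v := 𝓐.fibreCoord_prHomogeneity t (𝓐.mem_chartDomain_prolongation.1 hq) v
  anchor q hq y := by
    have h := 𝓐.mem_chartDomain_prolongation.1 hq
    change anchorRep _ 𝓐.prSnd q₀ _ _ = weightEquiv E t ht (anchorRep _ 𝓐.prSnd q₀ q y)
    rw [𝓐.anchorRep_prSnd h, 𝓐.anchorRep_prSnd (q := 𝓐.homogeneity n t q) h]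
    rfl
  bracket q hq y y' := by
    refine Prod.ext rfl (funext fun j ↦ ?_)
    exact (smul_zero (t ^ (j + 1 : ℕ))).symm

end AlmostLieAlgebroid
end HigherAlgebroid

end

theorem mainTheorem2 {E R M : Type*} [NormedAddCommGroup E] [NormedSpace ℝ E]
    [FiniteDimensional ℝ E] [NormedAddCommGroup R] [NormedSpace ℝ R] [FiniteDimensional ℝ R]
    [TopologicalSpace M] [ChartedSpace E M] [IsManifold 𝓘(ℝ, E) ∞ M] [T2Space M]
    [SecondCountableTopology M] {A : M → Type*} [∀ x, AddCommGroup (A x)] [∀ x, Module ℝ (A x)]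
    [∀ x, TopologicalSpace (A x)] [TopologicalSpace (TotalSpace R A)] [FiberBundle R A]
    [VectorBundle ℝ R A] [ContMDiffVectorBundle ∞ R A 𝓘(ℝ, E)]
    (𝓐 : HigherAlgebroid.AlmostLieAlgebroid E R A) (k : ℕ) (hk : 1 ≤ k) :
    GLBundle.IsGradedLinear (EN := E × (Fin (k - 1) → R)) (F := R × (Fin (k - 1) → R))
      (𝓐.Prolongation (k - 1)) k (𝓐.homogeneity (k - 1)) 𝓐.prHomogeneity ∧
    ∃ 𝓔 : GLBundle.WeightedAlgebroid (EN := E × (Fin (k - 1) → R)) (F := R × (Fin (k - 1) → R))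
        (V := 𝓐.Prolongation (k - 1)) k (𝓐.homogeneity (k - 1)) 𝓐.prHomogeneity,
      𝓔.IsSkew ∧ 𝓔.HasAnchor 𝓐.prSnd ∧
      ∀ (S S' : ContMDiffSection 𝓘(ℝ, E × (Fin (k - 1) → R)) (R × (Fin (k - 1) → R)) ∞
          (𝓐.Prolongation (k - 1))) (X X' : ContMDiffSection 𝓘(ℝ, E) R ∞ A),
        (∀ q, 𝓐.prFst q (S q) = X q.base) → (∀ q, 𝓐.prFst q (S' q) = X' q.base) →
        ∃ T : ContMDiffSection 𝓘(ℝ, E × (Fin (k - 1) → R)) (R × (Fin (k - 1) → R)) ∞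
            (𝓐.Prolongation (k - 1)),
          (∀ q, 𝓐.prFst q (T q) = 𝓐.bracket X X' q.base) ∧
          (∀ q, 𝓐.prSnd q (T q) = VectorField.mlieBracket 𝓘(ℝ, E × (Fin (k - 1) → R))
            (fun q ↦ 𝓐.prSnd q (S q)) (fun q ↦ 𝓐.prSnd q (S' q)) q) ∧
          𝓔.IsBracket S S' T := by
  obtain ⟨n, rfl⟩ := Nat.exists_eq_add_of_le' hk
  have H : ∀ t : ℝ, t ≠ 0 → ∀ q₀ : 𝓐.HigherBundle n,
      ∃ (ℓ : (E × (Fin n → R)) ≃L[ℝ] E × (Fin n → R))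
        (m : (R × (Fin n → R)) ≃L[ℝ] R × (Fin n → R)),
        (𝓐.prSkewStructure n).IsChartAutomorphism q₀ (𝓐.homogeneity n t) (𝓐.prHomogeneity t) ℓ m :=
    fun t ht q₀ ↦ ⟨_, _, 𝓐.isChartAutomorphism_homogeneity ht q₀⟩
  exact ⟨𝓐.isGradedLinear_prolongation n, (𝓐.prSkewStructure n).toWeightedAlgebroid H,
    (𝓐.prSkewStructure n).isSkew H, (𝓐.prSkewStructure n).hasAnchor H,
    fun S S' X X' hS hS' ↦
      ⟨HigherAlgebroid.AlmostLieAlgebroid.projectableBracket hS hS', fun _ ↦ rfl, fun _ ↦ rfl,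
        (𝓐.prSkewStructure n).isBracket H fun q ↦
          HigherAlgebroid.AlmostLieAlgebroid.localRep_projectableBracket hS hS'
            (HigherAlgebroid.mem_chartDomain_self q.base)⟩⟩
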